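/- Let $T\in M(n;\mathbb C)$ be a singular matrix whose imaginary part is positive definite, and let $\delta\in M(n;\mathbb Z)$ be such that $T-\delta$ is non-singular. Put $T'=(-T+\delta)^{-1}$, and let $\varphi:\mathbb C^n/2\pi(\mathbb Z^n\oplus T\mathbb Z^n)\to\mathbb C^n/2\pi(\mathbb Z^n\oplus T'\mathbb Z^n)$ be the biholomorphic map $\varphi(z)=(-T+\delta)^{-1}z$. In the real coordinates given by $z=x+Ty$ and $Z=X+T'Y$ it is $(x,y)\mapsto(X,Y)=(-y,x+\delta y)$. *Complex side.* Let $r\in\mathbb N$ be positive, $A=(a_{kj})\in M(n;\mathbb Z)$, $p,q\in\mathbb R^n$, $\mu=p+T'^tq$. If $d_1\mid d_2\mid\cdots\mid d_n$ are the elementary divisors of $A$ (zeros included), put $r'=\prod_i r/\gcd(r,d_i)$. Let $\mathcal U$ consist of $V_j,U_k\in U(r')$ $(1\le j,k\le n)$ with $V_jV_k=V_kV_j$, $U_jU_k=U_kU_j$, $\zeta^{-a_{kj}}U_kV_j=V_jU_k$, where $\zeta=e^{2\pi\mathbf i/r}$. The bundle $E_{(r,A,\mu,\mathcal U)}$ of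 rank $r'$ on $\mathbb C^n/2\pi(\mathbb Z^n\oplus T'\mathbb Z^n)$ has the transition functions $e^{\frac{\mathbf i}{r}\sum_i a_{ij}Y_i}V_j$ along $X_j\mapsto X_j+2\pi$ and $U_k$ along $Y_k\mapsto Y_k+2\pi$, and the connection $d-\frac{\mathbf i}{2\pi}\bigl(\frac1rX^tA^t+\frac1r\mu^t\bigr)dY\cdot I_{r'}$. The objects of the DG-category $\mathcal{DG}^{\varphi}_{T^{2n}_{J=T}}$ are the bundles with connection $\varphi^*E_{(r,A,\mu,\mathcal U)}$ which are holomorphic (the $(0,2)$-part of the curvature vanishes) and simple. Two objects are isomorphic if they are isomorphic as holomorphic vector bundles, i.e. by closed morphisms of degree $0$. *Symplectic side.* Let $\check T^{2n}_{J=T}$ be the torus $\mathbb R^{2n}/2\pi\mathbb Z^{2n}$ with coordinates $(\check x,\check y)$ and the complexified symplectic form $d\check x^t(T-\delta)d\check y$ (the symplectic form is $d\check x^t\,\mathrm{Im}(T-\delta)\,d\check y$, the B-field is $d\check x^t\,\mathrm{Re}(T-\delta)\,d\check y$). The objects of $Fuk_{\rm aff}(\check T^{2n}_{J=T})$ are the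 pairs $(\tilde L_{(r,A,p)},\tilde{\mathcal L}_{(r,A,p,q)})$, where $\tilde L_{(r,A,p)}=\{\check x=-\frac1rA\check y+\frac1rp\}$ is Lagrangian and $\tilde{\mathcal L}_{(r,A,p,q)}$ is the trivial line bundle on it with the connection $d+\frac{\mathbf i}{2\pi}\frac1rq^td\check y$, whose curvature has to be $2\pi\mathbf i$ times the restriction of the B-field. Two such pairs are isomorphic if the submanifolds are equal and the line bundles with connection are isomorphic. *Angles.* Choose for every triple $(r,A,\mathcal U)$ real vectors $\xi=\xi(r,A,\mathcal U)$, $\theta=\theta(r,A,\mathcal U)\in\mathbb R^n$ with $e^{\mathbf i\xi_j}=\det V_j$ and $e^{\mathbf i\theta_k}=\det U_k$, and put $p(\theta)=p-\frac r{r'}\theta$, $q(\xi)=q+\frac r{r'}\xi$. Call the choice consistent if for any two triples $(r,A,\mathcal U)$, $(s,B,\hat{\mathcal U})$ with $\frac1rA=\frac1sB$ (which have the same $r'$), with matrices $V_j,U_k$ and $\hat V_j,\hat U_k$ and angles $\xi,\theta$ and $\hat\xi,\hat\theta$, there is an invertible matrix $g$ with $$\hat V_j=e^{\mathbf i(\hat\xi_j-\xi_j)/r'}\,gV_jg^{-1},\qquad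 \hat U_k=e^{\mathbf i(\hat\theta_k-\theta_k)/r'}\,gU_kg^{-1}\qquad(1\le j,k\le n).$$ **Theorem.** For every choice of angles, the pair $(\tilde L_{(r,A,p(\theta))},\tilde{\mathcal L}_{(r,A,p(\theta),q(\xi))})$ attached to an object $\varphi^*E_{(r,A,\mu,\mathcal U)}$ of $\mathcal{DG}^{\varphi}_{T^{2n}_{J=T}}$ is an object of $Fuk_{\rm aff}(\check T^{2n}_{J=T})$. Consistent choices of angles exist, and for every consistent choice the map $$\varphi^*E_{(r,A,\mu,\mathcal U)}\longmapsto(\tilde L_{(r,A,p(\theta))},\tilde{\mathcal L}_{(r,A,p(\theta),q(\xi))})$$ is well defined on isomorphism classes and induces a bijection between the isomorphism classes of objects of $\mathcal{DG}^{\varphi}_{T^{2n}_{J=T}}$ and the isomorphism classes of objects of $Fuk_{\rm aff}(\check T^{2n}_{J=T})$. -/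

import Mathlib

open Matrix
open scoped ContDiff Real

noncomputable section

namespace TorusMirror

/-! ### Real tori, complex structures, vector bundles with connection -/

/-- The universal cover `ℝⁿ × ℝⁿ` (coordinates `(x, y)`) of the torus `ℝ²ⁿ / 2πℤ²ⁿ`. -/
abbrev Cover (n : ℕ) : Type := (Fin n → ℝ) × (Fin n → ℝ)

/-- Deck transformations of the universal cover. -/
abbrev Deck (n : ℕ) : Type := (Fin n → ℤ) × (Fin n → ℤ)

/-- The torus `ℝ²ⁿ / 2πℤ²ⁿ`. -/
abbrev Torus (n : ℕ) : Type := (Fin n → AddCircle (2 * π)) × (Fin n → AddCircle (2 * π))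

/-- The translation vector `2πk` of a deck transformation `k`. -/
def period {n : ℕ} (k : Deck n) : Cover n :=
  (fun i => 2 * π * (k.1 i : ℝ), fun i => 2 * π * (k.2 i : ℝ))

/-- An integer matrix as a real matrix. -/
abbrev toR {n : ℕ} (A : Matrix (Fin n) (Fin n) ℤ) : Matrix (Fin n) (Fin n) ℝ :=
  A.map (fun a => (a : ℝ))

/-- An integer matrix as a complex matrix. -/
abbrev toC {n : ℕ} (A : Matrix (Fin n) (Fin n) ℤ) : Matrix (Fin n) (Fin n) ℂ :=
  A.map (fun a => (a : ℂ))

/-- The complex coordinate `z = x + T y`. It identifies `ℝ²ⁿ / 2πℤ²ⁿ` with the complex torus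
`ℂⁿ / 2π(ℤⁿ ⊕ Tℤⁿ)`. Being linear, it is also the `ℂⁿ`-valued one-form `dz = dx + T dy`. -/
def zcoord {n : ℕ} (T : Matrix (Fin n) (Fin n) ℂ) (u : Cover n) : Fin n → ℂ :=
  (fun i => (u.1 i : ℂ)) + T *ᵥ (fun i => (u.2 i : ℂ))

/-- The complexified tangent vector `v + 𝐢 w` is of type `(0,1)`, i.e. `dz` vanishes on it. -/
def IsType01 {n : ℕ} (T : Matrix (Fin n) (Fin n) ℂ) (v w : Cover n) : Prop :=
  zcoord T v + Complex.I • zcoord T w = 0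

/-- A complex vector bundle on `ℝ²ⁿ / 2πℤ²ⁿ` together with a connection `d + ω · Id`, `ω` a scalar
one-form on the cover. The bundle is given by transition functions: its smooth sections are the
smooth vector valued functions `s` on the cover with `s (u + 2πk) = mult k u * s u`. -/
structure TorusBundle (n : ℕ) where
  /-- the rank of the bundle -/
  rank : ℕ
  /-- the transition functions -/
  mult : Deck n → Cover n → Matrix (Fin rank) (Fin rank) ℂ
  /-- the scalar one-form `ω`: `form u v` is its value at `u` on the tangent vector `v` -/
  form : Cover n → Cover n →ₗ[ℝ] ℂ
  mult_zero : ∀ u, mult 0 u = 1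
  /-- the cocycle condition -/
  mult_add : ∀ k l u, mult (k + l) u = mult k (u + period l) * mult l u
  mult_smooth : ∀ k a b, ContDiff ℝ ∞ (fun u => mult k u a b)
  form_smooth : ∀ v, ContDiff ℝ ∞ (fun u => form u v)
  /-- `d + ω · Id` is compatible with the transition functions -/
  compat : ∀ k u v a b, fderiv ℝ (fun x => mult k x a b) u v
    + (form (u + period k) v - form u v) * mult k u a b = 0

namespace TorusBundle

variable {n : ℕ}

/-- The curvature of the connection `d + ω · Id` is `curvature · Id`, where `curvature = dω`. -/
def curvature (B : TorusBundle n) (u v w : Cover n) : ℂ :=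
  fderiv ℝ (fun x => B.form x w) u v - fderiv ℝ (fun x => B.form x v) u w

/-- The bundle with its connection is holomorphic on `ℂⁿ / 2π(ℤⁿ ⊕ Tℤⁿ)`: the `(0,2)`-part of the
curvature form vanishes, i.e. the complex bilinear extension of the curvature form vanishes on all
pairs of vectors `v₁ + 𝐢 w₁`, `v₂ + 𝐢 w₂` of type `(0,1)`. -/
def IsHolomorphic (T : Matrix (Fin n) (Fin n) ℂ) (B : TorusBundle n) : Prop :=
  ∀ u v₁ w₁ v₂ w₂ : Cover n, IsType01 T v₁ w₁ → IsType01 T v₂ w₂ →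
    (B.curvature u v₁ v₂ - B.curvature u w₁ w₂
      + Complex.I * (B.curvature u v₁ w₂ + B.curvature u w₁ v₂))
      • (1 : Matrix (Fin B.rank) (Fin B.rank) ℂ) = 0

/-- The covariant derivative `dψ + ω' ψ - ψ ω` of a section `ψ` of `Hom(B, B')`. -/
def covDeriv (B B' : TorusBundle n) (ψ : Cover n → Matrix (Fin B'.rank) (Fin B.rank) ℂ)
    (u v : Cover n) : Matrix (Fin B'.rank) (Fin B.rank) ℂ :=
  Matrix.of fun a b =>
    fderiv ℝ (fun x => ψ x a b) u v + (B'.form u v - B.form u v) * ψ u a b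

/-- `ψ` is a holomorphic bundle map `B → B'`, i.e. a closed morphism of degree `0` of the
DG-category whose morphism complexes are the `Hom(B, B')`-valued `(0,•)`-forms with the
differential induced by the `(0,1)`-parts of the connections: `ψ` is a smooth section of
`Hom(B, B')` and the `(0,1)`-part of its covariant derivative vanishes. -/
structure IsHolHom (T : Matrix (Fin n) (Fin n) ℂ) (B B' : TorusBundle n)
    (ψ : Cover n → Matrix (Fin B'.rank) (Fin B.rank) ℂ) : Prop where
  smooth : ∀ a b, ContDiff ℝ ∞ (fun u => ψ u a b)
  equivariant : ∀ k u, ψ (u + period k) * B.mult k u = B'.mult k u * ψ u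
  dbar_closed : ∀ u v w, IsType01 T v w →
    covDeriv B B' ψ u v + Complex.I • covDeriv B B' ψ u w = 0

/-- `B` and `B'` are isomorphic (as holomorphic vector bundles; equivalently in the degree `0`
cohomology of the DG-category). -/
def Isomorphic (T : Matrix (Fin n) (Fin n) ℂ) (B B' : TorusBundle n) : Prop :=
  ∃ (ψ : Cover n → Matrix (Fin B'.rank) (Fin B.rank) ℂ)
    (χ : Cover n → Matrix (Fin B.rank) (Fin B'.rank) ℂ),
    IsHolHom T B B' ψ ∧ IsHolHom T B' B χ ∧ ∀ u, ψ u * χ u = 1 ∧ χ u * ψ u = 1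

/-- `B` is simple: its only holomorphic endomorphisms are the scalars. -/
def IsSimple (T : Matrix (Fin n) (Fin n) ℂ) (B : TorusBundle n) : Prop :=
  ∀ ψ, IsHolHom T B B ψ → ∃ c : ℂ, ∀ u, ψ u = c • (1 : Matrix (Fin B.rank) (Fin B.rank) ℂ)

theorem isHolHom_one (T : Matrix (Fin n) (Fin n) ℂ) (B : TorusBundle n) :
    IsHolHom T B B (fun _ => 1) where
  smooth a b := contDiff_const
  equivariant k u := by simp
  dbar_closed u v w _ := by
    ext a b
    simp [covDeriv]

theorem IsHolHom.comp {T : Matrix (Fin n) (Fin n) ℂ} {B B' B'' : TorusBundle n}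
    {ψ : Cover n → Matrix (Fin B'.rank) (Fin B.rank) ℂ}
    {χ : Cover n → Matrix (Fin B''.rank) (Fin B'.rank) ℂ}
    (hχ : IsHolHom T B' B'' χ) (hψ : IsHolHom T B B' ψ) :
    IsHolHom T B B'' (fun u => χ u * ψ u) where
  smooth a b := by
    simp only [Matrix.mul_apply]
    exact ContDiff.sum fun i _ => (hχ.smooth a i).mul (hψ.smooth i b)
  equivariant k u := by
    rw [Matrix.mul_assoc, hψ.equivariant, ← Matrix.mul_assoc, hχ.equivariant, Matrix.mul_assoc]
  dbar_closed u v w h := by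
    have key : ∀ x, covDeriv B B'' (fun u => χ u * ψ u) u x
        = covDeriv B' B'' χ u x * ψ u + χ u * covDeriv B B' ψ u x := by
      intro x
      ext a b
      have hd : fderiv ℝ (fun y => (χ y * ψ y) a b) u x
          = ∑ i, (χ u a i * fderiv ℝ (fun y => ψ y i b) u x
            + fderiv ℝ (fun y => χ y a i) u x * ψ u i b) := by
        have h1 : ∀ i, DifferentiableAt ℝ (fun y => χ y a i) u := fun i =>
          (hχ.smooth a i).differentiable (by simp) u
        have h2 : ∀ i, DifferentiableAt ℝ (fun y => ψ y i b) u := fun i =>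
          (hψ.smooth i b).differentiable (by simp) u
        have h3 := HasFDerivAt.fun_sum (u := Finset.univ)
          (fun i _ => (h1 i).hasFDerivAt.mul (h2 i).hasFDerivAt)
        have h4 : HasFDerivAt (fun y => (χ y * ψ y) a b) _ u := h3
        rw [h4.fderiv, _root_.sum_apply]
        refine Finset.sum_congr rfl fun i _ => ?_
        simp [mul_comm]
      simp only [covDeriv, Matrix.of_apply, Matrix.add_apply, hd]
      simp only [Matrix.mul_apply, Matrix.of_apply, Finset.mul_sum, ← Finset.sum_add_distrib]
      refine Finset.sum_congr rfl fun i _ => ?_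
      ring
    have e1 := hχ.dbar_closed u v w h
    have e2 := hψ.dbar_closed u v w h
    rw [key, key]
    calc _ = (covDeriv B' B'' χ u v + Complex.I • covDeriv B' B'' χ u w) * ψ u
          + χ u * (covDeriv B B' ψ u v + Complex.I • covDeriv B B' ψ u w) := by
            simp only [Matrix.add_mul, Matrix.mul_add, Matrix.smul_mul, Matrix.mul_smul, smul_add]
            abel
      _ = 0 := by rw [e1, e2]; simp

theorem isomorphic_equivalence (T : Matrix (Fin n) (Fin n) ℂ) :
    Equivalence (Isomorphic T) where
  refl B := ⟨_, _, isHolHom_one T B, isHolHom_one T B, fun _ => by simp⟩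
  symm := fun ⟨ψ, χ, h1, h2, h3⟩ => ⟨χ, ψ, h2, h1, fun u => (h3 u).symm⟩
  trans := fun ⟨ψ, χ, h1, h2, h3⟩ ⟨ψ', χ', h1', h2', h3'⟩ =>
    ⟨_, _, h1'.comp h1, h2.comp h2', fun u => by
      constructor
      · rw [Matrix.mul_assoc, ← Matrix.mul_assoc (ψ u), (h3 u).1, Matrix.one_mul, (h3' u).1]
      · rw [Matrix.mul_assoc, ← Matrix.mul_assoc (χ' u), (h3' u).2, Matrix.one_mul, (h3 u).2]⟩

end TorusBundle

/-! ### The biholomorphic map `φ` -/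

/-- The matrix `T' = (-T + δ)⁻¹`. -/
def Tprime {n : ℕ} (T : Matrix (Fin n) (Fin n) ℂ) (δ : Matrix (Fin n) (Fin n) ℤ) :
    Matrix (Fin n) (Fin n) ℂ :=
  (-T + toC δ)⁻¹

/-- The lift to the universal covers of the biholomorphic map
`φ : ℂⁿ/2π(ℤⁿ ⊕ Tℤⁿ) → ℂⁿ/2π(ℤⁿ ⊕ T'ℤⁿ)`, in real coordinates:
`(x, y) ↦ (X, Y) = (-y, x + δ y)`; see `zcoord_phi` for the complex coordinates. -/
def phi {n : ℕ} (δ : Matrix (Fin n) (Fin n) ℤ) : Cover n →ₗ[ℝ] Cover n :=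
  LinearMap.prod (-LinearMap.snd ℝ _ _)
    (LinearMap.fst ℝ _ _ + (toR δ).mulVecLin ∘ₗ LinearMap.snd ℝ _ _)

/-- The map of deck transformations induced by `φ`. -/
def phiDeck {n : ℕ} (δ : Matrix (Fin n) (Fin n) ℤ) : Deck n →+ Deck n :=
  AddMonoidHom.prod (-AddMonoidHom.snd _ _)
    (AddMonoidHom.fst _ _ + δ.mulVecLin.toAddMonoidHom.comp (AddMonoidHom.snd _ _))

theorem phi_apply {n : ℕ} (δ : Matrix (Fin n) (Fin n) ℤ) (u : Cover n) :
    phi δ u = (-u.2, u.1 + toR δ *ᵥ u.2) := rfl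

theorem phiDeck_apply {n : ℕ} (δ : Matrix (Fin n) (Fin n) ℤ) (k : Deck n) :
    phiDeck δ k = (-k.2, k.1 + δ *ᵥ k.2) := rfl

theorem phi_period {n : ℕ} (δ : Matrix (Fin n) (Fin n) ℤ) (k : Deck n) :
    phi δ (period k) = period (phiDeck δ k) := by
  rw [phi_apply, phiDeck_apply]
  refine Prod.ext ?_ ?_
  · ext i; simp [period]
  · ext i
    simp only [period, Matrix.mulVec, dotProduct, Pi.add_apply, Matrix.map_apply, Int.cast_add,
      Int.cast_sum, Int.cast_mul, mul_add, Finset.mul_sum]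
    congr 1
    exact Finset.sum_congr rfl fun j _ => by ring

/-- In complex coordinates `φ (z) = (-T + δ)⁻¹ z`. -/
theorem zcoord_phi {n : ℕ} (T : Matrix (Fin n) (Fin n) ℂ) (δ : Matrix (Fin n) (Fin n) ℤ)
    (h : (-T + toC δ).det ≠ 0) (u : Cover n) :
    zcoord (Tprime T δ) (phi δ u) = (-T + toC δ)⁻¹ *ᵥ zcoord T u := by
  have hu : IsUnit (-T + toC δ).det := isUnit_iff_ne_zero.2 h
  set M := -T + toC δ with hM
  have hT : T = toC δ - M := by rw [hM]; abel
  set y : Fin n → ℂ := fun i => (u.2 i : ℂ) with hy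
  have e1 : (fun i => ((phi δ u).1 i : ℂ)) = -y := by ext i; simp [phi_apply, hy]
  have e2 : (fun i => ((phi δ u).2 i : ℂ)) = (fun i => (u.1 i : ℂ)) + toC δ *ᵥ y := by
    ext i; simp [phi_apply, hy, Matrix.mulVec, dotProduct]
  have e3 : -y = M⁻¹ *ᵥ (-(M *ᵥ y)) := by
    rw [Matrix.mulVec_neg, Matrix.mulVec_mulVec, Matrix.nonsing_inv_mul _ hu, Matrix.one_mulVec]
  unfold zcoord Tprime
  rw [← hM, e1, e2, e3, ← Matrix.mulVec_add, hT]
  congr 1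
  rw [Matrix.sub_mulVec]
  abel

/-- The pullback `φ^*B` of a bundle with connection along `φ`. -/
def TorusBundle.pullback {n : ℕ} (δ : Matrix (Fin n) (Fin n) ℤ) (B : TorusBundle n) :
    TorusBundle n where
  rank := B.rank
  mult k u := B.mult (phiDeck δ k) (phi δ u)
  form u := B.form (phi δ u) ∘ₗ phi δ
  mult_zero u := by rw [map_zero, B.mult_zero]
  mult_add k l u := by rw [map_add, B.mult_add, map_add, phi_period]
  mult_smooth k a b :=
    (B.mult_smooth (phiDeck δ k) a b).comp (LinearMap.toContinuousLinearMap (phi δ)).contDiff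
  form_smooth v :=
    (B.form_smooth (phi δ v)).comp (LinearMap.toContinuousLinearMap (phi δ)).contDiff
  compat k u v a b := by
    have hf : HasFDerivAt (fun x => B.mult (phiDeck δ k) (phi δ x) a b)
        ((fderiv ℝ (fun x => B.mult (phiDeck δ k) x a b) (phi δ u)).comp
          (LinearMap.toContinuousLinearMap (phi δ))) u := by
      have h1 := ((B.mult_smooth (phiDeck δ k) a b).differentiable (by simp) (phi δ u)).hasFDerivAt
      exact h1.comp u (LinearMap.toContinuousLinearMap (phi δ)).hasFDerivAt
    rw [hf.fderiv]
    have := B.compat (phiDeck δ k) (phi δ u) (phi δ v) a b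
    rw [← phi_period, ← map_add] at this
    exact this

/-! ### The bundles `E_(r,A,μ,𝒰)` -/

/-- `k = r'`, the natural number attached to `(r, A)` by elementary divisors: if `P A Q` is diagonal
with entries `d₁ ∣ d₂ ∣ ⋯` (so the zeros come last), `P, Q ∈ GL(n, ℤ)`, and `rᵢ' = r / gcd(r, dᵢ)`
is the denominator of `dᵢ / r` in lowest terms, then `r' = ∏ rᵢ'` (zero entries contribute `1`). -/
def IsRankOf {n : ℕ} (r : ℕ) (A : Matrix (Fin n) (Fin n) ℤ) (k : ℕ) : Prop :=
  ∃ (P Q : GL (Fin n) ℤ) (d : Fin n → ℕ),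
    (P : Matrix (Fin n) (Fin n) ℤ) * A * (Q : Matrix (Fin n) (Fin n) ℤ)
      = Matrix.diagonal (fun i => (d i : ℤ)) ∧
    (∀ i j, i ≤ j → d i ∣ d j) ∧ k = ∏ i, r / Nat.gcd r (d i)

/-- A triple `(r, A, 𝒰)`: a positive integer `r`, an integer matrix `A = (a_kj)`, the rank `r'`
attached to `(r, A)`, and unitary matrices `V_j, U_k ∈ U(r')` satisfying the cocycle condition,
where `ζ = exp(2π𝐢/r)`. -/
structure TransData (n : ℕ) where
  /-- `r` -/
  r : ℕ
  r_pos : 0 < r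
  /-- `A` -/
  A : Matrix (Fin n) (Fin n) ℤ
  /-- `r'` -/
  rk : ℕ
  rk_spec : IsRankOf r A rk
  /-- the matrices `V_j` -/
  V : Fin n → Matrix.unitaryGroup (Fin rk) ℂ
  /-- the matrices `U_k` -/
  U : Fin n → Matrix.unitaryGroup (Fin rk) ℂ
  comm_V : ∀ j k, V j * V k = V k * V j
  comm_U : ∀ j k, U j * U k = U k * U j
  comm_UV : ∀ j k, Complex.exp (2 * π * Complex.I / r) ^ (-(A k j))
      • ((U k : Matrix (Fin rk) (Fin rk) ℂ) * (V j : Matrix (Fin rk) (Fin rk) ℂ))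
    = (V j : Matrix (Fin rk) (Fin rk) ℂ) * (U k : Matrix (Fin rk) (Fin rk) ℂ)

/-- The ordered product `W₁ ^ m₁ ⋯ Wₙ ^ mₙ`. -/
def zpowProd {G : Type*} [Group G] {n : ℕ} (W : Fin n → G) (m : Fin n → ℤ) : G :=
  (List.ofFn fun j => W j ^ m j).prod

theorem zpowProd_succ {G : Type*} [Group G] {n : ℕ} (W : Fin (n + 1) → G) (m : Fin (n + 1) → ℤ) :
    zpowProd W m = W 0 ^ m 0 * zpowProd (fun j => W j.succ) (fun j => m j.succ) := by
  simp [zpowProd, List.ofFn_succ]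

theorem zpowProd_zero {G : Type*} [Group G] {n : ℕ} (W : Fin n → G) : zpowProd W 0 = 1 := by
  induction n with
  | zero => simp [zpowProd]
  | succ n ih =>
    rw [zpowProd_succ]
    have : (fun j : Fin n => (0 : Fin (n + 1) → ℤ) j.succ) = 0 := rfl
    rw [this, ih]; simp

theorem zpowProd_single {G : Type*} [Group G] {n : ℕ} (W : Fin n → G) (j : Fin n) :
    zpowProd W (Pi.single j 1) = W j := by
  induction n with
  | zero => exact j.elim0
  | succ n ih =>
    rw [zpowProd_succ]
    refine Fin.cases ?_ (fun i => ?_) j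
    · have : (fun i : Fin n => (Pi.single (0 : Fin (n + 1)) (1 : ℤ) : Fin (n + 1) → ℤ) i.succ)
          = 0 := by ext i; simp
      rw [this, zpowProd_zero]; simp
    · have : (fun l : Fin n => (Pi.single i.succ (1 : ℤ) : Fin (n + 1) → ℤ) l.succ)
          = Pi.single i 1 := by ext l; simp [Pi.single_apply]
      rw [this, ih]; simp

theorem commute_zpowProd {G : Type*} [Group G] {n : ℕ} (g : G) (W : Fin n → G) (m : Fin n → ℤ)
    (h : ∀ j, Commute g (W j)) : Commute g (zpowProd W m) := by
  induction n with
  | zero => simp [zpowProd]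
  | succ n ih =>
    rw [zpowProd_succ]
    exact ((h 0).zpow_right _).mul_right (ih _ _ fun j => h j.succ)

theorem zpowProd_add {G : Type*} [Group G] {n : ℕ} (W : Fin n → G) (m m' : Fin n → ℤ)
    (h : ∀ i j, Commute (W i) (W j)) : zpowProd W (m + m') = zpowProd W m * zpowProd W m' := by
  induction n with
  | zero => simp [zpowProd]
  | succ n ih =>
    rw [zpowProd_succ, zpowProd_succ W m, zpowProd_succ W m']
    have e : (fun j : Fin n => (m + m') j.succ)
        = (fun j : Fin n => m j.succ) + fun j : Fin n => m' j.succ := rfl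
    rw [e, ih _ _ _ fun i j => h i.succ j.succ, Pi.add_apply, _root_.zpow_add]
    have hc : Commute (W 0 ^ m' 0) (zpowProd (fun j => W j.succ) fun j => m j.succ) :=
      commute_zpowProd _ _ _ fun j => (h 0 j.succ).zpow_left _
    simp only [mul_assoc]
    rw [← mul_assoc (W 0 ^ m' 0), hc.eq, mul_assoc]

/-- The scalar unitary matrix `exp(𝐢 t)`. -/
def phase (k : ℕ) (t : ℝ) : Matrix.unitaryGroup (Fin k) ℂ :=
  ⟨Complex.exp (t * Complex.I) • (1 : Matrix (Fin k) (Fin k) ℂ), by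
    rw [Matrix.mem_unitaryGroup_iff]
    rw [star_smul, star_one, smul_mul_smul_comm, one_mul]
    have : Complex.exp (t * Complex.I) * star (Complex.exp (t * Complex.I)) = 1 := by
      rw [Complex.star_def, ← Complex.exp_conj, ← Complex.exp_add]
      simp
    rw [this, one_smul]⟩

theorem phase_add (k : ℕ) (s t : ℝ) : phase k (s + t) = phase k s * phase k t := by
  apply Subtype.ext
  change Complex.exp (((s + t : ℝ) : ℂ) * Complex.I) • (1 : Matrix (Fin k) (Fin k) ℂ)
    = (Complex.exp (s * Complex.I) • 1) * (Complex.exp (t * Complex.I) • 1)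
  rw [smul_mul_smul_comm, one_mul, ← Complex.exp_add]
  push_cast
  rw [add_mul]

theorem phase_comm (k : ℕ) (t : ℝ) (g : Matrix.unitaryGroup (Fin k) ℂ) :
    phase k t * g = g * phase k t := by
  apply Subtype.ext
  simp [phase]

/-- `g h = exp(𝐢 t) h g`. -/
def Twist {k : ℕ} (t : ℝ) (g h : Matrix.unitaryGroup (Fin k) ℂ) : Prop :=
  g * h = phase k t * (h * g)

theorem phase_zero (k : ℕ) : phase k 0 = 1 := by
  apply Subtype.ext
  simp [phase]

theorem Twist.mul_right {k : ℕ} {s t : ℝ} {g h h' : Matrix.unitaryGroup (Fin k) ℂ}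
    (a : Twist s g h) (b : Twist t g h') : Twist (s + t) g (h * h') := by
  unfold Twist at *
  rw [← mul_assoc, a, phase_add, mul_assoc, mul_assoc, b, ← mul_assoc h, ← phase_comm]
  simp only [mul_assoc]

theorem Twist.swap {k : ℕ} {t : ℝ} {g h : Matrix.unitaryGroup (Fin k) ℂ} (a : Twist t g h) :
    Twist (-t) h g := by
  unfold Twist at *
  rw [a, ← mul_assoc, ← phase_add]
  simp [phase_zero]

theorem Twist.one_right {k : ℕ} (g : Matrix.unitaryGroup (Fin k) ℂ) : Twist 0 g 1 := by
  simp [Twist, phase_zero]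

theorem Twist.inv_right {k : ℕ} {t : ℝ} {g h : Matrix.unitaryGroup (Fin k) ℂ} (a : Twist t g h) :
    Twist (-t) g h⁻¹ := by
  have b := a.swap
  unfold Twist at *
  have : h⁻¹ * (h * g) * h⁻¹ = h⁻¹ * (phase k (-t) * (g * h)) * h⁻¹ := by rw [b]
  rw [← mul_assoc h⁻¹ (phase k (-t)), ← phase_comm] at this
  simpa [mul_assoc] using this

theorem Twist.zpow_right {k : ℕ} {t : ℝ} {g h : Matrix.unitaryGroup (Fin k) ℂ} (a : Twist t g h)
    (m : ℤ) : Twist (m * t) g (h ^ m) := by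
  have hn : ∀ m : ℕ, Twist (m * t) g (h ^ m) := by
    intro m
    induction m with
    | zero => simpa using Twist.one_right g
    | succ m ih => rw [pow_succ]; have := ih.mul_right a; convert this using 1; push_cast; ring
  cases m with
  | ofNat m => simpa using hn m
  | negSucc m =>
    rw [zpow_negSucc]; have := (hn (m + 1)).inv_right; convert this using 1; push_cast; ring

theorem Twist.zpowProd_right {k n : ℕ} (t : Fin n → ℝ) (g : Matrix.unitaryGroup (Fin k) ℂ)
    (W : Fin n → Matrix.unitaryGroup (Fin k) ℂ) (h : ∀ j, Twist (t j) g (W j)) (m : Fin n → ℤ) :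
    Twist (∑ j, m j * t j) g (zpowProd W m) := by
  induction n with
  | zero => simpa [zpowProd] using Twist.one_right g
  | succ n ih =>
    rw [zpowProd_succ, Fin.sum_univ_succ]
    exact ((h 0).zpow_right _).mul_right (ih _ _ (fun j => h j.succ) _)

namespace TransData

variable {n : ℕ}

theorem twist_UV (D : TransData n) (k j : Fin n) :
    Twist (2 * π * D.A k j / D.r) (D.U k) (D.V j) := by
  have h := D.comm_UV j k
  apply Subtype.ext
  set z := Complex.exp (2 * π * Complex.I / D.r) with hz
  have hz0 : z ≠ 0 := Complex.exp_ne_zero _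
  have e : Complex.exp ((2 * π * D.A k j / D.r : ℝ) * Complex.I) = z ^ (D.A k j) := by
    rw [hz, ← Complex.exp_int_mul]; congr 1; push_cast; ring
  change (D.U k : Matrix (Fin D.rk) (Fin D.rk) ℂ) * (D.V j : Matrix (Fin D.rk) (Fin D.rk) ℂ)
    = (Complex.exp ((2 * π * D.A k j / D.r : ℝ) * Complex.I) • (1 : Matrix _ _ ℂ)) *
      ((D.V j : Matrix (Fin D.rk) (Fin D.rk) ℂ) * (D.U k : Matrix (Fin D.rk) (Fin D.rk) ℂ))
  rw [e, ← h, Matrix.smul_mul, Matrix.one_mul, smul_smul, ← zpow_add₀ hz0]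
  simp

theorem twist_prod (D : TransData n) (l m : Fin n → ℤ) :
    Twist (2 * π / D.r * ((D.A *ᵥ m) ⬝ᵥ l : ℤ)) (zpowProd D.U l) (zpowProd D.V m) := by
  have h1 : ∀ k, Twist (-∑ j, m j * (2 * π * D.A k j / D.r)) (zpowProd D.V m) (D.U k) := fun k =>
    (Twist.zpowProd_right _ _ _ (fun j => D.twist_UV k j) m).swap
  have h2 := (Twist.zpowProd_right _ _ _ h1 l).swap
  convert h2 using 1
  simp only [Matrix.mulVec, dotProduct, Int.cast_sum, Int.cast_mul, Finset.mul_sum,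
    mul_neg, Finset.sum_neg_distrib, neg_neg, Finset.sum_mul]
  exact Finset.sum_congr rfl fun k _ => Finset.sum_congr rfl fun j _ => by ring

/-- The exponent `(1/r) (A m)ᵗ (Y + 2πl)`. -/
def expo (D : TransData n) (k : Deck n) (u : Cover n) : ℝ :=
  (1 / (D.r : ℝ)) * ((toR D.A *ᵥ fun i => (k.1 i : ℝ)) ⬝ᵥ (u.2 + (period k).2))

theorem expo_fderiv (D : TransData n) (k : Deck n) (u : Cover n) :
    HasFDerivAt (D.expo k)
      (LinearMap.toContinuousLinearMap ((1 / (D.r : ℝ)) •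
        (dotProductBilin ℝ ℝ (toR D.A *ᵥ fun i => (k.1 i : ℝ)) ∘ₗ LinearMap.snd ℝ _ _))) u := by
  have h : D.expo k = fun u => LinearMap.toContinuousLinearMap ((1 / (D.r : ℝ)) •
        (dotProductBilin ℝ ℝ (toR D.A *ᵥ fun i => (k.1 i : ℝ)) ∘ₗ LinearMap.snd ℝ _ _)) u
        + D.expo k 0 := by
    ext u
    simp [expo, dotProduct_add, mul_add]
  rw [h]
  exact (ContinuousLinearMap.hasFDerivAt _).add_const _

theorem expo_smooth (D : TransData n) (k : Deck n) : ContDiff ℝ ∞ (D.expo k) := by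
  unfold expo dotProduct
  fun_prop

/-- The unitary matrix `V₁^m₁ ⋯ Vₙ^mₙ U₁^l₁ ⋯ Uₙ^lₙ`. -/
def word (D : TransData n) (k : Deck n) : Matrix (Fin D.rk) (Fin D.rk) ℂ :=
  (zpowProd D.V k.1 * zpowProd D.U k.2 : Matrix.unitaryGroup (Fin D.rk) ℂ)

/-- The transition function of `E_(r,A,μ,𝒰)` along `2πk`, `k = (m, l)`:
`exp((𝐢/r) (A m)ᵗ (Y + 2πl)) V₁^m₁ ⋯ Vₙ^mₙ U₁^l₁ ⋯ Uₙ^lₙ`. See `trans_X`, `trans_Y` for the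
generators. -/
def trans (D : TransData n) (k : Deck n) (u : Cover n) : Matrix (Fin D.rk) (Fin D.rk) ℂ :=
  Complex.exp (Complex.I * D.expo k u) • D.word k

/-- The complex vector bundle `E_(r,A,μ,𝒰)` with the connection
`∇ = d - (𝐢/2π) ((1/r) Xᵗ Aᵗ + (1/r) μᵗ) dY · I_{r'}` on the torus with coordinates `(X, Y)`. -/
def bundle (D : TransData n) (μ : Fin n → ℂ) : TorusBundle n where
  rank := D.rk
  mult := D.trans
  form u :=
    { toFun := fun v => -(Complex.I / (2 * π)) * ∑ i,
        ((1 / (D.r : ℂ)) * (((toR D.A *ᵥ u.1) i : ℝ) : ℂ) + (1 / (D.r : ℂ)) * μ i) * (v.2 i : ℂ)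
      map_add' := fun v w => by
        simp only [Prod.snd_add, Pi.add_apply, Complex.ofReal_add, mul_add, Finset.sum_add_distrib]
      map_smul' := fun c v => by
        simp only [Prod.smul_snd, Pi.smul_apply, smul_eq_mul, Complex.ofReal_mul,
          Finset.mul_sum, RingHom.id_apply, Complex.real_smul]
        exact Finset.sum_congr rfl fun i _ => by ring }
  mult_zero u := by
    have : D.expo 0 u = 0 := by
      have h0 : (fun i : Fin n => (((0 : Deck n).1 i : ℤ) : ℝ)) = 0 := by ext; simp
      unfold expo
      rw [h0]; simp
    unfold trans word
    rw [this, Prod.fst_zero, Prod.snd_zero, zpowProd_zero, zpowProd_zero]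
    simp
  mult_add k l u := by
    have hV := zpowProd_add D.V k.1 l.1 D.comm_V
    have hU := zpowProd_add D.U k.2 l.2 D.comm_U
    have hT := congrArg Subtype.val (D.twist_prod k.2 l.1)
    simp only [Submonoid.coe_mul, phase] at hT
    unfold trans word
    rw [Prod.fst_add, Prod.snd_add, hV, hU]
    simp only [Submonoid.coe_mul]
    rw [smul_mul_smul_comm, ← Complex.exp_add]
    have hexp : (D.expo (k + l) u : ℝ) = D.expo k (u + period l) + D.expo l u
        + 2 * π / D.r * ((D.A *ᵥ l.1) ⬝ᵥ k.2 : ℤ) := by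
      have e1 : (fun i => (((k + l).1 i : ℤ) : ℝ))
          = (fun i => (k.1 i : ℝ)) + fun i => (l.1 i : ℝ) := by ext; simp
      have e2 : (period (k + l)).2 = (period k).2 + (period l).2 := by
        ext; simp [period, mul_add]
      have e3 : (((D.A *ᵥ l.1) ⬝ᵥ k.2 : ℤ) : ℝ) * (2 * π)
          = (toR D.A *ᵥ fun i => (l.1 i : ℝ)) ⬝ᵥ (period k).2 := by
        simp only [Matrix.mulVec, dotProduct, period, Int.cast_sum, Int.cast_mul, Finset.sum_mul,
          Matrix.map_apply]
        exact Finset.sum_congr rfl fun i _ => Finset.sum_congr rfl fun j _ => by ring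
      simp only [expo, e1, e2, Matrix.mulVec_add, add_dotProduct, dotProduct_add, Prod.snd_add]
      have : 2 * π / D.r * (((D.A *ᵥ l.1) ⬝ᵥ k.2 : ℤ) : ℝ)
          = 1 / (D.r : ℝ) * ((toR D.A *ᵥ fun i => (l.1 i : ℝ)) ⬝ᵥ (period k).2) := by
        rw [← e3]; ring
      rw [this]; ring
    rw [hexp]
    set a : Matrix (Fin D.rk) (Fin D.rk) ℂ := (zpowProd D.V k.1).1
    set b : Matrix (Fin D.rk) (Fin D.rk) ℂ := (zpowProd D.U k.2).1
    set c : Matrix (Fin D.rk) (Fin D.rk) ℂ := (zpowProd D.V l.1).1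
    set d : Matrix (Fin D.rk) (Fin D.rk) ℂ := (zpowProd D.U l.2).1
    have e4 : a * b * (c * d) = a * (b * c) * d := by simp only [Matrix.mul_assoc]
    rw [e4, hT]
    simp only [Matrix.smul_mul, Matrix.mul_smul, Matrix.one_mul, smul_smul, ← Complex.exp_add,
      Matrix.mul_assoc]
    congr 2
    push_cast
    ring
  mult_smooth k a b := by
    unfold trans
    simp only [Matrix.smul_apply, smul_eq_mul]
    refine ContDiff.mul (ContDiff.cexp (contDiff_const.mul ?_)) contDiff_const
    exact Complex.ofRealCLM.contDiff.comp (D.expo_smooth k)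
  form_smooth v := by
    refine contDiff_const.mul (ContDiff.sum fun i _ => ?_)
    refine ContDiff.mul (ContDiff.add (contDiff_const.mul ?_) contDiff_const) contDiff_const
    refine Complex.ofRealCLM.contDiff.comp ?_
    exact (contDiff_apply ℝ ℝ i).comp (((toR D.A).mulVecLin.toContinuousLinearMap.contDiff).comp
      contDiff_fst)
  compat k u v a b := by
    have h1 := ((Complex.ofRealCLM.hasFDerivAt).comp u (D.expo_fderiv k u)).const_mul Complex.I
    have h2 := (h1.cexp.mul_const
      (D.word k a b))
    have h3 : (fun x => D.trans k x a b) = fun x =>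
        Complex.exp (Complex.I * (Complex.ofRealCLM ∘ D.expo k) x) * D.word k a b := by
      ext x; simp [trans, Matrix.smul_apply]
    rw [h3, h2.fderiv]
    have hpi : (π : ℂ) ≠ 0 := by exact_mod_cast Real.pi_ne_zero
    have hdiff : ∀ (_ : Fin n → ℝ), (toR D.A *ᵥ (u + period k).1) =
        toR D.A *ᵥ u.1 + (2 * π) • (toR D.A *ᵥ fun i => (k.1 i : ℝ)) := by
      intro _
      rw [Prod.fst_add, Matrix.mulVec_add, ← Matrix.mulVec_smul]
      rfl
    simp only [LinearMap.coe_mk, AddHom.coe_mk, hdiff u.1, ← mul_sub, ← Finset.sum_sub_distrib]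
    have hs : ∀ i, ((1 / (D.r : ℂ)) * (((toR D.A *ᵥ u.1 +
        (2 * π) • (toR D.A *ᵥ fun i => (k.1 i : ℝ))) i : ℝ) : ℂ) + (1 / (D.r : ℂ)) * μ i)
          * (v.2 i : ℂ) - ((1 / (D.r : ℂ)) * (((toR D.A *ᵥ u.1) i : ℝ) : ℂ)
          + (1 / (D.r : ℂ)) * μ i) * (v.2 i : ℂ)
        = 2 * π * (1 / (D.r : ℂ) * ((((toR D.A *ᵥ fun i => (k.1 i : ℝ)) i * v.2 i : ℝ)) : ℂ)) := by
      intro i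
      simp only [Pi.add_apply, Pi.smul_apply, smul_eq_mul, Complex.ofReal_add, Complex.ofReal_mul,
        Complex.ofReal_ofNat]
      ring
    rw [Finset.sum_congr rfl fun i _ => hs i, ← Finset.mul_sum, ← Finset.mul_sum,
      ← Complex.ofReal_sum]
    have h4 : D.trans k u a b = Complex.exp (Complex.I * D.expo k u) * D.word k a b := rfl
    rw [h4]
    simp [dotProduct]
    field_simp
    ring

/-- Transition function in the direction `X_j ↦ X_j + 2π`: it is `exp((𝐢/r) a_j Y) V_j`, with `a_j`
the `j`-th column of `A`. -/
theorem trans_X (D : TransData n) (j : Fin n) (u : Cover n) :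
    D.trans (Pi.single j 1, 0) u
      = Complex.exp (Complex.I / D.r * ∑ i, (D.A i j : ℂ) * (u.2 i : ℂ)) •
        (D.V j : Matrix (Fin D.rk) (Fin D.rk) ℂ) := by
  have h : (fun i => ((Pi.single j 1 : Fin n → ℤ) i : ℝ)) = Pi.single j 1 := by
    ext i; by_cases hij : i = j
    · subst hij; simp
    · simp [hij]
  have h2 : (period ((Pi.single j 1, 0) : Deck n)).2 = 0 := by ext; simp [period]
  unfold trans word expo
  rw [zpowProd_single, zpowProd_zero, mul_one, h2, h, Matrix.mulVec_single_one]
  congr 2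
  simp only [dotProduct, Matrix.col_apply, Matrix.map_apply, add_zero]
  push_cast
  ring

/-- Transition function in the direction `Y_k ↦ Y_k + 2π`: it is `U_k`. -/
theorem trans_Y (D : TransData n) (k : Fin n) (u : Cover n) :
    D.trans (0, Pi.single k 1) u = (D.U k : Matrix (Fin D.rk) (Fin D.rk) ℂ) := by
  have h : (fun i : Fin n => ((0 : Fin n → ℤ) i : ℝ)) = 0 := by ext; simp
  unfold trans word expo
  rw [zpowProd_single, zpowProd_zero, one_mul, h]
  simp

end TransData

/-- An object of the DG-category `𝒟𝒢^φ` of the complex torus `ℂⁿ / 2π(ℤⁿ ⊕ Tℤⁿ)`: data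
`(r, A, 𝒰)` and `μ = p + T'ᵗ q` such that the bundle `φ^*E_(r,A,μ,𝒰)` is holomorphic and simple. -/
structure DGObj {n : ℕ} (T : Matrix (Fin n) (Fin n) ℂ) (δ : Matrix (Fin n) (Fin n) ℤ) where
  /-- `(r, A, 𝒰)` -/
  data : TransData n
  /-- the real part `p` of `μ` -/
  p : Fin n → ℝ
  /-- the component `q` of `μ` along `T'ᵗ` -/
  q : Fin n → ℝ
  hol : TorusBundle.IsHolomorphic T ((data.bundle ((fun i => (p i : ℂ))
    + (Tprime T δ)ᵀ *ᵥ fun i => (q i : ℂ))).pullback δ)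
  simple : TorusBundle.IsSimple T ((data.bundle ((fun i => (p i : ℂ))
    + (Tprime T δ)ᵀ *ᵥ fun i => (q i : ℂ))).pullback δ)

namespace DGObj

variable {n : ℕ} {T : Matrix (Fin n) (Fin n) ℂ} {δ : Matrix (Fin n) (Fin n) ℤ}

/-- `μ = p + T'ᵗ q` -/
def mu (E : DGObj T δ) : Fin n → ℂ :=
  (fun i => (E.p i : ℂ)) + (Tprime T δ)ᵀ *ᵥ fun i => (E.q i : ℂ)

/-- The bundle `φ^*E_(r,A,μ,𝒰)` with its connection. -/
def bundle (E : DGObj T δ) : TorusBundle n := (E.data.bundle E.mu).pullback δ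

/-- Isomorphism of objects of `𝒟𝒢^φ`. -/
instance isoSetoid (T : Matrix (Fin n) (Fin n) ℂ) (δ : Matrix (Fin n) (Fin n) ℤ) :
    Setoid (DGObj T δ) where
  r E E' := TorusBundle.Isomorphic T E.bundle E'.bundle
  iseqv := (TorusBundle.isomorphic_equivalence T).comap bundle

end DGObj

/-! ### Affine objects of the Fukaya category of the mirror torus -/

/-- Data `(r, A, p, q)` of an affine submanifold and a flat line bundle along it. -/
structure AffData (n : ℕ) where
  /-- `r` -/
  r : ℕ
  r_pos : 0 < r
  /-- `A` -/
  A : Matrix (Fin n) (Fin n) ℤ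
  /-- `p` -/
  p : Fin n → ℝ
  /-- `q` -/
  q : Fin n → ℝ

/-- The value on two tangent vectors of the constant two-form `dxᵗ W dy`. -/
def twoForm {n : ℕ} (W : Matrix (Fin n) (Fin n) ℝ) (v w : Cover n) : ℝ :=
  v.1 ⬝ᵥ (W *ᵥ w.2) - w.1 ⬝ᵥ (W *ᵥ v.2)

namespace AffData

variable {n : ℕ}

/-- The parametrization `y ↦ (-(1/r) A y + (1/r) p, y)` of the affine submanifold. -/
def param (a : AffData n) (y : Fin n → ℝ) : Cover n :=
  (-(1 / (a.r : ℝ)) • (toR a.A *ᵥ y) + (1 / (a.r : ℝ)) • a.p, y)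

/-- The same parametrization as a map to the torus. It is a covering of its image `L̃_(r,A,p)`. -/
def point (a : AffData n) (y : Fin n → ℝ) : Torus n :=
  (fun i => (((a.param y).1 i : ℝ) : AddCircle (2 * π)),
    fun i => (((a.param y).2 i : ℝ) : AddCircle (2 * π)))

/-- The `n`-dimensional submanifold `L̃_(r,A,p) = {(x, y) | x = -(1/r) A y + (1/r) p}` of the
torus. -/
def L (a : AffData n) : Set (Torus n) := Set.range a.point

/-- The tangent vector of `L̃_(r,A,p)` at `point y` corresponding to the vector `v` of parameters. -/
def tangent (a : AffData n) (y v : Fin n → ℝ) : Cover n := fderiv ℝ a.param y v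

/-- The connection one-form `(𝐢/2π)(1/r) qᵗ dy` of the connection `d + (𝐢/2π)(1/r) qᵗ dy` on the
trivial line bundle `ℒ̃_(r,A,p,q)` on `L̃_(r,A,p)`, evaluated on a tangent vector `v`. -/
def connForm (a : AffData n) (v : Cover n) : ℂ :=
  Complex.I / (2 * π) * (1 / (a.r : ℂ)) * ((a.q ⬝ᵥ v.2 : ℝ) : ℂ)

/-- The curvature form of that connection, in the coordinates of the parametrization. -/
def curvature (a : AffData n) (y v w : Fin n → ℝ) : ℂ :=
  fderiv ℝ (fun x => a.connForm (a.tangent x w)) y v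
    - fderiv ℝ (fun x => a.connForm (a.tangent x v)) y w

/-- `(L̃_(r,A,p), ℒ̃_(r,A,p,q))` is an object of the Fukaya category of the torus with the
complexified symplectic form `dxᵗ τ dy`, i.e. with symplectic form `ω = dxᵗ (Im τ) dy` and B-field
`B = dxᵗ (Re τ) dy`: the `n`-dimensional submanifold is Lagrangian, and the curvature of the line
bundle is the restriction of `2π𝐢 B`. -/
structure IsFukObj (τ : Matrix (Fin n) (Fin n) ℂ) (a : AffData n) : Prop where
  lagrangian : ∀ y v w, twoForm (τ.map Complex.im) (a.tangent y v) (a.tangent y w) = 0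
  curv : ∀ y v w, a.curvature y v w
    = 2 * π * Complex.I * (twoForm (τ.map Complex.re) (a.tangent y v) (a.tangent y w) : ℝ)

/-- Isomorphism of the affine objects: the submanifolds are equal, and the line bundles with
connection on them are isomorphic, i.e. there is a smooth nowhere vanishing function `f` on the
submanifold with `∇' (f s) = f ∇ s` for all sections `s`. -/
def Isomorphic (a b : AffData n) : Prop :=
  a.L = b.L ∧ ∃ f : Torus n → ℂ, ContDiff ℝ ∞ (fun y => f (a.point y)) ∧
    (∀ y, f (a.point y) ≠ 0) ∧
    ∀ y v, fderiv ℝ (fun x => f (a.point x)) y v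
      + (b.connForm (a.tangent y v) - a.connForm (a.tangent y v)) * f (a.point y) = 0

theorem tangent_eq (a : AffData n) (y v : Fin n → ℝ) :
    a.tangent y v = (-(1 / (a.r : ℝ)) • (toR a.A *ᵥ v), v) := by
  set ℓ : (Fin n → ℝ) →ₗ[ℝ] Cover n :=
    LinearMap.prod (-(1 / (a.r : ℝ)) • (toR a.A).mulVecLin) LinearMap.id with hl
  have h : a.param = fun y => LinearMap.toContinuousLinearMap ℓ y
      + ((1 / (a.r : ℝ)) • a.p, (0 : Fin n → ℝ)) := by
    funext y
    refine Prod.ext ?_ ?_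
    · simp [param, hl]
    · simp [param, hl]
  have h2 : HasFDerivAt a.param (LinearMap.toContinuousLinearMap ℓ) y := by
    rw [h]; exact (ContinuousLinearMap.hasFDerivAt _).add_const _
  unfold tangent
  rw [h2.fderiv]
  simp [hl]

theorem coe_eq_coe {s t : ℝ} (h : (s : AddCircle (2 * π)) = t) : ∃ k : ℤ, t = s + k * (2 * π) := by
  obtain ⟨k, hk⟩ := AddSubgroup.mem_zmultiples_iff.1 (QuotientAddGroup.eq.1 h)
  refine ⟨k, ?_⟩
  rw [zsmul_eq_mul] at hk
  rw [hk]; ring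

theorem coe_add_period (s : ℝ) (k : ℤ) :
    ((s + k * (2 * π) : ℝ) : AddCircle (2 * π)) = s := by
  rw [AddCircle.coe_add]
  have : ((k * (2 * π) : ℝ) : AddCircle (2 * π)) = 0 := by
    rw [← zsmul_eq_mul, AddCircle.coe_zsmul, AddCircle.coe_period, smul_zero]
  rw [this, add_zero]

theorem slope_eq_of_L_eq {a b : AffData n} (h : a.L = b.L) (y : Fin n → ℝ) :
    (1 / (b.r : ℝ)) • (toR b.A *ᵥ y) = (1 / (a.r : ℝ)) • (toR a.A *ᵥ y) := by
  funext i
  by_contra hne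
  set x : ℝ := ((1 / (a.r : ℝ)) • (toR a.A *ᵥ y)) i - ((1 / (b.r : ℝ)) • (toR b.A *ᵥ y)) i with hx
  have hx0 : x ≠ 0 := fun h0 => hne (sub_eq_zero.1 (hx ▸ h0)).symm
  let S : (Fin n → ℤ) × ℤ → ℝ := fun m =>
    ((1 / (a.r : ℝ)) • a.p) i - ((1 / (b.r : ℝ)) • b.p) i
      - ((1 / (a.r : ℝ)) • (toR a.A *ᵥ fun j => (m.1 j : ℝ) * (2 * π))) i + m.2 * (2 * π)
  have key : ∀ t : ℝ, ∃ m, S m = t * x := by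
    intro t
    have hm : b.point (t • y) ∈ a.L := h ▸ Set.mem_range_self _
    obtain ⟨z, hz⟩ := hm
    have h2 : ∀ j, ∃ k : ℤ, z j = (t • y) j + k * (2 * π) := fun j =>
      coe_eq_coe (congrFun (congrArg Prod.snd hz) j).symm
    choose m hm using h2
    obtain ⟨k, hk⟩ := coe_eq_coe (congrFun (congrArg Prod.fst hz) i)
    have hz' : z = t • y + fun j => (m j : ℝ) * (2 * π) := funext hm
    refine ⟨(m, k), ?_⟩
    simp only [param, hz', Matrix.mulVec_add, Matrix.mulVec_smul, Pi.add_apply, Pi.smul_apply,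
      smul_eq_mul] at hk
    simp only [S, hx, Pi.smul_apply, smul_eq_mul]
    linarith
  have hc : (Set.range S).Countable := Set.countable_range S
  have huniv : (Set.univ : Set ℝ) ⊆ (fun s => s / x) '' Set.range S := by
    intro t _
    obtain ⟨m, hm⟩ := key t
    exact ⟨_, ⟨m, rfl⟩, by simp only [hm]; field_simp⟩
  exact Set.not_countable_univ ((hc.image _).mono huniv)

theorem exists_shift {a b : AffData n} (h : a.L = b.L) :
    ∃ c : Fin n → ℝ, ∀ y, b.point y = a.point (y + c) := by
  have h0 : b.point 0 ∈ a.L := h ▸ Set.mem_range_self _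
  obtain ⟨c, hc⟩ := h0
  refine ⟨c, fun y => ?_⟩
  have hs := slope_eq_of_L_eq h y
  refine Prod.ext ?_ ?_
  · funext i
    have h1 := congrFun (congrArg Prod.fst hc) i
    have e1 : (a.param (y + c)).1 i
        = -((1 / (a.r : ℝ)) • (toR a.A *ᵥ y)) i + (a.param c).1 i := by
      simp [param, Matrix.mulVec_add]; ring
    have e2 : (b.param y).1 i
        = -((1 / (b.r : ℝ)) • (toR b.A *ᵥ y)) i + (b.param 0).1 i := by
      simp [param]
    change (((b.param y).1 i : ℝ) : AddCircle (2 * π))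
      = (((a.param (y + c)).1 i : ℝ) : AddCircle (2 * π))
    rw [e1, e2, hs, AddCircle.coe_add, AddCircle.coe_add]
    exact congrArg _ h1.symm
  · funext i
    have h1 := congrFun (congrArg Prod.snd hc) i
    change ((y i : ℝ) : AddCircle (2 * π)) = ((y i + c i : ℝ) : AddCircle (2 * π))
    have h2 : ((c i : ℝ) : AddCircle (2 * π)) = ((0 : ℝ) : AddCircle (2 * π)) := h1
    rw [AddCircle.coe_add, h2]
    simp

/-- The conditions on `f` in `Isomorphic` do not depend on the parametrization. -/
theorem transfer {a b : AffData n} (h : a.L = b.L) (f : Torus n → ℂ) (κ : Cover n → ℂ)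
    (hκ : ∀ y v, κ (b.tangent y v) = κ (a.tangent y v))
    (hf : ContDiff ℝ ∞ (fun y => f (a.point y)) ∧ (∀ y, f (a.point y) ≠ 0) ∧
      ∀ y v, fderiv ℝ (fun x => f (a.point x)) y v + κ (a.tangent y v) * f (a.point y) = 0) :
    ContDiff ℝ ∞ (fun y => f (b.point y)) ∧ (∀ y, f (b.point y) ≠ 0) ∧
      ∀ y v, fderiv ℝ (fun x => f (b.point x)) y v + κ (b.tangent y v) * f (b.point y) = 0 := by
  obtain ⟨c, hc⟩ := exists_shift h
  obtain ⟨h1, h2, h3⟩ := hf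
  refine ⟨?_, fun y => hc y ▸ h2 _, fun y v => ?_⟩
  · simp only [hc]
    exact h1.comp (contDiff_id.add contDiff_const)
  · have h4 := h3 (y + c) v
    have e : fderiv ℝ (fun x => f (b.point x)) y
        = fderiv ℝ (fun x => f (a.point x)) (y + c) := by
      simp only [hc]
      exact fderiv_comp_add_right (f := fun x => f (a.point x)) c
    rw [e, hκ, hc]
    rw [tangent_eq] at h4 ⊢
    exact h4

theorem connForm_tangent (a b d : AffData n) (y v : Fin n → ℝ) :
    d.connForm (b.tangent y v) = d.connForm (a.tangent y v) := by
  simp [connForm, tangent_eq]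

theorem isomorphic_equivalence : Equivalence (Isomorphic (n := n)) where
  refl a := ⟨rfl, fun _ => 1, contDiff_const, fun _ => one_ne_zero, fun y v => by simp⟩
  symm := by
    rintro a b ⟨hL, f, hf⟩
    obtain ⟨h1, h2, h3⟩ := transfer hL f (fun w => b.connForm w - a.connForm w)
      (fun y v => by simp only [connForm_tangent a b]) hf
    refine ⟨hL.symm, fun x => (f x)⁻¹, h1.inv h2, fun y => inv_ne_zero (h2 y), fun y v => ?_⟩
    have hd := (h1.differentiable (by simp) y).hasFDerivAt
    have h4 := h3 y v
    have hne := h2 y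
    have e : HasFDerivAt (fun x => (f (b.point x))⁻¹) _ y :=
      (hasFDerivAt_inv' hne).comp y hd
    rw [e.fderiv]
    simp
    field_simp
    linear_combination -h4
  trans := by
    rintro a b c ⟨hL, f, hf⟩ ⟨hL', g, hg⟩
    obtain ⟨h1, h2, h3⟩ := hf
    obtain ⟨h1', h2', h3'⟩ := transfer hL.symm g (fun w => c.connForm w - b.connForm w)
      (fun y v => by simp only [connForm_tangent b a]) hg
    refine ⟨hL.trans hL', fun x => f x * g x, h1.mul h1', fun y => mul_ne_zero (h2 y) (h2' y),
      fun y v => ?_⟩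
    have hd := (h1.differentiable (by simp) y).hasFDerivAt
    have hd' := (h1'.differentiable (by simp) y).hasFDerivAt
    have h5 := h3 y v
    have h6 := h3' y v
    have e : HasFDerivAt (fun x => f (a.point x) * g (a.point x)) _ y := hd.mul hd'
    rw [e.fderiv]
    simp
    linear_combination g (a.point y) * h5 + f (a.point y) * h6

end AffData

/-- An object of `Fuk_aff` of the torus with complexified symplectic form `dxᵗ τ dy`. -/
structure FukObj {n : ℕ} (τ : Matrix (Fin n) (Fin n) ℂ) where
  /-- `(r, A, p, q)` -/
  data : AffData n
  isFukObj : data.IsFukObj τ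

/-- Isomorphism of objects of `Fuk_aff`. -/
instance FukObj.isoSetoid {n : ℕ} (τ : Matrix (Fin n) (Fin n) ℂ) : Setoid (FukObj τ) where
  r a b := AffData.Isomorphic a.data b.data
  iseqv := AffData.isomorphic_equivalence.comap FukObj.data

/-! ### The mirror map -/

/-- A choice of real numbers `ξ_j`, `θ_k` with `exp(𝐢 ξ_j) = det V_j`, `exp(𝐢 θ_k) = det U_k` for all
`(r, A, 𝒰)`. -/
structure Angles (n : ℕ) where
  /-- `ξ` -/
  ξ : TransData n → Fin n → ℝ
  /-- `θ` -/
  θ : TransData n → Fin n → ℝ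
  exp_ξ : ∀ D j, Complex.exp (Complex.I * ξ D j)
    = (D.V j : Matrix (Fin D.rk) (Fin D.rk) ℂ).det
  exp_θ : ∀ D k, Complex.exp (Complex.I * θ D k)
    = (D.U k : Matrix (Fin D.rk) (Fin D.rk) ℂ).det

/-- Determinants fix `ξ` and `θ` only modulo `2π`, and `2π`-shifts change the affine submanifold in
general. The choice is consistent if, for any two triples `(r, A, 𝒰)` and `(s, B, 𝒱)` of the same
slope `A / r = B / s`, the matrices of `𝒱` are obtained from those of `𝒰` by a change of frame `g`
and multiplication by the `r'`-th roots `exp(𝐢 (ξ_j(𝒱) - ξ_j(𝒰)) / r')` and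
`exp(𝐢 (θ_k(𝒱) - θ_k(𝒰)) / r')` of the quotients of determinants. -/
def Angles.IsConsistent {n : ℕ} (a : Angles n) : Prop :=
  ∀ D D' : TransData n, (D.r : ℤ) • D'.A = (D'.r : ℤ) • D.A →
    ∃ (g : Matrix (Fin D'.rk) (Fin D.rk) ℂ) (g' : Matrix (Fin D.rk) (Fin D'.rk) ℂ),
      g * g' = 1 ∧ g' * g = 1 ∧
      (∀ j, (D'.V j : Matrix (Fin D'.rk) (Fin D'.rk) ℂ)
        = Complex.exp (Complex.I * ((a.ξ D' j - a.ξ D j) / D.rk : ℝ)) •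
          (g * (D.V j : Matrix (Fin D.rk) (Fin D.rk) ℂ) * g')) ∧
      (∀ k, (D'.U k : Matrix (Fin D'.rk) (Fin D'.rk) ℂ)
        = Complex.exp (Complex.I * ((a.θ D' k - a.θ D k) / D.rk : ℝ)) •
          (g * (D.U k : Matrix (Fin D.rk) (Fin D.rk) ℂ) * g'))

/-- The data `(r, A, p(θ), q(ξ))` attached to `φ^*E_(r,A,μ,𝒰)`, `μ = p + T'ᵗ q`, where
`p(θ) = p - (r/r') θ` and `q(ξ) = q + (r/r') ξ`. -/
def mirrorData {n : ℕ} {T : Matrix (Fin n) (Fin n) ℂ} {δ : Matrix (Fin n) (Fin n) ℤ}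
    (a : Angles n) (E : DGObj T δ) : AffData n where
  r := E.data.r
  r_pos := E.data.r_pos
  A := E.data.A
  p := E.p - ((E.data.r : ℝ) / (E.data.rk : ℝ)) • a.θ E.data
  q := E.q + ((E.data.r : ℝ) / (E.data.rk : ℝ)) • a.ξ E.data

end TorusMirror

end

open TorusMirror

/-!
By the relations of `𝒰`, the words `Vᵐ Uˡ` form a projective representation of `ℤⁿ ⊕ ℤⁿ` whose size
`r'` makes them span the whole matrix algebra. Hence a matrix is determined up to a scalar by the
phases with which it intertwines the generators, and the generators of two triples with equal slope
`A / r` are conjugate up to phases. The slope is an isomorphism invariant, because it is the winding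
of the determinants of the transition functions.

For equal slopes, Liouville's theorem shows that the component of a holomorphic map along each word
is an exponential, which can be nonzero only if its multipliers match those of the bundles. So
bundles are simple, and they are isomorphic exactly if, up to the phases relating their generators,
the differences of `p / r` and of `q / r` lie in `2π ((1/r) A ℤⁿ + ℤⁿ)` and
`2π ((1/r) Aᵗ ℤⁿ + ℤⁿ)`.

On the symplectic side the first lattice decides whether two submanifolds of the same slope
coincide; by lattice duality the second one decides whether two connections have the same holonomy.
Both holomorphy and being an object of the Fukaya category say that `Aᵗ (T - δ)` is symmetric.
-/

noncomputable section

namespace TorusMirror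

/-! ### Smith normal form -/

section UnimodEquiv

variable {R S ι : Type*} [CommRing R] [CommRing S] [Fintype ι] [DecidableEq ι]
  {A B C : Matrix ι ι R}

/-- Equality of square matrices up to invertible row and column operations. -/
def UnimodEquiv (A B : Matrix ι ι R) : Prop :=
  ∃ P Q : GL ι R, (P : Matrix ι ι R) * A * (Q : Matrix ι ι R) = B

theorem UnimodEquiv.refl (A : Matrix ι ι R) : UnimodEquiv A A :=
  ⟨1, 1, by simp⟩

theorem UnimodEquiv.trans (h : UnimodEquiv A B) (h' : UnimodEquiv B C) : UnimodEquiv A C := by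
  obtain ⟨P, Q, rfl⟩ := h
  obtain ⟨P', Q', rfl⟩ := h'
  exact ⟨P' * P, Q * Q', by simp [Matrix.mul_assoc]⟩

theorem UnimodEquiv.transpose (h : UnimodEquiv A B) : UnimodEquiv Aᵀ Bᵀ := by
  obtain ⟨P, Q, rfl⟩ := h
  have transposed_unit (P : GL ι R) : ∃ P' : GL ι R, (P' : Matrix ι ι R) = (P : Matrix ι ι R)ᵀ :=
    ⟨⟨(P : Matrix ι ι R)ᵀ, ((P⁻¹ : GL ι R) : Matrix ι ι R)ᵀ,
      by rw [← Matrix.transpose_mul, Units.inv_mul, Matrix.transpose_one],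
      by rw [← Matrix.transpose_mul, Units.mul_inv, Matrix.transpose_one]⟩, rfl⟩
  obtain ⟨P', hP⟩ := transposed_unit P
  obtain ⟨Q', hQ⟩ := transposed_unit Q
  exact ⟨Q', P', by rw [hP, hQ, Matrix.transpose_mul, Matrix.transpose_mul, Matrix.mul_assoc]⟩

theorem UnimodEquiv.map (f : R →+* S) (h : UnimodEquiv A B) : UnimodEquiv (A.map f) (B.map f) := by
  obtain ⟨P, Q, rfl⟩ := h
  exact ⟨GeneralLinearGroup.map f P, GeneralLinearGroup.map f Q, by simp⟩

theorem UnimodEquiv.dvd {a : R} (h : UnimodEquiv A B) (ha : ∀ i j, a ∣ A i j) (i j : ι) :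
    a ∣ B i j := by
  obtain ⟨P, Q, rfl⟩ := h
  simp only [Matrix.mul_apply]
  exact Finset.dvd_sum fun x _ => (Finset.dvd_sum fun y _ => (ha y x).mul_left _).mul_right _

theorem unimodEquiv_add_vecMulVec_row (A : Matrix ι ι R) {k : ι} {c : ι → R} (hc : c k = 0) :
    UnimodEquiv A (A + vecMulVec c (A k)) := by
  have nilpotent : vecMulVec c (Pi.single k 1) * vecMulVec c (Pi.single k 1) = 0 := by
    rw [vecMulVec_mul_vecMulVec]
    simp [hc]
  refine ⟨⟨1 + vecMulVec c (Pi.single k 1), 1 - vecMulVec c (Pi.single k 1), ?_, ?_⟩, 1, ?_⟩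
  · rw [Matrix.add_mul, Matrix.mul_sub, Matrix.mul_sub, nilpotent]; simp
  · rw [Matrix.sub_mul, Matrix.mul_add, Matrix.mul_add, nilpotent]; simp
  · simp only [Units.val_one, Matrix.mul_one, Matrix.add_mul, Matrix.one_mul, vecMulVec_mul,
      single_one_vecMul]
    rfl

theorem unimodEquiv_submatrix (A : Matrix ι ι R) (σ τ : Equiv.Perm ι) :
    UnimodEquiv A (A.submatrix σ τ) := by
  have mul_symm (ρ : Equiv.Perm ι) :
      ρ.toPEquiv.toMatrix * ρ.symm.toPEquiv.toMatrix = (1 : Matrix ι ι R) := by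
    rw [← PEquiv.toMatrix_trans, ← Equiv.toPEquiv_trans]
    simp
  refine ⟨⟨σ.toPEquiv.toMatrix, σ.symm.toPEquiv.toMatrix, mul_symm σ, mul_symm σ.symm⟩,
    ⟨τ.symm.toPEquiv.toMatrix, τ.toPEquiv.toMatrix, mul_symm τ.symm, mul_symm τ⟩, ?_⟩
  rw [PEquiv.toMatrix_toPEquiv_mul, PEquiv.mul_toMatrix_toPEquiv]
  rfl

theorem unimodEquiv_diagonal_of_associated {d e : ι → R} (h : ∀ i, Associated (d i) (e i)) :
    UnimodEquiv (diagonal d) (diagonal e) := by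
  choose u hu using h
  refine ⟨1, ⟨diagonal fun i => (u i : R), diagonal fun i => ((u i)⁻¹ : Rˣ), ?_, ?_⟩, ?_⟩ <;>
    simp [hu]

end UnimodEquiv

section CornerBlock

variable {R : Type*} [CommRing R] {n : ℕ}

/-- The block diagonal matrix with blocks `a` and `M`. -/
def cornerBlock (a : R) (M : Matrix (Fin n) (Fin n) R) : Matrix (Fin (n + 1)) (Fin (n + 1)) R :=
  Matrix.of (Fin.cons (Fin.cons a 0) fun i => Fin.cons 0 (M i))

theorem cornerBlock_mul (a b : R) (M N : Matrix (Fin n) (Fin n) R) :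
    cornerBlock a M * cornerBlock b N = cornerBlock (a * b) (M * N) := by
  ext i j
  refine Fin.cases ?_ (fun i => ?_) i <;> refine Fin.cases ?_ (fun j => ?_) j <;>
    simp [cornerBlock, Matrix.mul_apply, Fin.sum_univ_succ]

theorem cornerBlock_diagonal (a : R) (d : Fin n → R) :
    cornerBlock a (diagonal d) = diagonal (Fin.cons a d : Fin (n + 1) → R) := by
  ext i j
  refine Fin.cases ?_ (fun i => ?_) i <;> refine Fin.cases ?_ (fun j => ?_) j <;>
    simp [cornerBlock, diagonal_apply, (Fin.succ_ne_zero _).symm]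

theorem cornerBlock_one : cornerBlock 1 (1 : Matrix (Fin n) (Fin n) R) = 1 := by
  rw [← diagonal_one, cornerBlock_diagonal, ← diagonal_one]
  congr 1
  ext i
  refine Fin.cases ?_ (fun i => ?_) i <;> simp

theorem eq_cornerBlock {B : Matrix (Fin (n + 1)) (Fin (n + 1)) R} (hcol : ∀ i ≠ 0, B i 0 = 0)
    (hrow : ∀ j ≠ 0, B 0 j = 0) : B = cornerBlock (B 0 0) (B.submatrix Fin.succ Fin.succ) := by
  ext i j
  refine Fin.cases ?_ (fun i => ?_) i <;> refine Fin.cases ?_ (fun j => ?_) j <;>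
    simp [cornerBlock, hrow, hcol]

theorem UnimodEquiv.cornerBlock {M N : Matrix (Fin n) (Fin n) R} (a : R) (h : UnimodEquiv M N) :
    UnimodEquiv (cornerBlock a M) (cornerBlock a N) := by
  obtain ⟨P, Q, rfl⟩ := h
  have bordered_unit (P : GL (Fin n) R) : ∃ P' : GL (Fin (n + 1)) R,
      (P' : Matrix (Fin (n + 1)) (Fin (n + 1)) R) = TorusMirror.cornerBlock 1 P.1 :=
    ⟨⟨TorusMirror.cornerBlock 1 P.1, TorusMirror.cornerBlock 1 (P⁻¹).1,
      by rw [cornerBlock_mul, Units.mul_inv, mul_one, cornerBlock_one],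
      by rw [cornerBlock_mul, Units.inv_mul, mul_one, cornerBlock_one]⟩, rfl⟩
  obtain ⟨P', hP⟩ := bordered_unit P
  obtain ⟨Q', hQ⟩ := bordered_unit Q
  exact ⟨P', Q', by rw [hP, hQ, cornerBlock_mul, cornerBlock_mul, one_mul, mul_one]⟩

end CornerBlock

section EuclideanDomain

variable {R : Type*} [EuclideanDomain R] {n : ℕ} {A B C : Matrix (Fin (n + 1)) (Fin (n + 1)) R}

/-- The corner entry of `C` is Euclidean-minimal among the nonzero entries of all matrices
equivalent to `C`. -/
def IsMinimalCorner (C : Matrix (Fin (n + 1)) (Fin (n + 1)) R) : Prop :=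
  C 0 0 ≠ 0 ∧ ∀ B, UnimodEquiv C B → ∀ i j, B i j ≠ 0 → ¬ EuclideanDomain.r (B i j) (C 0 0)

theorem exists_isMinimalCorner (hA : A ≠ 0) : ∃ C, UnimodEquiv A C ∧ IsMinimalCorner C := by
  obtain ⟨i, j, hij⟩ : ∃ i j, A i j ≠ 0 := by
    by_contra! h
    exact hA (Matrix.ext h)
  let entries : Set R := {x | x ≠ 0 ∧ ∃ B, UnimodEquiv A B ∧ ∃ i j, B i j = x}
  obtain ⟨x, ⟨hx, B, hB, k, l, rfl⟩, hmin⟩ :=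
    EuclideanDomain.r_wellFounded.has_min entries ⟨_, hij, A, .refl A, i, j, rfl⟩
  have corner : B.submatrix (Equiv.swap 0 k) (Equiv.swap 0 l) 0 0 = B k l := by simp
  have hC := hB.trans (unimodEquiv_submatrix B (Equiv.swap 0 k) (Equiv.swap 0 l))
  refine ⟨_, hC, by rwa [corner], fun D hD i j hne => ?_⟩
  rw [corner]
  exact hmin _ ⟨hne, D, hC.trans hD, i, j, rfl⟩

theorem IsMinimalCorner.of_unimodEquiv (h : IsMinimalCorner C) (hB : UnimodEquiv C B)
    (corner : B 0 0 = C 0 0) : IsMinimalCorner B := by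
  rw [IsMinimalCorner, corner]
  exact ⟨h.1, fun D hD => h.2 D (hB.trans hD)⟩

theorem IsMinimalCorner.transpose (h : IsMinimalCorner C) : IsMinimalCorner Cᵀ :=
  ⟨h.1, fun B hB i j => h.2 Bᵀ (by simpa using hB.transpose) j i⟩

theorem IsMinimalCorner.dvd_col (h : IsMinimalCorner C) (i : Fin (n + 1)) : C 0 0 ∣ C i 0 := by
  rcases eq_or_ne i 0 with rfl | hi
  · exact dvd_rfl
  let c : Fin (n + 1) → R := Pi.single i (-(C i 0 / C 0 0))
  have hc : c 0 = 0 := Pi.single_eq_of_ne hi.symm _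
  have entry : (C + vecMulVec c (C 0)) i 0 = C i 0 % C 0 0 := by
    simp only [c, Matrix.add_apply, vecMulVec_apply, Pi.single_eq_same]
    linear_combination EuclideanDomain.mod_eq_sub_mul_div (C i 0) (C 0 0) |>.symm
  have minimal := h.2 _ (unimodEquiv_add_vecMulVec_row C hc) i 0
  rw [entry] at minimal
  by_contra hdvd
  exact minimal (mt EuclideanDomain.mod_eq_zero.1 hdvd) (EuclideanDomain.mod_lt _ h.1)

theorem IsMinimalCorner.dvd_row (h : IsMinimalCorner C) (j : Fin (n + 1)) : C 0 0 ∣ C 0 j :=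
  h.transpose.dvd_col j

theorem IsMinimalCorner.exists_clear_col (h : IsMinimalCorner C) :
    ∃ B, UnimodEquiv C B ∧ (∀ j, B 0 j = C 0 j) ∧ ∀ i ≠ 0, B i 0 = 0 := by
  choose q hq using h.dvd_col
  refine ⟨_, unimodEquiv_add_vecMulVec_row C (c := fun i => if i = 0 then 0 else -q i)
    (if_pos rfl), fun j => by simp [vecMulVec_apply], fun i hi => ?_⟩
  simp only [Matrix.add_apply, vecMulVec_apply, if_neg hi]
  rw [hq i]
  ring

theorem IsMinimalCorner.exists_clear_col_row (h : IsMinimalCorner C) :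
    ∃ B, UnimodEquiv C B ∧ IsMinimalCorner B ∧ (∀ i ≠ 0, B i 0 = 0) ∧ ∀ j ≠ 0, B 0 j = 0 := by
  obtain ⟨B, hCB, hrow, hcol⟩ := h.exists_clear_col
  have hB := h.of_unimodEquiv hCB (hrow 0)
  obtain ⟨E, hBE, hErow, hEcol⟩ := hB.transpose.exists_clear_col
  have hE := hB.transpose.of_unimodEquiv hBE (hErow 0)
  refine ⟨Eᵀ, hCB.trans (by simpa using hBE.transpose), hE.transpose, fun i hi => ?_, hEcol⟩
  exact (hErow i).trans (hcol i hi)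

theorem IsMinimalCorner.dvd_of_clear_col (h : IsMinimalCorner C) (hcol : ∀ i ≠ 0, C i 0 = 0)
    (i j : Fin (n + 1)) : C 0 0 ∣ C i j := by
  rcases eq_or_ne i 0 with rfl | hi
  · exact h.dvd_row j
  let c : Fin (n + 1) → R := Pi.single 0 1
  have hc : c i = 0 := Pi.single_eq_of_ne hi _
  -- Adding row `i` to row `0` does not change the corner, so row `0` stays divisible by it.
  have row_zero (l : Fin (n + 1)) : (C + vecMulVec c (C i)) 0 l = C 0 l + C i l := by
    simp [c, vecMulVec_apply]
  have corner : (C + vecMulVec c (C i)) 0 0 = C 0 0 := by rw [row_zero, hcol i hi, add_zero]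
  have hdvd := (h.of_unimodEquiv (unimodEquiv_add_vecMulVec_row C hc) corner).dvd_row j
  rw [corner, row_zero] at hdvd
  exact (dvd_add_right (h.dvd_row j)).1 hdvd

theorem exists_unimodEquiv_diagonal {n : ℕ} (A : Matrix (Fin n) (Fin n) R) :
    ∃ d : Fin n → R, UnimodEquiv A (diagonal d) ∧ ∀ i j, i ≤ j → d i ∣ d j := by
  induction n with
  | zero => exact ⟨0, ⟨1, 1, Subsingleton.elim _ _⟩, fun i => i.elim0⟩
  | succ n ih =>
    by_cases hA : A = 0
    · exact ⟨0, ⟨1, 1, by simp [hA]⟩, fun i j _ => by simp⟩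
    obtain ⟨C, hAC, hC⟩ := exists_isMinimalCorner hA
    obtain ⟨B, hCB, hB, hcol, hrow⟩ := hC.exists_clear_col_row
    obtain ⟨d, hd, hdvd⟩ := ih (B.submatrix Fin.succ Fin.succ)
    have head_dvd (i : Fin n) : B 0 0 ∣ d i := by
      simpa using hd.dvd (fun i j => hB.dvd_of_clear_col hcol i.succ j.succ) i i
    refine ⟨Fin.cons (B 0 0) d, ?_, fun i j => ?_⟩
    · rw [← cornerBlock_diagonal]
      exact (hAC.trans hCB).trans (eq_cornerBlock hcol hrow ▸ hd.cornerBlock (B 0 0))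
    · refine Fin.cases ?_ (fun i => ?_) i <;> refine Fin.cases ?_ (fun j => ?_) j
      · simp
      · simpa using head_dvd j
      · simp
      · simpa using hdvd i j

end EuclideanDomain

theorem exists_unimodEquiv_diagonal_natCast {n : ℕ} (A : Matrix (Fin n) (Fin n) ℤ) :
    ∃ d : Fin n → ℕ, UnimodEquiv A (diagonal fun i => (d i : ℤ)) ∧ ∀ i j, i ≤ j → d i ∣ d j := by
  obtain ⟨d, hd, hdvd⟩ := exists_unimodEquiv_diagonal A
  exact ⟨fun i => (d i).natAbs,
    hd.trans (unimodEquiv_diagonal_of_associated fun i => Int.associated_natAbs (d i)),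
    fun i j hij => Int.natAbs_dvd_natAbs.2 (hdvd i j hij)⟩

section RankOf

variable {n r k : ℕ} {A : Matrix (Fin n) (Fin n) ℤ}

theorem exists_isRankOf (r : ℕ) (A : Matrix (Fin n) (Fin n) ℤ) : ∃ k, IsRankOf r A k := by
  obtain ⟨d, ⟨P, Q, h⟩, hd⟩ := exists_unimodEquiv_diagonal_natCast A
  exact ⟨_, P, Q, d, h, hd, rfl⟩

theorem IsRankOf.transpose (h : IsRankOf r A k) : IsRankOf r Aᵀ k := by
  obtain ⟨P, Q, d, h, hd, hk⟩ := h
  obtain ⟨P', Q', h'⟩ := UnimodEquiv.transpose ⟨P, Q, h⟩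
  exact ⟨P', Q', d, by rw [h', diagonal_transpose], hd, hk⟩

theorem IsRankOf.pos (hr : 0 < r) (h : IsRankOf r A k) : 0 < k := by
  obtain ⟨P, Q, d, -, -, rfl⟩ := h
  exact Finset.prod_pos fun i _ =>
    Nat.div_pos (Nat.le_of_dvd hr (Nat.gcd_dvd_left _ _)) (Nat.gcd_pos_of_pos_left _ hr)

theorem UnimodEquiv.card_range {R ι : Type*} [CommRing R] [Fintype ι] [DecidableEq ι]
    {A B : Matrix ι ι R} (h : UnimodEquiv A B) :
    Nat.card A.mulVecLin.range = Nat.card B.mulVecLin.range := by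
  obtain ⟨P, Q, rfl⟩ := h
  have surjective : Q.1.mulVecLin.range = ⊤ := LinearMap.range_eq_top.2 fun v =>
    ⟨(Q⁻¹).1 *ᵥ v, by simp [Matrix.mulVec_mulVec]⟩
  rw [mulVecLin_mul, mulVecLin_mul, LinearMap.range_comp_of_range_eq_top _ surjective,
    LinearMap.range_comp]
  exact (Nat.card_image_of_injective (mulVec_injective_of_isUnit P.isUnit) _).symm

theorem card_range_diagonal {R ι : Type*} [CommRing R] [Fintype ι] [DecidableEq ι] (d : ι → R) :
    Nat.card (diagonal d).mulVecLin.range = ∏ i, Nat.card (Set.range (d i * ·)) := by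
  have mem_range (v : ι → R) :
      v ∈ (diagonal d).mulVecLin.range ↔ ∀ i, v i ∈ Set.range (d i * ·) := by
    simp only [LinearMap.mem_range, mulVecLin_apply, funext_iff, mulVec_diagonal, Set.mem_range,
      Classical.skolem]
  rw [← Nat.card_pi]
  exact Nat.card_congr ((Equiv.subtypeEquivRight mem_range).trans Equiv.subtypePiEquivPi)

theorem card_range_natCast_mul_zmod (hr : 0 < r) (d : ℕ) :
    Nat.card (Set.range ((d : ZMod r) * ·)) = r / r.gcd d := by
  have range_eq : Set.range ((d : ZMod r) * ·)
      = (AddSubgroup.zmultiples (d : ZMod r) : Set (ZMod r)) := by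
    ext y
    constructor
    · rintro ⟨x, rfl⟩
      obtain ⟨k, rfl⟩ := ZMod.intCast_surjective x
      exact AddSubgroup.mem_zmultiples_iff.2 ⟨k, by simp [mul_comm]⟩
    · intro hy
      obtain ⟨k, rfl⟩ := AddSubgroup.mem_zmultiples_iff.1 hy
      exact ⟨k, by simp [mul_comm]⟩
  rw [range_eq]
  exact (Nat.card_zmultiples _).trans (ZMod.addOrderOf_coe _ hr.ne')

/-- The image of `A` in `(ℤ / r)ⁿ`; it indexes the words in the `V_j` up to scalars, as the image
of `Aᵀ` does for the `U_k`. -/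
abbrev imageMod (r : ℕ) (A : Matrix (Fin n) (Fin n) ℤ) : Submodule (ZMod r) (Fin n → ZMod r) :=
  (A.map (Int.castRingHom (ZMod r))).mulVecLin.range

theorem IsRankOf.eq_card (hr : 0 < r) (h : IsRankOf r A k) : k = Nat.card (imageMod r A) := by
  obtain ⟨P, Q, d, hPQ, -, rfl⟩ := h
  have h := (UnimodEquiv.map (Int.castRingHom (ZMod r)) ⟨P, Q, hPQ⟩).card_range
  rw [diagonal_map (map_zero _), card_range_diagonal] at h
  rw [h]
  exact Finset.prod_congr rfl fun i _ => by
    simpa using (card_range_natCast_mul_zmod hr (d i)).symm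

theorem intCast_mulVec_zmod (r : ℕ) (A : Matrix (Fin n) (Fin n) ℤ) (m : Fin n → ℤ) (i : Fin n) :
    (((A *ᵥ m) i : ℤ) : ZMod r)
      = (A.map (Int.castRingHom (ZMod r)) *ᵥ fun j => (m j : ZMod r)) i :=
  RingHom.map_mulVec (Int.castRingHom (ZMod r)) A m i

theorem exists_lift_imageMod (A : Matrix (Fin n) (Fin n) ℤ) (x : imageMod r A) :
    ∃ m : Fin n → ℤ, ∀ i, (((A *ᵥ m) i : ℤ) : ZMod r) = x.1 i := by
  obtain ⟨y, hy⟩ := x.2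
  choose m hm using fun i => ZMod.intCast_surjective (y i)
  refine ⟨m, fun i => ?_⟩
  rw [intCast_mulVec_zmod, funext hm, ← hy]
  rfl

end RankOf

/-! ### Lattices attached to a slope -/

section SlopeLattice

variable {n : ℕ}

/-- The subgroup `2π ((1/r) A ℤⁿ + ℤⁿ)` of `ℝⁿ`. -/
def slopeLattice (r : ℕ) (A : Matrix (Fin n) (Fin n) ℤ) : AddSubgroup (Fin n → ℝ) where
  carrier := {v | ∃ m l : Fin n → ℤ, ∀ i, v i = 2 * π * (((A *ᵥ m) i : ℤ) / (r : ℝ) + l i)}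
  zero_mem' := ⟨0, 0, by simp⟩
  add_mem' := by
    rintro v w ⟨m, l, hv⟩ ⟨m', l', hw⟩
    refine ⟨m + m', l + l', fun i => ?_⟩
    simp only [Pi.add_apply, hv, hw, mulVec_add, Int.cast_add]
    ring
  neg_mem' := by
    rintro v ⟨m, l, hv⟩
    refine ⟨-m, -l, fun i => ?_⟩
    simp only [Pi.neg_apply, hv, mulVec_neg, Int.cast_neg]
    ring

theorem toR_mulVec_intCast (A : Matrix (Fin n) (Fin n) ℤ) (m : Fin n → ℤ) (i : Fin n) :
    (toR A *ᵥ fun j => (m j : ℝ)) i = ((A *ᵥ m) i : ℤ) :=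
  (RingHom.map_mulVec (Int.castRingHom ℝ) A m i).symm

variable {r : ℕ} {A : Matrix (Fin n) (Fin n) ℤ}

theorem mulVec_mem_slopeLattice (B : Matrix (Fin n) (Fin n) ℤ) {v : Fin n → ℝ}
    (hv : v ∈ slopeLattice r A) : toR B *ᵥ v ∈ slopeLattice r (B * A) := by
  obtain ⟨m, l, hv⟩ := hv
  refine ⟨m, B *ᵥ l, fun i => ?_⟩
  have decompose : v = (2 * π / r) • (fun i => (((A *ᵥ m) i : ℤ) : ℝ))
      + (2 * π) • fun i => (l i : ℝ) := by
    ext i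
    simp only [hv, Pi.add_apply, Pi.smul_apply, smul_eq_mul]
    ring
  simp only [decompose, mulVec_add, mulVec_smul, Pi.add_apply, Pi.smul_apply, smul_eq_mul,
    toR_mulVec_intCast, mulVec_mulVec]
  ring

theorem slopeLattice_mul_le (A P : Matrix (Fin n) (Fin n) ℤ) :
    slopeLattice r (A * P) ≤ slopeLattice r A := by
  rintro v ⟨m, l, hv⟩
  exact ⟨P *ᵥ m, l, by simpa only [mulVec_mulVec] using hv⟩

theorem exists_eq_of_mul_div_gcd_eq (hr : 0 < r) (d : ℕ) {b : ℝ} {z : ℤ}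
    (h : b * (r / r.gcd d : ℕ) = 2 * π * z) :
    ∃ x y : ℤ, b = 2 * π * ((d * x : ℤ) / (r : ℝ) + y) := by
  have hr' : (r : ℝ) ≠ 0 := Nat.cast_ne_zero.2 hr.ne'
  have bezout : (r.gcd d : ℝ) = r * r.gcdA d + d * r.gcdB d := by
    exact_mod_cast Nat.gcd_eq_gcd_ab r d
  have hgcd : ((r / r.gcd d : ℕ) : ℝ) * r.gcd d = r := by
    exact_mod_cast Nat.div_mul_cancel (Nat.gcd_dvd_left r d)
  refine ⟨z * r.gcdB d, z * r.gcdA d, ?_⟩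
  push_cast
  field_simp
  linear_combination (-b) * hgcd + (r.gcd d : ℝ) * h + 2 * π * z * bezout

theorem mem_slopeLattice_diagonal (hr : 0 < r) (d : Fin n → ℕ) {b : Fin n → ℝ}
    (hb : ∀ m : Fin n → ℤ, (∀ i, (r : ℤ) ∣ d i * m i) →
      ∃ z : ℤ, b ⬝ᵥ (fun i => (m i : ℝ)) = 2 * π * z) :
    b ∈ slopeLattice r (diagonal fun i => (d i : ℤ)) := by
  have coordinate (i : Fin n) : ∃ x y : ℤ, b i = 2 * π * ((d i * x : ℤ) / (r : ℝ) + y) := by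
    obtain ⟨z, hz⟩ := hb (Pi.single i ((r / r.gcd (d i) : ℕ) : ℤ)) fun j => by
      rcases eq_or_ne j i with rfl | hj
      · rw [Pi.single_eq_same]
        refine Int.natCast_dvd_natCast.2 ⟨d j / r.gcd (d j), ?_⟩
        rw [← Nat.mul_div_assoc _ (Nat.gcd_dvd_left _ _), mul_comm,
          ← Nat.mul_div_assoc _ (Nat.gcd_dvd_right _ _)]
      · simp [hj]
    refine exists_eq_of_mul_div_gcd_eq hr (d i) (z := z) (hz ▸ ?_)
    simp [dotProduct, Pi.single_apply, -Nat.cast_div_charZero, -Int.natCast_ediv]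
  choose x y hxy using coordinate
  exact ⟨x, y, fun i => by rw [hxy, mulVec_diagonal]⟩

theorem dotProduct_mulVec_intCast (Q : Matrix (Fin n) (Fin n) ℤ) (b : Fin n → ℝ)
    (m : Fin n → ℤ) : ((toR Q)ᵀ *ᵥ b) ⬝ᵥ (fun i => (m i : ℝ))
      = b ⬝ᵥ fun i => (((Q *ᵥ m) i : ℤ) : ℝ) := by
  rw [← funext (toR_mulVec_intCast Q m), dotProduct_mulVec, mulVec_transpose]

theorem exists_dotProduct_eq_of_mem_slopeLattice_transpose (hr : 0 < r) {b : Fin n → ℝ}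
    (hb : b ∈ slopeLattice r Aᵀ) {m : Fin n → ℤ} (hm : ∀ i, (r : ℤ) ∣ (A *ᵥ m) i) :
    ∃ z : ℤ, b ⬝ᵥ (fun i => (m i : ℝ)) = 2 * π * z := by
  obtain ⟨l, l', hb⟩ := hb
  choose c hc using hm
  have integral : (Aᵀ *ᵥ l) ⬝ᵥ m = r * (l ⬝ᵥ c) := by
    rw [mulVec_transpose, ← dotProduct_mulVec, funext hc, ← smul_eq_mul, ← dotProduct_smul]
    rfl
  refine ⟨l ⬝ᵥ c + l' ⬝ᵥ m, ?_⟩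
  calc b ⬝ᵥ (fun i => (m i : ℝ))
      = 2 * π * (((Aᵀ *ᵥ l) ⬝ᵥ m : ℤ) / (r : ℝ) + (l' ⬝ᵥ m : ℤ)) := by
        simp only [dotProduct, hb, Int.cast_sum, Int.cast_mul, Finset.sum_div, Finset.mul_sum,
          mul_add, add_mul, Finset.sum_add_distrib]
        congr 1 <;> exact Finset.sum_congr rfl fun i _ => by ring
    _ = _ := by
        rw [integral]
        push_cast
        field_simp

theorem mem_slopeLattice_transpose_iff (hr : 0 < r) {b : Fin n → ℝ} :
    b ∈ slopeLattice r Aᵀ ↔ ∀ m : Fin n → ℤ, (∀ i, (r : ℤ) ∣ (A *ᵥ m) i) →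
      ∃ z : ℤ, b ⬝ᵥ (fun i => (m i : ℝ)) = 2 * π * z := by
  refine ⟨fun hb m => exists_dotProduct_eq_of_mem_slopeLattice_transpose hr hb, fun hb => ?_⟩
  obtain ⟨d, ⟨P, Q, hPQ⟩, -⟩ := exists_unimodEquiv_diagonal_natCast A
  have hAQ : A * Q.1 = (P⁻¹).1 * diagonal fun i => (d i : ℤ) := by
    rw [← hPQ, Matrix.mul_assoc, ← Matrix.mul_assoc, Units.inv_mul, Matrix.one_mul]
  have transformed := mem_slopeLattice_diagonal hr d (b := (toR Q.1)ᵀ *ᵥ b) fun m hm => by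
    rw [dotProduct_mulVec_intCast]
    refine hb _ fun i => ?_
    rw [mulVec_mulVec, hAQ, ← mulVec_mulVec]
    rw [Matrix.mulVec, dotProduct]
    refine Finset.dvd_sum fun j _ => Dvd.dvd.mul_left ?_ _
    rw [mulVec_diagonal]
    exact hm j
  have restored : b = toR (Q⁻¹).1ᵀ *ᵥ ((toR Q.1)ᵀ *ᵥ b) := by
    have mul_inv : toR Q.1 * toR (Q⁻¹).1 = toR (Q.1 * (Q⁻¹).1) :=
      (Matrix.map_mul (f := Int.castRingHom ℝ)).symm
    have transpose_toR : toR (Q⁻¹).1ᵀ = (toR (Q⁻¹).1)ᵀ := rfl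
    rw [mulVec_mulVec, transpose_toR, ← transpose_mul, mul_inv, Units.mul_inv]
    simp
  have product : (Q⁻¹).1ᵀ * diagonal (fun i => (d i : ℤ)) = Aᵀ * P.1ᵀ := by
    rw [← diagonal_transpose, ← hPQ, ← transpose_mul, ← transpose_mul, Matrix.mul_assoc,
      Units.mul_inv, Matrix.mul_one]
  rw [restored]
  exact slopeLattice_mul_le Aᵀ P.1ᵀ (product ▸ mulVec_mem_slopeLattice _ transformed)

end SlopeLattice

/-! ### Commutation up to phases of unitary matrices -/

section UnitaryMatrices

variable {m m' ι : Type*} [Fintype m] [Fintype m']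

open scoped ComplexOrder in
theorem trace_conjTranspose_mul_self_ne_zero {X : Matrix m' m ℂ} (hX : X ≠ 0) :
    (Xᴴ * X).trace ≠ 0 :=
  fun h => hX (trace_conjTranspose_mul_self_eq_zero_iff.1 h)

theorem linearIndependent_of_trace_conjTranspose_mul {b : ι → Matrix m' m ℂ} (h0 : ∀ i, b i ≠ 0)
    (h : Pairwise fun i j => ((b i)ᴴ * b j).trace = 0) : LinearIndependent ℂ b := by
  classical
  refine linearIndependent_iff'.2 fun s c hc i hi => ?_
  have projected := congrArg (fun M => ((b i)ᴴ * M).trace) hc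
  simp only [Matrix.mul_sum, Matrix.mul_smul, trace_sum, trace_smul, Matrix.mul_zero,
    trace_zero] at projected
  rw [Finset.sum_eq_single_of_mem i hi fun j _ hj => by rw [h hj.symm, smul_zero]] at projected
  exact (smul_eq_zero.1 projected).resolve_right (trace_conjTranspose_mul_self_ne_zero (h0 i))

variable [DecidableEq m] [DecidableEq m']

theorem mul_conjTranspose_unitary (W : unitaryGroup m ℂ) : W.1 * W.1ᴴ = 1 :=
  mem_unitaryGroup_iff.1 W.2

theorem conjTranspose_mul_unitary (W : unitaryGroup m ℂ) : W.1ᴴ * W.1 = 1 :=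
  mem_unitaryGroup_iff'.1 W.2

theorem star_mul_self_eq_one {c : ℂ} (hc : ‖c‖ = 1) : star c * c = 1 := by
  rw [mul_comm, Complex.star_def, Complex.mul_conj']
  simp [hc]

theorem norm_exp_I_mul (t : ℝ) : ‖Complex.exp (Complex.I * t)‖ = 1 := by
  rw [mul_comm, Complex.norm_exp_ofReal_mul_I]

section Intertwiner

variable {W : unitaryGroup m ℂ} {W' : unitaryGroup m' ℂ} {X Y : Matrix m' m ℂ} {c d : ℂ}

theorem unitary_mul_conjTranspose (hX : W'.1 * X = c • (X * W.1)) :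
    W.1 * Xᴴ = star c • (Xᴴ * W'.1) := by
  have adjoint := congrArg (fun M => W.1 * Mᴴ * W'.1) hX
  simpa only [conjTranspose_mul, conjTranspose_smul, Matrix.mul_assoc, Matrix.mul_smul,
    Matrix.smul_mul, conjTranspose_mul_unitary, Matrix.mul_one, ← Matrix.mul_assoc W.1 W.1ᴴ,
    mul_conjTranspose_unitary, Matrix.one_mul] using adjoint

theorem unitary_mul_conjTranspose_mul (hX : W'.1 * X = c • (X * W.1))
    (hY : W'.1 * Y = d • (Y * W.1)) : W.1 * (Xᴴ * Y) = (star c * d) • (Xᴴ * Y * W.1) := by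
  rw [← Matrix.mul_assoc, unitary_mul_conjTranspose hX, Matrix.smul_mul, Matrix.mul_assoc, hY,
    Matrix.mul_smul, smul_smul, Matrix.mul_assoc]

theorem trace_conjTranspose_mul_eq (hX : W'.1 * X = c • (X * W.1))
    (hY : W'.1 * Y = d • (Y * W.1)) : (Xᴴ * Y).trace = star c * d * (Xᴴ * Y).trace := by
  calc (Xᴴ * Y).trace = (W.1 * (Xᴴ * Y) * W.1ᴴ).trace := by
        rw [trace_mul_comm (W.1 * _), ← Matrix.mul_assoc, conjTranspose_mul_unitary, Matrix.one_mul]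
    _ = star c * d * (Xᴴ * Y).trace := by
        rw [unitary_mul_conjTranspose_mul hX hY, Matrix.smul_mul, Matrix.mul_assoc _ W.1,
          mul_conjTranspose_unitary, Matrix.mul_one, trace_smul, smul_eq_mul]

theorem norm_eq_one_of_unitary_mul_eq (h0 : X ≠ 0) (hX : W'.1 * X = c • (X * W.1)) : ‖c‖ = 1 := by
  have normSq : star c * c = 1 := by
    have trace_eq := trace_conjTranspose_mul_eq hX hX
    exact (mul_eq_right₀ (trace_conjTranspose_mul_self_ne_zero h0)).1 trace_eq.symm
  rw [Complex.star_def, Complex.conj_mul'] at normSq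
  exact (pow_eq_one_iff_of_nonneg (norm_nonneg c) two_ne_zero).1 (by exact_mod_cast normSq)

theorem trace_conjTranspose_mul_eq_zero (hc : ‖c‖ = 1) (hcd : c ≠ d)
    (hX : W'.1 * X = c • (X * W.1)) (hY : W'.1 * Y = d • (Y * W.1)) : (Xᴴ * Y).trace = 0 := by
  by_contra h
  have inverse : star c * d = 1 := (mul_eq_right₀ h).1 (trace_conjTranspose_mul_eq hX hY).symm
  have hc0 : star c ≠ 0 := left_ne_zero_of_mul (star_mul_self_eq_one hc ▸ one_ne_zero)
  exact hcd (mul_left_cancel₀ hc0 ((star_mul_self_eq_one hc).trans inverse.symm))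

theorem commute_conjTranspose_mul_self (hc : ‖c‖ = 1) (hX : W'.1 * X = c • (X * W.1)) :
    Commute (Xᴴ * X) W.1 := by
  have h := unitary_mul_conjTranspose_mul hX hX
  rw [star_mul_self_eq_one hc, one_smul] at h
  exact h.symm

end Intertwiner

theorem exists_common_eigenvector {K E : Type*} [Field K] [IsAlgClosed K] [AddCommGroup E]
    [Module K E] [FiniteDimensional K E] [Nontrivial E] (f : ι → Module.End K E)
    (hf : ∀ i j, Commute (f i) (f j)) : ∃ v : E, v ≠ 0 ∧ ∀ i, ∃ c : K, f i v = c • v := by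
  -- On a minimal nonzero invariant subspace every `f i` is a scalar.
  let invariant : Set (Submodule K E) := {S | S ≠ ⊥ ∧ ∀ i, ∀ v ∈ S, f i v ∈ S}
  obtain ⟨S, ⟨S_ne_bot, S_inv⟩, S_min⟩ :=
    wellFounded_lt.has_min invariant ⟨⊤, top_ne_bot, fun _ _ _ => trivial⟩
  have scalar : ∀ i, ∃ c : K, ∀ v ∈ S, f i v = c • v := by
    intro i
    have : Nontrivial S := Submodule.nontrivial_iff_ne_bot.2 S_ne_bot
    obtain ⟨c, hc⟩ := Module.End.exists_eigenvalue ((f i).restrict (S_inv i))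
    obtain ⟨v, hv⟩ := hc.exists_hasEigenvector
    have eigenspace_inv : S ⊓ (f i).eigenspace c ∈ invariant := by
      refine ⟨(Submodule.ne_bot_iff _).2 ⟨v, ⟨v.2, ?_⟩, fun h => hv.2 (Subtype.ext h)⟩,
        fun j w hw => ⟨S_inv j w hw.1, ?_⟩⟩
      · exact Module.End.mem_eigenspace_iff.2 (congrArg Subtype.val hv.apply_eq_smul)
      · exact Module.End.mapsTo_genEigenspace_of_comm (hf j i).symm c 1 hw.2
    have eigenspace_eq : S ⊓ (f i).eigenspace c = S :=
      inf_le_left.eq_of_not_lt (S_min _ eigenspace_inv)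
    exact ⟨c, fun w hw => Module.End.mem_eigenspace_iff.1 (eigenspace_eq.ge hw).2⟩
  obtain ⟨v, hv, hv0⟩ := (Submodule.ne_bot_iff _).1 S_ne_bot
  exact ⟨v, hv0, fun i => (scalar i).imp fun c hc => hc v hv⟩

end UnitaryMatrices

section Twist

variable {k k' : ℕ} {s t : ℝ}

theorem Twist.mul_left {g g' h : unitaryGroup (Fin k) ℂ} (a : Twist s g h) (b : Twist t g' h) :
    Twist (s + t) (g * g') h := by
  have := (a.swap.mul_right b.swap).swap
  rwa [neg_add_rev, neg_neg, neg_neg, add_comm] at this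

theorem Twist.of_commute {g h : unitaryGroup (Fin k) ℂ} (a : Commute g h) : Twist 0 g h := by
  rw [Twist, phase_zero, one_mul, a.eq]

theorem Twist.coe_mul {g h : unitaryGroup (Fin k) ℂ} (a : Twist t g h) :
    g.1 * h.1 = Complex.exp (Complex.I * t) • (h.1 * g.1) := by
  simpa [phase, mul_comm] using congrArg Subtype.val a

/-- Conjugation `X ↦ W' X W⁻¹`; its eigenvectors are intertwiners up to a scalar. -/
def conjugation (W : unitaryGroup (Fin k) ℂ) (W' : unitaryGroup (Fin k') ℂ) :
    Module.End ℂ (Matrix (Fin k') (Fin k) ℂ) where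
  toFun X := W'.1 * X * W.1ᴴ
  map_add' X Y := by rw [Matrix.mul_add, Matrix.add_mul]
  map_smul' c X := by simp

theorem commute_conjugation {g h : unitaryGroup (Fin k) ℂ} {g' h' : unitaryGroup (Fin k') ℂ}
    (a : Twist t g h) (a' : Twist t g' h') : Commute (conjugation g g') (conjugation h h') := by
  refine LinearMap.ext fun X => ?_
  change g'.1 * (h'.1 * X * h.1ᴴ) * g.1ᴴ = h'.1 * (g'.1 * X * g.1ᴴ) * h.1ᴴ
  have adjoint := congrArg conjTranspose a.coe_mul
  rw [conjTranspose_smul, conjTranspose_mul, conjTranspose_mul] at adjoint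
  calc g'.1 * (h'.1 * X * h.1ᴴ) * g.1ᴴ = g'.1 * h'.1 * X * (h.1ᴴ * g.1ᴴ) := by
        simp only [Matrix.mul_assoc]
    _ = h'.1 * g'.1 * X * (g.1ᴴ * h.1ᴴ) := by
        rw [a'.coe_mul, adjoint, Matrix.smul_mul, Matrix.smul_mul, Matrix.mul_smul, smul_smul,
          mul_comm, star_mul_self_eq_one (norm_exp_I_mul t), one_smul]
    _ = h'.1 * (g'.1 * X * g.1ᴴ) * h.1ᴴ := by simp only [Matrix.mul_assoc]

end Twist

section PhaseConj

variable {ι : Type*} {k k' k'' : ℕ} {s t : ι → ℝ} {W : ι → Matrix (Fin k) (Fin k) ℂ}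
  {W' : ι → Matrix (Fin k') (Fin k') ℂ} {W'' : ι → Matrix (Fin k'') (Fin k'') ℂ}

/-- The families `W` and `W'` agree up to a common change of frame and the phases
`exp (i t)`. The sizes `k` and `k'` are then equal, but need not be so definitionally. -/
def PhaseConj (t : ι → ℝ) (W : ι → Matrix (Fin k) (Fin k) ℂ)
    (W' : ι → Matrix (Fin k') (Fin k') ℂ) : Prop :=
  ∃ (g : Matrix (Fin k') (Fin k) ℂ) (g' : Matrix (Fin k) (Fin k') ℂ), g * g' = 1 ∧ g' * g = 1 ∧
    ∀ i, W' i = Complex.exp (Complex.I * t i) • (g * W i * g')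

theorem PhaseConj.size_eq (h : PhaseConj t W W') : k = k' := by
  obtain ⟨g, g', h1, h2, -⟩ := h
  simpa using (Fintype.card_congr (indexEquivOfInv h1 h2)).symm

theorem PhaseConj.symm (h : PhaseConj t W W') : PhaseConj (-t) W' W := by
  obtain ⟨g, g', h1, h2, h⟩ := h
  refine ⟨g', g, h2, h1, fun i => ?_⟩
  have conj_conj : g' * (g * W i * g') * g = W i := by
    calc _ = g' * g * W i * (g' * g) := by simp only [Matrix.mul_assoc]
      _ = W i := by rw [h2, Matrix.one_mul, Matrix.mul_one]
  rw [h, Matrix.mul_smul, Matrix.smul_mul, smul_smul, ← Complex.exp_add, conj_conj]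
  simp

theorem PhaseConj.trans (h : PhaseConj s W W') (h' : PhaseConj t W' W'') :
    PhaseConj (s + t) W W'' := by
  obtain ⟨a, a', ha, ha', h⟩ := h
  obtain ⟨b, b', hb, hb', h'⟩ := h'
  refine ⟨b * a, a' * b', ?_, ?_, fun i => ?_⟩
  · rw [Matrix.mul_assoc, ← Matrix.mul_assoc a, ha, Matrix.one_mul, hb]
  · rw [Matrix.mul_assoc, ← Matrix.mul_assoc b', hb', Matrix.one_mul, ha']
  · rw [h', h, Matrix.mul_smul, Matrix.smul_mul, smul_smul, ← Complex.exp_add]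
    simp only [Matrix.mul_assoc, Pi.add_apply, Complex.ofReal_add, mul_add, add_comm]

theorem PhaseConj.det_eq (h : PhaseConj t W W') (i : ι) :
    (W' i).det = Complex.exp (Complex.I * (k * t i : ℝ)) * (W i).det := by
  have size_eq := h.size_eq
  obtain ⟨g, g', h1, h2, h⟩ := h
  rw [h, det_smul, det_conj_of_mul_eq_one h1 h2, Fintype.card_fin, ← size_eq,
    ← Complex.exp_nat_mul]
  congr 2
  push_cast
  ring

/-- Only scalars commute with the family `W`. -/
def HasScalarCommutant (W : ι → Matrix (Fin k) (Fin k) ℂ) : Prop :=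
  ∀ M, (∀ i, Commute M (W i)) → ∃ c : ℂ, M = c • 1

theorem exists_inverse_of_scalar_conjTranspose_mul {X : Matrix (Fin k') (Fin k) ℂ} (hX : X ≠ 0)
    {c c' : ℂ} (h : Xᴴ * X = c • 1) (h' : X * Xᴴ = c' • 1) :
    ∃ Y : Matrix (Fin k) (Fin k') ℂ, X * Y = 1 ∧ Y * X = 1 := by
  have c_ne_zero : c ≠ 0 := by
    rintro rfl
    exact trace_conjTranspose_mul_self_ne_zero hX (by rw [h, zero_smul, trace_zero])
  have c_eq : c = c' := by
    have assoc : X * (Xᴴ * X) = X * Xᴴ * X := (Matrix.mul_assoc _ _ _).symm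
    rw [h, h', Matrix.mul_smul, Matrix.mul_one, Matrix.smul_mul, Matrix.one_mul] at assoc
    exact smul_left_injective ℂ hX assoc
  refine ⟨c⁻¹ • Xᴴ, ?_, ?_⟩
  · rw [Matrix.mul_smul, h', ← c_eq, smul_smul, inv_mul_cancel₀ c_ne_zero, one_smul]
  · rw [Matrix.smul_mul, h, smul_smul, inv_mul_cancel₀ c_ne_zero, one_smul]

theorem exists_phaseConj_of_twist (hk : 0 < k) (hk' : 0 < k') (W : ι → unitaryGroup (Fin k) ℂ)
    (W' : ι → unitaryGroup (Fin k') ℂ) (t : ι → ι → ℝ) (h : ∀ i j, Twist (t i j) (W i) (W j))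
    (h' : ∀ i j, Twist (t i j) (W' i) (W' j)) (hW : HasScalarCommutant fun i => (W i).1)
    (hW' : HasScalarCommutant fun i => (W' i).1) :
    ∃ τ, PhaseConj τ (fun i => (W i).1) fun i => (W' i).1 := by
  have : Nonempty (Fin k) := ⟨⟨0, hk⟩⟩
  have : Nonempty (Fin k') := ⟨⟨0, hk'⟩⟩
  obtain ⟨X, X_ne_zero, eigen⟩ := exists_common_eigenvector (fun i => conjugation (W i) (W' i))
    fun i j => commute_conjugation (h i j) (h' i j)
  choose c hc using eigen
  have intertwines : ∀ i, (W' i).1 * X = c i • (X * (W i).1) := fun i => by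
    have : (W' i).1 * X * (W i).1ᴴ = c i • X := hc i
    rw [← Matrix.smul_mul, ← this, Matrix.mul_assoc, conjTranspose_mul_unitary, Matrix.mul_one]
  have norm_c : ∀ i, ‖c i‖ = 1 := fun i => norm_eq_one_of_unitary_mul_eq X_ne_zero (intertwines i)
  obtain ⟨a, ha⟩ := hW (Xᴴ * X) fun i =>
    commute_conjTranspose_mul_self (norm_c i) (intertwines i)
  obtain ⟨a', ha'⟩ := hW' (X * Xᴴ) fun i => by
    simpa using commute_conjTranspose_mul_self ((norm_star _).trans (norm_c i))
      (unitary_mul_conjTranspose (intertwines i))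
  obtain ⟨Y, hXY, hYX⟩ := exists_inverse_of_scalar_conjTranspose_mul X_ne_zero ha ha'
  choose τ hτ using fun i => (Complex.norm_eq_one_iff _).1 (norm_c i)
  refine ⟨τ, X, Y, hXY, hYX, fun i => ?_⟩
  rw [mul_comm, hτ, ← Matrix.smul_mul, ← intertwines, Matrix.mul_assoc, hXY, Matrix.mul_one]

end PhaseConj

/-! ### Words in the transition matrices -/

section IntertwinesUpTo

variable {k k' n : ℕ} {s t : ℝ} {X : Matrix (Fin k') (Fin k) ℂ} {g h : unitaryGroup (Fin k) ℂ}
  {g' h' : unitaryGroup (Fin k') ℂ}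

/-- `X` intertwines `g` and `g'` up to the phase `exp (i t)`. -/
def IntertwinesUpTo (X : Matrix (Fin k') (Fin k) ℂ) (t : ℝ) (g : unitaryGroup (Fin k) ℂ)
    (g' : unitaryGroup (Fin k') ℂ) : Prop :=
  g'.1 * X = Complex.exp (Complex.I * t) • (X * g.1)

theorem IntertwinesUpTo.one : IntertwinesUpTo X 0 1 1 := by
  simp [IntertwinesUpTo]

theorem IntertwinesUpTo.mul (a : IntertwinesUpTo X s g g') (b : IntertwinesUpTo X t h h') :
    IntertwinesUpTo X (s + t) (g * h) (g' * h') := by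
  unfold IntertwinesUpTo at *
  rw [Submonoid.coe_mul, Submonoid.coe_mul, Matrix.mul_assoc, b, Matrix.mul_smul,
    ← Matrix.mul_assoc, a, Matrix.smul_mul, smul_smul, ← Complex.exp_add, Matrix.mul_assoc,
    Complex.ofReal_add, mul_add, add_comm]

theorem IntertwinesUpTo.inv (a : IntertwinesUpTo X t g g') :
    IntertwinesUpTo X (-t) g⁻¹ g'⁻¹ := by
  have cancel : X * g.1ᴴ = Complex.exp (Complex.I * t) • (g'.1ᴴ * X) := by
    calc X * g.1ᴴ = g'.1ᴴ * (g'.1 * X) * g.1ᴴ := by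
          rw [← Matrix.mul_assoc, conjTranspose_mul_unitary, Matrix.one_mul]
      _ = Complex.exp (Complex.I * t) • (g'.1ᴴ * X) := by
          rw [a, Matrix.mul_smul, Matrix.smul_mul, Matrix.mul_assoc, Matrix.mul_assoc,
            mul_conjTranspose_unitary, Matrix.mul_one]
  change g'.1ᴴ * X = Complex.exp (Complex.I * (-t : ℝ)) • (X * g.1ᴴ)
  rw [cancel, smul_smul, ← Complex.exp_add]
  simp

theorem IntertwinesUpTo.zpow (a : IntertwinesUpTo X t g g') (m : ℤ) :
    IntertwinesUpTo X (m * t) (g ^ m) (g' ^ m) := by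
  have pow : ∀ m : ℕ, IntertwinesUpTo X (m * t) (g ^ m) (g' ^ m) := fun m => by
    induction m with
    | zero => simpa using one
    | succ m ih => simpa only [pow_succ, Nat.cast_succ, add_one_mul] using ih.mul a
  cases m with
  | ofNat m => simpa using pow m
  | negSucc m =>
    simpa only [zpow_negSucc, Int.cast_negSucc, neg_mul] using (pow (m + 1)).inv

theorem IntertwinesUpTo.zpowProd {t : Fin n → ℝ} {W : Fin n → unitaryGroup (Fin k) ℂ}
    {W' : Fin n → unitaryGroup (Fin k') ℂ} (h : ∀ j, IntertwinesUpTo X (t j) (W j) (W' j))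
    (m : Fin n → ℤ) :
    IntertwinesUpTo X (∑ j, m j * t j) (zpowProd W m) (zpowProd W' m) := by
  induction n with
  | zero => simpa [TorusMirror.zpowProd] using one
  | succ n ih =>
    rw [zpowProd_succ, zpowProd_succ, Fin.sum_univ_succ]
    exact ((h 0).zpow _).mul (ih (fun j => h j.succ) _)

theorem IntertwinesUpTo.of_eq_conj {X' : Matrix (Fin k) (Fin k') ℂ} (h : X' * X = 1)
    (hg : g'.1 = Complex.exp (Complex.I * t) • (X * g.1 * X')) : IntertwinesUpTo X t g g' := by
  rw [IntertwinesUpTo, hg, Matrix.smul_mul, Matrix.mul_assoc, h, Matrix.mul_one]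

theorem IntertwinesUpTo.comp {k'' : ℕ} {Y : Matrix (Fin k'') (Fin k') ℂ}
    {g'' : unitaryGroup (Fin k'') ℂ} (b : IntertwinesUpTo Y s g' g'')
    (a : IntertwinesUpTo X t g g') : IntertwinesUpTo (Y * X) (s + t) g g'' := by
  unfold IntertwinesUpTo at *
  rw [← Matrix.mul_assoc, b, Matrix.smul_mul, Matrix.mul_assoc, a, Matrix.mul_smul, smul_smul,
    ← Complex.exp_add, ← mul_add, ← Complex.ofReal_add, ← Matrix.mul_assoc]

theorem IntertwinesUpTo.inverse {X' : Matrix (Fin k) (Fin k') ℂ} (h : X * X' = 1)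
    (h' : X' * X = 1) (a : IntertwinesUpTo X t g g') : IntertwinesUpTo X' (-t) g' g := by
  have conj_eq : X' * g'.1 = Complex.exp (Complex.I * t) • (g.1 * X') := by
    calc X' * g'.1 = X' * (g'.1 * X) * X' := by
          rw [Matrix.mul_assoc, Matrix.mul_assoc, h, Matrix.mul_one]
      _ = Complex.exp (Complex.I * t) • (g.1 * X') := by
          rw [a, Matrix.mul_smul, Matrix.smul_mul, ← Matrix.mul_assoc, h', Matrix.one_mul]
  rw [IntertwinesUpTo, conj_eq, smul_smul, ← Complex.exp_add]
  simp

end IntertwinesUpTo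

theorem commute_zpowProd_zpowProd {G : Type*} [Group G] {n : ℕ} {W : Fin n → G}
    (h : ∀ i j, W i * W j = W j * W i) (m l : Fin n → ℤ) :
    Commute (zpowProd W m) (zpowProd W l) :=
  commute_zpowProd _ _ _ fun j => (commute_zpowProd _ _ _ fun i => h j i).symm

theorem exp_eq_stdAddChar (r : ℕ) [NeZero r] (a : ℤ) :
    Complex.exp (Complex.I * (2 * π / r * a : ℝ)) = ZMod.stdAddChar (a : ZMod r) := by
  rw [ZMod.stdAddChar_coe]
  congr 1
  push_cast
  ring

namespace TransData

variable {n : ℕ} {D D' : TransData n}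

theorem rk_pos (D : TransData n) : 0 < D.rk := D.rk_spec.pos D.r_pos

theorem r_ne_zero (D : TransData n) : (D.r : ℝ) ≠ 0 := by exact_mod_cast D.r_pos.ne'

/-- The word `V₁^m₁ ⋯ Vₙ^mₙ U₁^l₁ ⋯ Uₙ^lₙ` as an element of the unitary group. -/
def unitaryWord (D : TransData n) (k : Deck n) : unitaryGroup (Fin D.rk) ℂ :=
  zpowProd D.V k.1 * zpowProd D.U k.2

/-- The words of `k` and `w` commute up to `ζ ^ pairing k w`, where `ζ = exp (2πi/r)`. -/
def pairing (D : TransData n) (k w : Deck n) : ℤ :=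
  (D.A *ᵥ w.1) ⬝ᵥ k.2 - (D.A *ᵥ k.1) ⬝ᵥ w.2

theorem twist_unitaryWord (D : TransData n) (k w : Deck n) :
    Twist (2 * π / D.r * D.pairing k w) (D.unitaryWord k) (D.unitaryWord w) := by
  have twist_VV : Twist 0 (zpowProd D.V k.1) (zpowProd D.V w.1) :=
    .of_commute (commute_zpowProd_zpowProd D.comm_V _ _)
  have twist_UU : Twist 0 (zpowProd D.U k.2) (zpowProd D.U w.2) :=
    .of_commute (commute_zpowProd_zpowProd D.comm_U _ _)
  have twist := (twist_VV.mul_right (D.twist_prod w.2 k.1).swap).mul_left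
    ((D.twist_prod k.2 w.1).mul_right twist_UU)
  have phase_eq : 2 * π / D.r * (D.pairing k w : ℝ)
      = 0 + -(2 * π / D.r * ((D.A *ᵥ k.1) ⬝ᵥ w.2 : ℤ))
        + (2 * π / D.r * ((D.A *ᵥ w.1) ⬝ᵥ k.2 : ℤ) + 0) := by
    rw [pairing, Int.cast_sub]
    ring
  rw [phase_eq]
  exact twist

theorem word_mul_word (D : TransData n) (k w : Deck n) :
    D.word k * D.word w
      = Complex.exp (Complex.I * (2 * π / D.r * D.pairing k w : ℝ)) • (D.word w * D.word k) :=
  (D.twist_unitaryWord k w).coe_mul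

theorem conjTranspose_mul_word (D : TransData n) (k : Deck n) : (D.word k)ᴴ * D.word k = 1 :=
  conjTranspose_mul_unitary (D.unitaryWord k)

theorem word_mul_conjTranspose (D : TransData n) (k : Deck n) : D.word k * (D.word k)ᴴ = 1 :=
  mul_conjTranspose_unitary (D.unitaryWord k)

theorem word_ne_zero (D : TransData n) (k : Deck n) : D.word k ≠ 0 := by
  have : Nonempty (Fin D.rk) := ⟨⟨0, D.rk_pos⟩⟩
  exact right_ne_zero_of_mul (D.conjTranspose_mul_word k ▸ one_ne_zero)

theorem trace_conjTranspose_word_mul_word_eq_zero {k w w' : Deck n}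
    (h : (D.pairing k w : ZMod D.r) ≠ D.pairing k w') : ((D.word w)ᴴ * D.word w').trace = 0 := by
  have : NeZero D.r := ⟨D.r_pos.ne'⟩
  refine trace_conjTranspose_mul_eq_zero (norm_exp_I_mul _) (fun h_exp => h ?_)
    (D.word_mul_word k w) (D.word_mul_word k w')
  rw [exp_eq_stdAddChar, exp_eq_stdAddChar] at h_exp
  exact ZMod.injective_stdAddChar h_exp

theorem pairing_inr_single (D : TransData n) (i : Fin n) (w : Deck n) :
    D.pairing (0, Pi.single i 1) w = (D.A *ᵥ w.1) i := by
  simp [pairing]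

theorem pairing_inl_single (D : TransData n) (i : Fin n) (w : Deck n) :
    D.pairing (Pi.single i 1, 0) w = -(D.Aᵀ *ᵥ w.2) i := by
  simp only [pairing, dotProduct_zero, mulVec_single_one, zero_sub]
  rfl

/-- Lifts of the classes in `im A × im Aᵀ` modulo `r`: the corresponding words form a basis of the
matrix algebra. -/
def lift (D : TransData n) (x : imageMod D.r D.A × imageMod D.r D.Aᵀ) : Deck n :=
  ((exists_lift_imageMod D.A x.1).choose, (exists_lift_imageMod D.Aᵀ x.2).choose)

theorem linearIndependent_word_lift (D : TransData n) :
    LinearIndependent ℂ fun x => D.word (D.lift x) := by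
  refine linearIndependent_of_trace_conjTranspose_mul (fun x => D.word_ne_zero _)
    fun x y hxy => ?_
  have lift_fst : ∀ z i, (((D.A *ᵥ (D.lift z).1) i : ℤ) : ZMod D.r) = z.1.1 i := fun z =>
    (exists_lift_imageMod D.A z.1).choose_spec
  have lift_snd : ∀ z i, (((D.Aᵀ *ᵥ (D.lift z).2) i : ℤ) : ZMod D.r) = z.2.1 i := fun z =>
    (exists_lift_imageMod D.Aᵀ z.2).choose_spec
  by_cases h_fst : x.1 = y.1
  · have h_snd : x.2.1 ≠ y.2.1 := fun h => hxy (Prod.ext h_fst (Subtype.ext h))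
    obtain ⟨i, hi⟩ := Function.ne_iff.1 h_snd
    refine trace_conjTranspose_word_mul_word_eq_zero (k := (Pi.single i 1, 0)) ?_
    rwa [pairing_inl_single, pairing_inl_single, Int.cast_neg, Int.cast_neg, lift_snd, lift_snd,
      neg_injective.ne_iff]
  · obtain ⟨i, hi⟩ := Function.ne_iff.1 fun h => h_fst (Subtype.ext h)
    refine trace_conjTranspose_word_mul_word_eq_zero (k := (0, Pi.single i 1)) ?_
    rwa [pairing_inr_single, pairing_inr_single, lift_fst, lift_fst]

theorem span_word (D : TransData n) : Submodule.span ℂ (Set.range D.word) = ⊤ := by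
  have : NeZero D.r := ⟨D.r_pos.ne'⟩
  have : Fintype (imageMod D.r D.A × imageMod D.r D.Aᵀ) := Fintype.ofFinite _
  have card_eq : Fintype.card (imageMod D.r D.A × imageMod D.r D.Aᵀ)
      = Module.finrank ℂ (Matrix (Fin D.rk) (Fin D.rk) ℂ) := by
    rw [← Nat.card_eq_fintype_card, Nat.card_prod, ← D.rk_spec.eq_card D.r_pos,
      ← D.rk_spec.transpose.eq_card D.r_pos, Module.finrank_matrix]
    simp
  rw [eq_top_iff, ← D.linearIndependent_word_lift.span_eq_top_of_card_eq_finrank' card_eq]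
  exact Submodule.span_mono (Set.range_comp_subset_range D.lift D.word)

theorem exists_trace_word_ne_zero (D : TransData n) {M : Matrix (Fin D.rk) (Fin D.rk) ℂ}
    (hM : M ≠ 0) : ∃ w, ((D.word w)ᴴ * M).trace ≠ 0 := by
  by_contra! h
  have trace_mul_eq_zero : traceLinearMap (Fin D.rk) ℂ ℂ ∘ₗ LinearMap.mulLeft ℂ Mᴴ = 0 := by
    refine LinearMap.ext_on D.span_word ?_
    rintro _ ⟨w, rfl⟩
    change (Mᴴ * D.word w).trace = 0
    rw [← star_eq_zero, ← trace_conjTranspose, conjTranspose_mul, conjTranspose_conjTranspose, h]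
  exact trace_conjTranspose_mul_self_ne_zero hM (LinearMap.congr_fun trace_mul_eq_zero M)

theorem hasScalarCommutant_word (D : TransData n) : HasScalarCommutant D.word := by
  intro M hM
  have commute_all : ∀ X, Commute X M := by
    intro X
    have hX : X ∈ Submodule.span ℂ (Set.range D.word) := D.span_word ▸ Submodule.mem_top
    induction hX using Submodule.span_induction with
    | mem x hx => obtain ⟨k, rfl⟩ := hx; exact (hM k).symm
    | zero => exact Commute.zero_left _
    | add x y _ _ hx hy => exact hx.add_left hy
    | smul c x _ hx => exact hx.smul_left c
  obtain ⟨c, rfl⟩ := mem_range_scalar_iff_commute_single'.2 fun i j => commute_all (single i j 1)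
  exact ⟨c, (smul_one_eq_diagonal c).symm⟩

/-- The generators `V_j` and `U_k` as one family. -/
def gen (D : TransData n) : Fin n ⊕ Fin n → unitaryGroup (Fin D.rk) ℂ := Sum.elim D.V D.U

/-- The phase acquired by a word when the generators acquire the phases `t`. -/
def wordPhase (t : Fin n ⊕ Fin n → ℝ) (k : Deck n) : ℝ :=
  ∑ j, k.1 j * t (.inl j) + ∑ j, k.2 j * t (.inr j)

theorem intertwinesUpTo_unitaryWord {X : Matrix (Fin D'.rk) (Fin D.rk) ℂ}
    {t : Fin n ⊕ Fin n → ℝ} (h : ∀ i, IntertwinesUpTo X (t i) (D.gen i) (D'.gen i)) (k : Deck n) :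
    IntertwinesUpTo X (wordPhase t k) (D.unitaryWord k) (D'.unitaryWord k) :=
  (IntertwinesUpTo.zpowProd (fun j => h (.inl j)) k.1).mul (.zpowProd (fun j => h (.inr j)) k.2)

theorem hasScalarCommutant_gen (D : TransData n) : HasScalarCommutant fun i => (D.gen i).1 := by
  refine fun M hM => D.hasScalarCommutant_word M fun k => ?_
  have h := intertwinesUpTo_unitaryWord (X := M) (t := 0)
    (fun i => by simpa [IntertwinesUpTo] using (hM i).eq.symm) k
  simp only [IntertwinesUpTo, wordPhase, Pi.zero_apply, mul_zero, Finset.sum_const_zero, add_zero,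
    Complex.ofReal_zero, Complex.exp_zero, one_smul] at h
  exact h.symm

theorem phaseConj_word {t : Fin n ⊕ Fin n → ℝ}
    (h : PhaseConj t (fun i => (D.gen i).1) fun i => (D'.gen i).1) :
    PhaseConj (wordPhase t) D.word D'.word := by
  obtain ⟨g, g', h1, h2, h⟩ := h
  have intertwines : ∀ i, IntertwinesUpTo g (t i) (D.gen i) (D'.gen i) := fun i =>
    .of_eq_conj h2 (h i)
  refine ⟨g, g', h1, h2, fun k => ?_⟩
  calc D'.word k = D'.word k * g * g' := by rw [Matrix.mul_assoc, h1, Matrix.mul_one]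
    _ = Complex.exp (Complex.I * wordPhase t k) • (g * D.word k * g') := by
      rw [← Matrix.smul_mul]
      exact congrArg (· * g') (intertwinesUpTo_unitaryWord intertwines k)

/-- Triples of the same slope `A / r`. -/
def SameSlope (D D' : TransData n) : Prop := (D.r : ℤ) • D'.A = (D'.r : ℤ) • D.A

theorem sameSlope_iff :
    SameSlope D D' ↔ ∀ i j, (D'.A i j : ℝ) / D'.r = (D.A i j : ℝ) / D.r := by
  rw [SameSlope, ← Matrix.ext_iff]
  refine forall_congr' fun i => forall_congr' fun j => ?_
  rw [div_eq_div_iff D'.r_ne_zero D.r_ne_zero, Matrix.smul_apply, Matrix.smul_apply, smul_eq_mul,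
    smul_eq_mul, mul_comm (D.r : ℤ), mul_comm (D'.r : ℤ)]
  norm_cast

theorem sameSlope_equivalence : Equivalence (SameSlope (n := n)) where
  refl _ := rfl
  symm h := sameSlope_iff.2 fun i j => (sameSlope_iff.1 h i j).symm
  trans h h' := sameSlope_iff.2 fun i j => (sameSlope_iff.1 h' i j).trans (sameSlope_iff.1 h i j)

/-- The commutation phases of the generators. -/
def genPhase (D : TransData n) : Fin n ⊕ Fin n → Fin n ⊕ Fin n → ℝ
  | .inl _, .inl _ => 0
  | .inr _, .inr _ => 0
  | .inr k, .inl j => 2 * π * D.A k j / D.r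
  | .inl j, .inr k => -(2 * π * D.A k j / D.r)

theorem twist_gen (D : TransData n) (i j : Fin n ⊕ Fin n) :
    Twist (D.genPhase i j) (D.gen i) (D.gen j) := by
  rcases i with i | i <;> rcases j with j | j
  · exact .of_commute (D.comm_V i j)
  · exact (D.twist_UV j i).swap
  · exact D.twist_UV i j
  · exact .of_commute (D.comm_U i j)

/-- A finite-dimensional analogue of the Stone–von Neumann theorem. -/
theorem SameSlope.exists_phaseConj (h : SameSlope D D') :
    ∃ τ, PhaseConj τ (fun i => (D.gen i).1) fun i => (D'.gen i).1 := by
  have genPhase_eq : D'.genPhase = D.genPhase := by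
    funext i j
    rcases i with i | i <;> rcases j with j | j <;>
      simp [genPhase, mul_div_assoc, sameSlope_iff.1 h]
  exact exists_phaseConj_of_twist D.rk_pos D'.rk_pos D.gen D'.gen D.genPhase D.twist_gen
    (genPhase_eq ▸ D'.twist_gen) D.hasScalarCommutant_gen D'.hasScalarCommutant_gen

end TransData

section MonomialUnitaries

variable {m : Type*} [Fintype m] [DecidableEq m]

/-- The permutation matrix of `σ`, with entries `1` at `(a, σ a)`, as a unitary matrix. -/
def permUnitary (σ : Equiv.Perm m) : unitaryGroup m ℂ :=
  ⟨σ.permMatrix ℂ, by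
    rw [mem_unitaryGroup_iff, star_eq_conjTranspose, conjTranspose_permMatrix, ← permMatrix_mul,
      inv_mul_cancel, permMatrix_one]⟩

/-- The diagonal matrix with unimodular entries `d` as a unitary matrix. -/
def diagUnitary (d : m → Circle) : unitaryGroup m ℂ :=
  ⟨diagonal fun a => (d a : ℂ), by
    rw [mem_unitaryGroup_iff, star_eq_conjTranspose, diagonal_conjTranspose,
      diagonal_mul_diagonal, ← diagonal_one]
    congr 1
    funext a
    simp [Complex.mul_conj]⟩

theorem permUnitary_mul (σ τ : Equiv.Perm m) :
    permUnitary (σ * τ) = permUnitary τ * permUnitary σ :=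
  Subtype.ext (permMatrix_mul _ _)

theorem commute_diagUnitary (d d' : m → Circle) : Commute (diagUnitary d) (diagUnitary d') := by
  refine Subtype.ext ?_
  change diagonal _ * diagonal _ = diagonal _ * diagonal _
  simp only [diagonal_mul_diagonal, mul_comm]

theorem permUnitary_mul_diagUnitary {σ : Equiv.Perm m} {d : m → Circle} {c : Circle}
    (h : ∀ a, d (σ a) = c * d a) :
    (permUnitary σ).1 * (diagUnitary d).1
      = (c : ℂ) • ((diagUnitary d).1 * (permUnitary σ).1) := by
  ext a b
  simp only [permUnitary, diagUnitary, mul_diagonal, Matrix.smul_apply, diagonal_mul, smul_eq_mul,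
    PEquiv.toMatrix_apply, Equiv.toPEquiv_apply, Option.mem_def, Option.some.injEq]
  split_ifs with hab
  · rw [one_mul, mul_one, ← hab, h, Circle.coe_mul]
  · rw [zero_mul, mul_zero, mul_zero]

end MonomialUnitaries

namespace TransData

variable {n : ℕ}

/-- The finite Heisenberg representation on functions on `im (A mod r)`: the `V_j` translate by
the columns of `-A` and the `U_k` multiply by the coordinate characters. -/
theorem exists_transData (r : ℕ) (hr : 0 < r) (A : Matrix (Fin n) (Fin n) ℤ) :
    ∃ D : TransData n, D.r = r ∧ D.A = A := by
  have : NeZero r := ⟨hr.ne'⟩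
  obtain ⟨k, hk⟩ := exists_isRankOf r A
  let e : Fin k ≃ imageMod r A := (Finite.equivFinOfCardEq (hk.eq_card hr).symm).symm
  let shift (j : Fin n) : imageMod r A := -⟨_, LinearMap.mem_range_self _ (Pi.single j 1)⟩
  let σ (j : Fin n) : Equiv.Perm (Fin k) := e.symm.permCongr (Equiv.addRight (shift j))
  let d (l : Fin n) (a : Fin k) : Circle := ZMod.toCircle ((e a).1 l)
  have e_σ : ∀ j a, e (σ j a) = e a + shift j := fun j a => by simp [σ]
  have σ_comm : ∀ i j, σ i * σ j = σ j * σ i := fun i j => by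
    refine Equiv.ext fun a => e.injective ?_
    rw [Equiv.Perm.mul_apply, Equiv.Perm.mul_apply, e_σ, e_σ, e_σ, e_σ]
    exact add_right_comm _ _ _
  have d_σ : ∀ j l a, d l (σ j a) = ZMod.toCircle (N := r) (-(A l j) : ℤ) * d l a :=
    fun j l a => by
      rw [mul_comm, ← AddChar.map_add_eq_mul]
      simp [d, e_σ, shift]
  refine ⟨⟨r, hr, A, k, hk, fun j => permUnitary (σ j), fun l => diagUnitary (d l),
    fun i j => ?_, fun i j => (commute_diagUnitary _ _).eq, fun j l => ?_⟩, rfl, rfl⟩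
  · rw [← permUnitary_mul, σ_comm, permUnitary_mul]
  · rw [permUnitary_mul_diagUnitary (d_σ j l), ZMod.toCircle_intCast, ← Complex.exp_int_mul]
    congr 2
    ring

end TransData

/-! ### Angles -/

theorem exists_real_angle {k : ℕ} (g : unitaryGroup (Fin k) ℂ) :
    ∃ t : ℝ, Complex.exp (Complex.I * t) = g.1.det := by
  obtain ⟨t, ht⟩ := (Complex.norm_eq_one_iff _).1 (CStarRing.norm_of_mem_unitary
    (det_of_mem_unitary g.2))
  exact ⟨t, by rw [← ht, mul_comm]⟩

namespace Angles

variable {n : ℕ}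

/-- The angles `ξ_j` and `θ_k` as one family. -/
def gen (a : Angles n) (D : TransData n) : Fin n ⊕ Fin n → ℝ := Sum.elim (a.ξ D) (a.θ D)

theorem isConsistent_iff {a : Angles n} : a.IsConsistent ↔ ∀ D D' : TransData n, D.SameSlope D' →
    PhaseConj (fun i => (a.gen D' i - a.gen D i) / D.rk) (fun i => (D.gen i).1)
      fun i => (D'.gen i).1 := by
  refine forall₃_congr fun D D' _ => ?_
  simp only [PhaseConj, Sum.forall]
  rfl

theorem exists_isConsistent (n : ℕ) : ∃ a : Angles n, a.IsConsistent := by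
  let S : Setoid (TransData n) := ⟨TransData.SameSlope, TransData.sameSlope_equivalence⟩
  let rep (D : TransData n) : TransData n := (Quotient.mk S D).out
  choose τ hτ using fun D => TransData.SameSlope.exists_phaseConj (Quotient.mk_out (s := S) D)
  choose t ht using fun (D : TransData n) i => exists_real_angle (D.gen i)
  let angle (D : TransData n) (i : Fin n ⊕ Fin n) : ℝ := (rep D).rk * τ D i + t (rep D) i
  have exp_angle : ∀ D i, Complex.exp (Complex.I * angle D i) = (D.gen i).1.det := fun D i => by
    rw [(hτ D).det_eq i, ← ht, ← Complex.exp_add, ← mul_add, ← Complex.ofReal_add]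
  refine ⟨⟨fun D j => angle D (.inl j), fun D k => angle D (.inr k), fun D j => exp_angle D _,
    fun D k => exp_angle D _⟩, isConsistent_iff.2 fun D D' h => ?_⟩
  have rep_eq : rep D' = rep D := congrArg Quotient.out (Quotient.sound (s := S) h).symm
  have hτ' : PhaseConj (τ D') (fun i => ((rep D').gen i).1) fun i => (D'.gen i).1 := hτ D'
  rw [rep_eq] at hτ'
  convert (hτ D).symm.trans hτ' using 1
  have rk_ne_zero : (D.rk : ℝ) ≠ 0 := by exact_mod_cast D.rk_pos.ne'
  have rk_rep : (rep D).rk = D.rk := (hτ D).size_eq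
  funext i
  rcases i with i | i <;>
  · simp only [gen, Sum.elim_inl, Sum.elim_inr, angle, rep_eq, rk_rep, Pi.add_apply, Pi.neg_apply]
    field_simp
    ring

end Angles

/-! ### Holomorphic functions on complex tori -/

theorem re_mulVec_ofReal {n : ℕ} (T : Matrix (Fin n) (Fin n) ℂ) (y : Fin n → ℝ) (i : Fin n) :
    ((T *ᵥ fun j => (y j : ℂ)) i).re = (T.map Complex.re *ᵥ y) i := by
  simp [Matrix.mulVec, dotProduct]

theorem im_mulVec_ofReal {n : ℕ} (T : Matrix (Fin n) (Fin n) ℂ) (y : Fin n → ℝ) (i : Fin n) :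
    ((T *ᵥ fun j => (y j : ℂ)) i).im = (T.map Complex.im *ᵥ y) i := by
  simp [Matrix.mulVec, dotProduct]

theorem zcoord_surjective {n : ℕ} {T : Matrix (Fin n) (Fin n) ℂ}
    (hIm : (T.map Complex.im).det ≠ 0) : Function.Surjective (zcoord T) := by
  intro z
  obtain ⟨y, hy⟩ := Matrix.mulVec_surjective_iff_isUnit.2
    ((Matrix.isUnit_iff_isUnit_det _).2 hIm.isUnit) fun i => (z i).im
  refine ⟨(fun i => (z i).re - (T.map Complex.re *ᵥ y) i, y), ?_⟩
  funext i
  apply Complex.ext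
  · simp [zcoord, re_mulVec_ofReal]
  · simp [zcoord, im_mulVec_ofReal, congrFun hy i]

/-- The type `(0,1)` vectors of the coordinate `z = x + T y` come from an almost complex structure
on `Cover n`: every real tangent vector `v` completes to some `v + 𝐢 w` of type `(0,1)`. -/
def HasComplexStructure {n : ℕ} (T : Matrix (Fin n) (Fin n) ℂ) : Prop :=
  ∀ v, ∃ w, IsType01 T v w

theorem hasComplexStructure_of_det_im_ne_zero {n : ℕ} {T : Matrix (Fin n) (Fin n) ℂ}
    (hIm : (T.map Complex.im).det ≠ 0) : HasComplexStructure T := by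
  intro v
  obtain ⟨w, hw⟩ := zcoord_surjective hIm (Complex.I • zcoord T v)
  refine ⟨w, ?_⟩
  rw [IsType01, hw, smul_smul, Complex.I_mul_I, neg_one_smul, add_neg_cancel]

theorem exists_eq_add_two_pi_mul_int {n : ℕ} (x : Fin n → ℝ) :
    ∃ m : Fin n → ℤ, ∃ y ∈ Set.Icc (0 : Fin n → ℝ) fun _ => 2 * π,
      x = y + fun i => 2 * π * m i := by
  refine ⟨fun i => toIcoDiv Real.two_pi_pos 0 (x i), fun i => toIcoMod Real.two_pi_pos 0 (x i),
    ⟨fun i => left_le_toIcoMod _ _ _, fun i => ?_⟩, funext fun i => ?_⟩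
  · simpa using (toIcoMod_lt_right Real.two_pi_pos 0 (x i)).le
  · simpa [mul_comm] using (toIcoMod_add_toIcoDiv_zsmul Real.two_pi_pos 0 (x i)).symm

theorem isBounded_range_of_norm_periodic {n : ℕ} {H : Cover n → ℂ} (hH : Continuous H)
    (hper : ∀ k u, ‖H (u + period k)‖ = ‖H u‖) : Bornology.IsBounded (Set.range H) := by
  obtain ⟨C, hC⟩ := isCompact_Icc.exists_bound_of_continuousOn
    (s := Set.Icc (0 : Cover n) (fun _ => 2 * π, fun _ => 2 * π)) hH.continuousOn
  refine isBounded_iff_forall_norm_le.2 ⟨C, ?_⟩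
  rintro _ ⟨⟨x, y⟩, rfl⟩
  obtain ⟨m, x', hx', rfl⟩ := exists_eq_add_two_pi_mul_int x
  obtain ⟨l, y', hy', rfl⟩ := exists_eq_add_two_pi_mul_int y
  exact (hper (m, l) (x', y')).trans_le (hC _ ⟨⟨hx'.1, hy'.1⟩, ⟨hx'.2, hy'.2⟩⟩)

theorem differentiable_complex_line {E : Type*} [NormedAddCommGroup E] [NormedSpace ℝ E] {H : E → ℂ}
    (hH : Differentiable ℝ H) {v w : E}
    (hd : ∀ u, fderiv ℝ H u v + Complex.I * fderiv ℝ H u w = 0) (u : E) :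
    Differentiable ℂ fun t : ℂ => H (u + (t.re • v + t.im • w)) := by
  intro t
  let ℓ : ℂ →L[ℝ] E := Complex.reCLM.smulRight v + Complex.imCLM.smulRight w
  have hF : HasFDerivAt (fun t : ℂ => H (u + ℓ t)) ((fderiv ℝ H (u + ℓ t)).comp ℓ) t :=
    (hH (u + ℓ t)).hasFDerivAt.comp t (ℓ.hasFDerivAt.const_add u)
  have hℓ1 : ℓ 1 = v := by simp [ℓ]
  have hℓI : ℓ Complex.I = w := by simp [ℓ]
  refine differentiableAt_complex_iff_differentiableAt_real.2 ⟨hF.differentiableAt, ?_⟩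
  change fderiv ℝ (fun t : ℂ => H (u + ℓ t)) t Complex.I
    = Complex.I • fderiv ℝ (fun t : ℂ => H (u + ℓ t)) t 1
  rw [hF.fderiv, ContinuousLinearMap.comp_apply, ContinuousLinearMap.comp_apply, hℓ1, hℓI,
    smul_eq_mul]
  linear_combination (-Complex.I) * hd (u + ℓ t) + fderiv ℝ H (u + ℓ t) w * Complex.I_mul_I

theorem apply_eq_apply_of_holomorphic_of_norm_periodic {n : ℕ} {T : Matrix (Fin n) (Fin n) ℂ}
    (hT : HasComplexStructure T) {H : Cover n → ℂ} (hH : Differentiable ℝ H)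
    (hper : ∀ k u, ‖H (u + period k)‖ = ‖H u‖)
    (hd : ∀ u v w, IsType01 T v w → fderiv ℝ H u v + Complex.I * fderiv ℝ H u w = 0)
    (u u' : Cover n) : H u = H u' := by
  obtain ⟨w, hw⟩ := hT (u' - u)
  have hline := differentiable_complex_line hH (fun x => hd x _ _ hw) u
  have hb := (isBounded_range_of_norm_periodic hH.continuous hper).subset
    (Set.range_comp_subset_range (fun t : ℂ => u + (t.re • (u' - u) + t.im • w)) H)
  simpa using hline.apply_eq_apply_of_bounded hb 0 1

/-! ### Winding numbers -/

section Winding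

variable {E : Type*} [NormedAddCommGroup E] [NormedSpace ℝ E]

theorem exists_continuous_log {f : E → ℂ} (hf : Continuous f) (h0 : ∀ u, f u ≠ 0) :
    ∃ g : E → ℂ, Continuous g ∧ ∀ u, Complex.exp (g u) = f u := by
  obtain ⟨F, ⟨-, hF⟩, -⟩ := Complex.isCoveringMapOn_exp.existsUnique_continuousMap_lifts
    (⟨f, hf⟩ : C(E, ℂ)) (a₀ := 0) (e₀ := Complex.log (f 0)) (Complex.exp_log (h0 0))
    (fun u => h0 u)
  exact ⟨F, F.continuous, fun u => congrFun hF u⟩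

theorem apply_eq_apply_of_exp_eq {g : E → ℂ} (hg : Continuous g) {c : ℂ}
    (h : ∀ u, Complex.exp (g u) = c) (u u' : E) : g u = g u' :=
  Complex.isCoveringMap_exp.const_of_comp hg
    (fun a a' => Subtype.ext ((h a).trans (h a').symm)) u u'

/-- A continuous logarithm of `f` changes by a constant along `b` and by `𝐢 lam` plus a constant
along `a`; comparing the two ways around the square spanned by `a` and `b` gives the claim. -/
theorem multiplier_invariant {f : E → ℂ} (hf : Continuous f) (h0 : ∀ u, f u ≠ 0)
    {a b : E} {c₁ c₂ : ℂ} {lam : E → ℝ} (hl : Continuous lam)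
    (ha : ∀ u, f (u + a) = c₁ * Complex.exp (Complex.I * lam u) * f u)
    (hb : ∀ u, f (u + b) = c₂ * f u) (u : E) : lam (u + b) = lam u := by
  obtain ⟨g, hg, hgf⟩ := exists_continuous_log hf h0
  have along_a : ∀ u, Complex.exp (g (u + a) - g u - Complex.I * lam u) = c₁ := fun u => by
    rw [Complex.exp_sub, Complex.exp_sub, hgf, hgf, ha, mul_div_cancel_right₀ _ (h0 u),
      mul_div_cancel_right₀ _ (Complex.exp_ne_zero _)]
  have along_b : ∀ u, Complex.exp (g (u + b) - g u) = c₂ := fun u => by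
    rw [Complex.exp_sub, hgf, hgf, hb, mul_div_cancel_right₀ _ (h0 u)]
  have const_a := apply_eq_apply_of_exp_eq (by fun_prop) along_a (u + b) u
  have const_b := apply_eq_apply_of_exp_eq (by fun_prop) along_b (u + a) u
  rw [add_right_comm] at const_b
  have hzero : Complex.I * ((lam (u + b) : ℂ) - lam u) = 0 := by
    linear_combination const_b - const_a
  exact_mod_cast sub_eq_zero.1 ((mul_eq_zero.1 hzero).resolve_left Complex.I_ne_zero)

end Winding

/-! ### Pullback along the biholomorphic map -/

section LinearSubstitution

variable {E F G : Type*} [NormedAddCommGroup E] [NormedSpace ℝ E] [FiniteDimensional ℝ E]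
  [NormedAddCommGroup F] [NormedSpace ℝ F] [NormedAddCommGroup G] [NormedSpace ℝ G]

theorem fderiv_comp_linearMap {f : F → G} (ℓ : E →ₗ[ℝ] F) {u : E}
    (hf : DifferentiableAt ℝ f (ℓ u)) (v : E) :
    fderiv ℝ (fun x => f (ℓ x)) u v = fderiv ℝ f (ℓ u) (ℓ v) := by
  have h : HasFDerivAt (fun x => f (ℓ x))
      ((fderiv ℝ f (ℓ u)).comp (LinearMap.toContinuousLinearMap ℓ)) u :=
    hf.hasFDerivAt.comp u (LinearMap.toContinuousLinearMap ℓ).hasFDerivAt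
  rw [h.fderiv]
  rfl

theorem contDiff_comp_linearMap {f : F → G} (hf : ContDiff ℝ ∞ f) (ℓ : E →ₗ[ℝ] F) :
    ContDiff ℝ ∞ fun x => f (ℓ x) :=
  hf.comp (LinearMap.toContinuousLinearMap ℓ).contDiff

end LinearSubstitution

/-- The inverse of `phi`, that is `z ↦ (-T + δ) z` in the real coordinates. -/
def phiInv {n : ℕ} (δ : Matrix (Fin n) (Fin n) ℤ) : Cover n →ₗ[ℝ] Cover n :=
  LinearMap.prod (LinearMap.snd ℝ _ _ + (toR δ).mulVecLin ∘ₗ LinearMap.fst ℝ _ _)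
    (-LinearMap.fst ℝ _ _)

theorem phi_phiInv {n : ℕ} (δ : Matrix (Fin n) (Fin n) ℤ) (u : Cover n) :
    phi δ (phiInv δ u) = u := by
  rw [phi_apply]
  exact Prod.ext (by simp [phiInv]) (by simp [phiInv, Matrix.mulVec_neg])

theorem phiInv_phi {n : ℕ} (δ : Matrix (Fin n) (Fin n) ℤ) (u : Cover n) :
    phiInv δ (phi δ u) = u := by
  rw [phi_apply]
  exact Prod.ext (by simp [phiInv, Matrix.mulVec_neg]) (by simp [phiInv])

theorem phiDeck_surjective {n : ℕ} (δ : Matrix (Fin n) (Fin n) ℤ) :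
    Function.Surjective (phiDeck δ) := fun k =>
  ⟨(k.2 + δ *ᵥ k.1, -k.1), by simp [phiDeck_apply, Matrix.mulVec_neg]⟩

section Pullback

variable {n : ℕ} {T : Matrix (Fin n) (Fin n) ℂ} {δ : Matrix (Fin n) (Fin n) ℤ}

theorem det_neg_add_ne_zero (hδ : (T - toC δ).det ≠ 0) : (-T + toC δ).det ≠ 0 := by
  rw [neg_add_eq_sub, ← neg_sub, Matrix.det_neg]
  exact mul_ne_zero (pow_ne_zero _ (neg_ne_zero.2 one_ne_zero)) hδ

theorem isType01_phi (hδ : (T - toC δ).det ≠ 0) (v w : Cover n) :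
    IsType01 (Tprime T δ) (phi δ v) (phi δ w) ↔ IsType01 T v w := by
  have hd := det_neg_add_ne_zero hδ
  have hinj : Function.Injective (-T + toC δ)⁻¹.mulVec :=
    Matrix.mulVec_injective_iff_isUnit.2
      (Matrix.isUnit_nonsing_inv_iff.2 ((Matrix.isUnit_iff_isUnit_det _).2 hd.isUnit))
  rw [IsType01, IsType01, zcoord_phi T δ hd, zcoord_phi T δ hd, ← Matrix.mulVec_smul,
    ← Matrix.mulVec_add]
  exact hinj.eq_iff' (Matrix.mulVec_zero _)

theorem hasComplexStructure_Tprime (hδ : (T - toC δ).det ≠ 0) (hT : HasComplexStructure T) :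
    HasComplexStructure (Tprime T δ) := by
  intro v
  obtain ⟨w, hw⟩ := hT (phiInv δ v)
  refine ⟨phi δ w, ?_⟩
  rwa [← phi_phiInv δ v, isType01_phi hδ]

namespace TorusBundle

variable {B B' : TorusBundle n}

theorem covDeriv_pullback {ψ : Cover n → Matrix (Fin B'.rank) (Fin B.rank) ℂ}
    (hψ : ∀ a b, ContDiff ℝ ∞ fun u => ψ u a b) (u v : Cover n) :
    covDeriv (B.pullback δ) (B'.pullback δ) (fun u => ψ (phi δ u)) u v
      = covDeriv B B' ψ (phi δ u) (phi δ v) := by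
  ext a b
  exact congrArg (· + (B'.form (phi δ u) (phi δ v) - B.form (phi δ u) (phi δ v))
    * ψ (phi δ u) a b)
    (fderiv_comp_linearMap (phi δ) ((hψ a b).differentiable (by simp) _) v)

theorem IsHolHom.pullback (hδ : (T - toC δ).det ≠ 0)
    {ψ : Cover n → Matrix (Fin B'.rank) (Fin B.rank) ℂ} (h : IsHolHom (Tprime T δ) B B' ψ) :
    IsHolHom T (B.pullback δ) (B'.pullback δ) fun u => ψ (phi δ u) where
  smooth a b := contDiff_comp_linearMap (h.smooth a b) (phi δ)
  equivariant k u := by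
    rw [map_add, phi_period]
    exact h.equivariant _ _
  dbar_closed u v w hvw := by
    rw [covDeriv_pullback h.smooth, covDeriv_pullback h.smooth]
    exact h.dbar_closed _ _ _ ((isType01_phi hδ v w).2 hvw)

theorem IsHolHom.of_pullback (hδ : (T - toC δ).det ≠ 0)
    {ψ : Cover n → Matrix (Fin B'.rank) (Fin B.rank) ℂ}
    (h : IsHolHom T (B.pullback δ) (B'.pullback δ) ψ) :
    IsHolHom (Tprime T δ) B B' fun u => ψ (phiInv δ u) := by
  have hsmooth : ∀ a b, ContDiff ℝ ∞ fun x => ψ (phiInv δ x) a b := fun a b =>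
    contDiff_comp_linearMap (h.smooth a b) (phiInv δ)
  refine ⟨hsmooth, fun k u => ?_, fun u v w hvw => ?_⟩
  · obtain ⟨k, rfl⟩ := phiDeck_surjective δ k
    have hperiod : phiInv δ (u + period (phiDeck δ k)) = phiInv δ u + period k := by
      rw [map_add, ← phi_period, phiInv_phi]
    have heq : ψ (phiInv δ u + period k) * B.mult (phiDeck δ k) (phi δ (phiInv δ u))
        = B'.mult (phiDeck δ k) (phi δ (phiInv δ u)) * ψ (phiInv δ u) :=
      h.equivariant k (phiInv δ u)
    rw [hperiod]
    rwa [phi_phiInv] at heq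
  · have hcov : ∀ x, covDeriv B B' (fun u => ψ (phiInv δ u)) u x
        = covDeriv (B.pullback δ) (B'.pullback δ) ψ (phiInv δ u) (phiInv δ x) := fun x => by
      have hcov := covDeriv_pullback (δ := δ) hsmooth (phiInv δ u) (phiInv δ x)
      simp only [phiInv_phi] at hcov
      rw [phi_phiInv, phi_phiInv] at hcov
      exact hcov.symm
    rw [hcov, hcov]
    exact h.dbar_closed _ _ _ ((isType01_phi hδ _ _).1 (by rwa [phi_phiInv, phi_phiInv]))

theorem isomorphic_pullback_iff (hδ : (T - toC δ).det ≠ 0) :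
    Isomorphic T (B.pullback δ) (B'.pullback δ) ↔ Isomorphic (Tprime T δ) B B' :=
  ⟨fun ⟨_, _, hψ, hχ, hinv⟩ => ⟨_, _, hψ.of_pullback hδ, hχ.of_pullback hδ, fun _ => hinv _⟩,
    fun ⟨_, _, hψ, hχ, hinv⟩ => ⟨_, _, hψ.pullback hδ, hχ.pullback hδ, fun _ => hinv _⟩⟩

theorem IsSimple.pullback (hδ : (T - toC δ).det ≠ 0) (h : IsSimple (Tprime T δ) B) :
    IsSimple T (B.pullback δ) := by
  intro ψ hψ
  obtain ⟨c, hc⟩ := h _ (hψ.of_pullback hδ)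
  refine ⟨c, fun u => ?_⟩
  have hu := hc (phi δ u)
  rwa [phiInv_phi] at hu

theorem curvature_pullback (B : TorusBundle n) (u v w : Cover n) :
    (B.pullback δ).curvature u v w = B.curvature (phi δ u) (phi δ v) (phi δ w) := by
  have hform : ∀ x, DifferentiableAt ℝ (fun y => B.form y x) (phi δ u) := fun x =>
    (B.form_smooth x).differentiable (by simp) _
  rw [curvature, curvature, ← fderiv_comp_linearMap (phi δ) (hform _),
    ← fderiv_comp_linearMap (phi δ) (hform _)]
  rfl

end TorusBundle

end Pullback

/-! ### Holomorphic maps between bundles of equal slope -/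

section PlaneWave

variable {E : Type*} [NormedAddCommGroup E] [NormedSpace ℝ E]

/-- The unitary character `exp (𝐢 ℓ / 2π)` of a real vector space; its logarithmic derivative has
the shape of the connection forms below. -/
def planeWave (ℓ : E →L[ℝ] ℝ) (u : E) : ℂ := Complex.exp (Complex.I * (ℓ u / (2 * π) : ℝ))

theorem planeWave_zero_right (ℓ : E →L[ℝ] ℝ) : planeWave ℓ 0 = 1 := by simp [planeWave]

theorem planeWave_add_right (ℓ : E →L[ℝ] ℝ) (u v : E) :
    planeWave ℓ (u + v) = planeWave ℓ u * planeWave ℓ v := by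
  rw [planeWave, planeWave, planeWave, ← Complex.exp_add, ← mul_add, ← Complex.ofReal_add, map_add,
    add_div]

theorem planeWave_neg_mul_planeWave (ℓ : E →L[ℝ] ℝ) (u : E) :
    planeWave (-ℓ) u * planeWave ℓ u = 1 := by
  rw [planeWave, planeWave, ← Complex.exp_add, ← mul_add, ← Complex.ofReal_add,
    _root_.neg_apply, neg_div, neg_add_cancel, Complex.ofReal_zero, mul_zero, Complex.exp_zero]

theorem norm_planeWave (ℓ : E →L[ℝ] ℝ) (u : E) : ‖planeWave ℓ u‖ = 1 := norm_exp_I_mul _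

theorem planeWave_ne_zero (ℓ : E →L[ℝ] ℝ) (u : E) : planeWave ℓ u ≠ 0 := Complex.exp_ne_zero _

theorem hasFDerivAt_planeWave (ℓ : E →L[ℝ] ℝ) (u : E) : HasFDerivAt (planeWave ℓ)
    ((planeWave ℓ u * (Complex.I / (2 * π))) • Complex.ofRealCLM.comp ℓ) u := by
  have h : HasFDerivAt (fun u => Complex.I / (2 * π) * ((ℓ u : ℝ) : ℂ))
      ((Complex.I / (2 * π)) • Complex.ofRealCLM.comp ℓ) u :=
    (Complex.ofRealCLM.comp ℓ).hasFDerivAt.const_mul _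
  have planeWave_eq : planeWave ℓ
      = fun u => Complex.exp (Complex.I / (2 * π) * ((ℓ u : ℝ) : ℂ)) := by
    funext u
    rw [planeWave]
    push_cast
    ring_nf
  rw [mul_smul, planeWave_eq]
  exact h.cexp

theorem eq_planeWave_mul_of_fderiv {ℓ : E →L[ℝ] ℝ} {f : E → ℂ} (hf : Differentiable ℝ f)
    (hd : ∀ u v, fderiv ℝ f u v = Complex.I / (2 * π) * ℓ v * f u) (u : E) :
    f u = planeWave ℓ u * f 0 := by
  have hderiv : ∀ u, HasFDerivAt (fun u => planeWave (-ℓ) u * f u) _ u := fun u =>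
    (hasFDerivAt_planeWave (-ℓ) u).mul (hf u).hasFDerivAt
  have hconst := is_const_of_fderiv_eq_zero (𝕜 := ℝ) (fun u => (hderiv u).differentiableAt)
    (fun u => by
      rw [(hderiv u).fderiv]
      ext v
      simp only [_root_.add_apply, _root_.smul_apply, smul_eq_mul, ContinuousLinearMap.comp_apply,
        Complex.ofRealCLM_apply, _root_.neg_apply, Complex.ofReal_neg, hd, _root_.zero_apply]
      ring) u 0
  rw [planeWave_zero_right, one_mul] at hconst
  rw [← hconst, ← mul_assoc, mul_comm (planeWave ℓ u), planeWave_neg_mul_planeWave, one_mul]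

theorem contDiff_planeWave (ℓ : E →L[ℝ] ℝ) : ContDiff ℝ ∞ (planeWave ℓ) :=
  (contDiff_const.mul (Complex.ofRealCLM.contDiff.comp (ℓ.contDiff.div_const _))).cexp

end PlaneWave

/-- A twisted form of Liouville's theorem: the factor `planeWave (-ℓ)` turns `f` into a holomorphic
function of periodic absolute value. -/
theorem eq_planeWave_mul_of_dbar {n : ℕ} {T : Matrix (Fin n) (Fin n) ℂ} (hT : HasComplexStructure T)
    {f : Cover n → ℂ} (hf : Differentiable ℝ f) (hper : ∀ k u, ‖f (u + period k)‖ = ‖f u‖)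
    {ℓ : Cover n →L[ℝ] ℝ} (hd : ∀ u v w, IsType01 T v w → fderiv ℝ f u v
      + Complex.I * fderiv ℝ f u w = Complex.I / (2 * π) * (ℓ v + Complex.I * ℓ w) * f u)
    (u : Cover n) : f u = planeWave ℓ u * f 0 := by
  have hderiv : ∀ u, HasFDerivAt (fun u => planeWave (-ℓ) u * f u) _ u := fun u =>
    (hasFDerivAt_planeWave (-ℓ) u).mul (hf u).hasFDerivAt
  have hconst := apply_eq_apply_of_holomorphic_of_norm_periodic hT
    (fun u => (hderiv u).differentiableAt)
    (fun k u => by rw [norm_mul, norm_mul, norm_planeWave, norm_planeWave, hper])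
    (fun u v w hvw => by
      rw [(hderiv u).fderiv]
      simp only [_root_.add_apply, _root_.smul_apply, smul_eq_mul, ContinuousLinearMap.comp_apply,
        Complex.ofRealCLM_apply, _root_.neg_apply, Complex.ofReal_neg]
      linear_combination planeWave (-ℓ) u * hd u v w hvw) u 0
  rw [planeWave_zero_right, one_mul] at hconst
  rw [← hconst, ← mul_assoc, mul_comm (planeWave ℓ u), planeWave_neg_mul_planeWave, one_mul]

/-- The linear form `αᵗ y` on `ℝⁿ`. -/
def dotForm {n : ℕ} (α : Fin n → ℝ) : (Fin n → ℝ) →L[ℝ] ℝ :=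
  LinearMap.toContinuousLinearMap (dotProductBilin ℝ ℝ α)

theorem dotForm_apply {n : ℕ} (α y : Fin n → ℝ) : dotForm α y = α ⬝ᵥ y := rfl

/-- The parameter `μ = p + Tᵗ q` of the paper, for the period matrix `T`. -/
def muOf {n : ℕ} (T : Matrix (Fin n) (Fin n) ℂ) (p q : Fin n → ℝ) : Fin n → ℂ :=
  (fun i => (p i : ℂ)) + Tᵀ *ᵥ fun i => (q i : ℂ)

namespace TransData

variable {n : ℕ} {D D' : TransData n}

/-- The bilinear form `(1/r) (A x)ᵗ y`, through which the slope enters transition functions,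
connection and curvature. -/
def slopeForm (D : TransData n) (x y : Fin n → ℝ) : ℝ := (1 / (D.r : ℝ)) * ((toR D.A *ᵥ x) ⬝ᵥ y)

/-- The linear form `(1/r) (pᵗ dY - qᵗ dX)`; modulo forms of type `(1,0)` it is the part
`(1/r) μᵗ dY` of the connection. -/
def paramForm (D : TransData n) (p q : Fin n → ℝ) : Cover n →L[ℝ] ℝ :=
  (1 / (D.r : ℝ)) • ((dotForm p).comp (ContinuousLinearMap.snd ℝ _ _)
    - (dotForm q).comp (ContinuousLinearMap.fst ℝ _ _))

theorem paramForm_apply (D : TransData n) (p q : Fin n → ℝ) (u : Cover n) :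
    D.paramForm p q u = (1 / (D.r : ℝ)) * (p ⬝ᵥ u.2 - q ⬝ᵥ u.1) := rfl

theorem SameSlope.slopeForm_eq (h : SameSlope D D') : D'.slopeForm = D.slopeForm := by
  funext x y
  simp only [slopeForm, Matrix.mulVec, dotProduct, Finset.mul_sum, Finset.sum_mul, Matrix.map_apply]
  refine Finset.sum_congr rfl fun i _ => Finset.sum_congr rfl fun j _ => ?_
  linear_combination x j * y i * sameSlope_iff.1 h i j

theorem SameSlope.expo_eq (h : SameSlope D D') : D'.expo = D.expo := by
  funext k u
  exact congrFun (congrFun h.slopeForm_eq _) _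

theorem form_bundle_apply (D : TransData n) (μ : Fin n → ℂ) (u v : Cover n) :
    (D.bundle μ).form u v = -(Complex.I / (2 * π)) * (D.slopeForm u.1 v.2
      + (1 / (D.r : ℂ)) * (μ ⬝ᵥ fun i => (v.2 i : ℂ))) := by
  change -(Complex.I / (2 * π)) * ∑ i, _ = _
  simp only [slopeForm, dotProduct, Complex.ofReal_mul, Complex.ofReal_sum, Complex.ofReal_div,
    Complex.ofReal_one, Complex.ofReal_natCast, add_mul, Finset.sum_add_distrib, mul_assoc,
    Finset.mul_sum]

theorem form_bundle_muOf_apply (D : TransData n) (T : Matrix (Fin n) (Fin n) ℂ)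
    (p q : Fin n → ℝ) (u v : Cover n) : (D.bundle (muOf T p q)).form u v
      = -(Complex.I / (2 * π)) * (D.slopeForm u.1 v.2 + D.paramForm p q v
        + (1 / (D.r : ℂ)) * ((fun i => (q i : ℂ)) ⬝ᵥ zcoord T v)) := by
  have transpose_eq : (Tᵀ *ᵥ fun i => (q i : ℂ)) ⬝ᵥ (fun i => (v.2 i : ℂ))
      = (fun i => (q i : ℂ)) ⬝ᵥ (T *ᵥ fun i => (v.2 i : ℂ)) := by
    rw [Matrix.dotProduct_mulVec, Matrix.mulVec_transpose]
  rw [form_bundle_apply, zcoord, dotProduct_add, ← transpose_eq, muOf, add_dotProduct]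
  simp only [paramForm_apply, dotProduct, Complex.ofReal_mul, Complex.ofReal_sub,
    Complex.ofReal_sum, Complex.ofReal_div, Complex.ofReal_one, Complex.ofReal_natCast]
  ring

theorem form_bundle_type01 (D : TransData n) {T : Matrix (Fin n) (Fin n) ℂ} (p q : Fin n → ℝ)
    (u : Cover n) {v w : Cover n} (hvw : IsType01 T v w) :
    (D.bundle (muOf T p q)).form u v + Complex.I * (D.bundle (muOf T p q)).form u w
      = -(Complex.I / (2 * π)) * (D.slopeForm u.1 v.2 + Complex.I * D.slopeForm u.1 w.2
        + (D.paramForm p q v + Complex.I * D.paramForm p q w)) := by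
  have hz : (fun i => (q i : ℂ)) ⬝ᵥ zcoord T v
      + Complex.I * ((fun i => (q i : ℂ)) ⬝ᵥ zcoord T w) = 0 := by
    rw [← smul_eq_mul, ← dotProduct_smul, ← dotProduct_add, hvw, dotProduct_zero]
  rw [form_bundle_muOf_apply, form_bundle_muOf_apply]
  linear_combination (-(Complex.I / (2 * π)) * (1 / (D.r : ℂ))) * hz

section SameSlope

variable {T : Matrix (Fin n) (Fin n) ℂ} {p q p' q' : Fin n → ℝ}
  {ψ : Cover n → Matrix (Fin D'.rk) (Fin D.rk) ℂ}

theorem SameSlope.dbar_closed_iff (h : SameSlope D D') {v w : Cover n} (hvw : IsType01 T v w)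
    (u : Cover n) :
    TorusBundle.covDeriv (D.bundle (muOf T p q)) (D'.bundle (muOf T p' q')) ψ u v + Complex.I •
        TorusBundle.covDeriv (D.bundle (muOf T p q)) (D'.bundle (muOf T p' q')) ψ u w = 0 ↔
      ∀ a b, fderiv ℝ (fun x => ψ x a b) u v + Complex.I * fderiv ℝ (fun x => ψ x a b) u w
        = Complex.I / (2 * π) * ((D'.paramForm p' q' - D.paramForm p q) v
          + Complex.I * (D'.paramForm p' q' - D.paramForm p q) w) * ψ u a b := by
  have form_eq := D.form_bundle_type01 p q u hvw
  have form_eq' := D'.form_bundle_type01 p' q' u hvw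
  rw [h.slopeForm_eq] at form_eq'
  rw [← Matrix.ext_iff]
  refine forall_congr' fun a => forall_congr' fun b => ?_
  change fderiv ℝ (fun x => ψ x a b) u v
    + ((D'.bundle (muOf T p' q')).form u v - (D.bundle (muOf T p q)).form u v) * ψ u a b
    + Complex.I * (fderiv ℝ (fun x => ψ x a b) u w
    + ((D'.bundle (muOf T p' q')).form u w - (D.bundle (muOf T p q)).form u w) * ψ u a b) = 0 ↔ _
  simp only [_root_.sub_apply, Complex.ofReal_sub]
  constructor <;> intro hab
  · linear_combination hab - ψ u a b * (form_eq' - form_eq)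
  · linear_combination hab + ψ u a b * (form_eq' - form_eq)

theorem SameSlope.equivariant_iff (h : SameSlope D D') (k : Deck n) (u : Cover n) :
    ψ (u + period k) * D.trans k u = D'.trans k u * ψ u ↔
      ψ (u + period k) * D.word k = D'.word k * ψ u := by
  rw [trans, trans, h.expo_eq, Matrix.mul_smul, Matrix.smul_mul]
  exact (smul_right_injective _ (Complex.exp_ne_zero _)).eq_iff

theorem SameSlope.isHolHom_iff (h : SameSlope D D') :
    TorusBundle.IsHolHom T (D.bundle (muOf T p q)) (D'.bundle (muOf T p' q')) ψ ↔
      (∀ a b, ContDiff ℝ ∞ fun u => ψ u a b) ∧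
      (∀ k u, ψ (u + period k) * D.word k = D'.word k * ψ u) ∧
      ∀ u v w, IsType01 T v w → ∀ a b, fderiv ℝ (fun x => ψ x a b) u v
        + Complex.I * fderiv ℝ (fun x => ψ x a b) u w
        = Complex.I / (2 * π) * ((D'.paramForm p' q' - D.paramForm p q) v
          + Complex.I * (D'.paramForm p' q' - D.paramForm p q) w) * ψ u a b :=
  ⟨fun ⟨smooth, equivariant, dbar_closed⟩ =>
    ⟨smooth, fun k u => (h.equivariant_iff k u).1 (equivariant k u),
      fun u v w hvw => (h.dbar_closed_iff hvw u).1 (dbar_closed u v w hvw)⟩,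
  fun ⟨smooth, equivariant, dbar_closed⟩ =>
    ⟨smooth, fun k u => (h.equivariant_iff k u).2 (equivariant k u),
      fun u v w hvw => (h.dbar_closed_iff hvw u).2 (dbar_closed u v w hvw)⟩⟩

theorem trace_mul_apply_add_period {X : Matrix (Fin D'.rk) (Fin D.rk) ℂ} {s : ℝ} {k : Deck n}
    (hX : IntertwinesUpTo X s (D.unitaryWord k) (D'.unitaryWord k)) {u : Cover n}
    (hψ : ψ (u + period k) * D.word k = D'.word k * ψ u) :
    (Xᴴ * ψ (u + period k)).trace = Complex.exp (Complex.I * s) * (Xᴴ * ψ u).trace := by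
  have word_mul : D.word k * Xᴴ = star (Complex.exp (Complex.I * s)) • (Xᴴ * D'.word k) :=
    unitary_mul_conjTranspose hX
  have hstar := star_mul_self_eq_one (norm_exp_I_mul s)
  calc (Xᴴ * ψ (u + period k)).trace
      = (Xᴴ * (ψ (u + period k) * D.word k) * (D.word k)ᴴ).trace := by
        rw [Matrix.mul_assoc, Matrix.mul_assoc, D.word_mul_conjTranspose, Matrix.mul_one]
    _ = (Xᴴ * D'.word k * ψ u * (D.word k)ᴴ).trace := by rw [hψ, ← Matrix.mul_assoc]
    _ = Complex.exp (Complex.I * s) * (D.word k * Xᴴ * ψ u * (D.word k)ᴴ).trace := by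
        rw [word_mul, Matrix.smul_mul, Matrix.smul_mul, trace_smul, smul_eq_mul, ← mul_assoc,
          mul_comm (Complex.exp _), hstar, one_mul]
    _ = Complex.exp (Complex.I * s) * (Xᴴ * ψ u).trace := by
        rw [trace_mul_comm, ← Matrix.mul_assoc, ← Matrix.mul_assoc, D.conjTranspose_mul_word,
          Matrix.one_mul]

theorem hasFDerivAt_trace_mul {E ι κ : Type*} [NormedAddCommGroup E] [NormedSpace ℝ E] [Fintype ι]
    [Fintype κ] (C : Matrix κ ι ℂ) {ψ : E → Matrix ι κ ℂ} {u : E}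
    (hψ : ∀ a b, DifferentiableAt ℝ (fun x => ψ x a b) u) :
    HasFDerivAt (fun x => (C * ψ x).trace)
      (∑ b, ∑ a, C b a • fderiv ℝ (fun x => ψ x a b) u) u := by
  simp only [Matrix.trace, Matrix.diag_apply, Matrix.mul_apply]
  exact HasFDerivAt.fun_sum fun b _ => HasFDerivAt.fun_sum fun a _ =>
    (hψ a b).hasFDerivAt.const_mul _

theorem SameSlope.trace_mul_eq_planeWave (h : SameSlope D D') (hT : HasComplexStructure T)
    {X : Matrix (Fin D'.rk) (Fin D.rk) ℂ} {s : Deck n → ℝ}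
    (hX : ∀ k, IntertwinesUpTo X (s k) (D.unitaryWord k) (D'.unitaryWord k))
    (hψ : TorusBundle.IsHolHom T (D.bundle (muOf T p q)) (D'.bundle (muOf T p' q')) ψ)
    (u : Cover n) : (Xᴴ * ψ u).trace
      = planeWave (D'.paramForm p' q' - D.paramForm p q) u * (Xᴴ * ψ 0).trace := by
  obtain ⟨smooth, equivariant, dbar_closed⟩ := h.isHolHom_iff.1 hψ
  have hderiv : ∀ u, HasFDerivAt (fun u => (Xᴴ * ψ u).trace) _ u := fun u =>
    hasFDerivAt_trace_mul Xᴴ fun a b => (smooth a b).differentiable (by simp) u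
  refine eq_planeWave_mul_of_dbar hT (fun u => (hderiv u).differentiableAt) (fun k u => ?_)
    (fun u v w hvw => ?_) u
  · rw [trace_mul_apply_add_period (hX k) (equivariant k u), norm_mul, norm_exp_I_mul, one_mul]
  · rw [(hderiv u).fderiv]
    simp only [_root_.sum_apply, _root_.smul_apply, smul_eq_mul, Matrix.trace, Matrix.diag_apply,
      Matrix.mul_apply, Finset.mul_sum, ← Finset.sum_add_distrib]
    refine Finset.sum_congr rfl fun b _ => Finset.sum_congr rfl fun a _ => ?_
    linear_combination Xᴴ b a * dbar_closed u v w hvw a b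

theorem SameSlope.planeWave_period_eq (h : SameSlope D D') (hT : HasComplexStructure T)
    {X : Matrix (Fin D'.rk) (Fin D.rk) ℂ} {s : Deck n → ℝ}
    (hX : ∀ k, IntertwinesUpTo X (s k) (D.unitaryWord k) (D'.unitaryWord k))
    (hψ : TorusBundle.IsHolHom T (D.bundle (muOf T p q)) (D'.bundle (muOf T p' q')) ψ)
    (h0 : (Xᴴ * ψ 0).trace ≠ 0) (k : Deck n) :
    planeWave (D'.paramForm p' q' - D.paramForm p q) (period k)
      = Complex.exp (Complex.I * s k) := by
  have hper := trace_mul_apply_add_period (hX k) ((h.isHolHom_iff.1 hψ).2.1 k 0)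
  rw [zero_add, h.trace_mul_eq_planeWave hT hX hψ] at hper
  exact mul_right_cancel₀ h0 hper

theorem intertwinesUpTo_word (D : TransData n) (w k : Deck n) :
    IntertwinesUpTo (D.word w) (2 * π / D.r * D.pairing k w) (D.unitaryWord k) (D.unitaryWord k) :=
  D.word_mul_word k w

theorem isSimple_bundle (D : TransData n) (hT : HasComplexStructure T) (p q : Fin n → ℝ) :
    TorusBundle.IsSimple T (D.bundle (muOf T p q)) := by
  have hD : SameSlope D D := sameSlope_equivalence.refl D
  intro ψ hψ
  change Cover n → Matrix (Fin D.rk) (Fin D.rk) ℂ at ψ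
  have hconst : ∀ u, ψ u = ψ 0 := by
    intro u
    by_contra hne
    obtain ⟨w, hw⟩ := D.exists_trace_word_ne_zero (sub_ne_zero.2 hne)
    rw [Matrix.mul_sub, trace_sub, hD.trace_mul_eq_planeWave hT (D.intertwinesUpTo_word w) hψ u]
      at hw
    simp [planeWave] at hw
  obtain ⟨c, hc⟩ := D.hasScalarCommutant_word (ψ 0) fun k => by
    have hk := (hD.isHolHom_iff.1 hψ).2.1 k 0
    rwa [hconst] at hk
  exact ⟨c, fun u => (hconst u).trans hc⟩

theorem SameSlope.isHolHom_planeWave (h : SameSlope D D') {X : Matrix (Fin D'.rk) (Fin D.rk) ℂ}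
    {s : Deck n → ℝ} (hX : ∀ k, IntertwinesUpTo X (s k) (D.unitaryWord k) (D'.unitaryWord k))
    (hs : ∀ k, planeWave (D'.paramForm p' q' - D.paramForm p q) (period k)
      = Complex.exp (Complex.I * s k)) :
    TorusBundle.IsHolHom T (D.bundle (muOf T p q)) (D'.bundle (muOf T p' q')) fun u =>
      planeWave (D'.paramForm p' q' - D.paramForm p q) u • X := by
  refine h.isHolHom_iff.2 ⟨fun a b => ?_, fun k u => ?_, fun u v w _ a b => ?_⟩
  · exact (contDiff_planeWave _).mul contDiff_const
  · have hXk : D'.word k * X = Complex.exp (Complex.I * s k) • (X * D.word k) := hX k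
    rw [Matrix.mul_smul, hXk, smul_smul, Matrix.smul_mul, planeWave_add_right, hs]
  · simp only [Matrix.smul_apply, smul_eq_mul]
    rw [((hasFDerivAt_planeWave _ u).mul_const (X a b)).fderiv]
    simp only [_root_.smul_apply, smul_eq_mul, ContinuousLinearMap.comp_apply,
      Complex.ofRealCLM_apply]
    ring

theorem SameSlope.isomorphic_of_planeWave_period_eq (h : SameSlope D D')
    {X : Matrix (Fin D'.rk) (Fin D.rk) ℂ} {X' : Matrix (Fin D.rk) (Fin D'.rk) ℂ} {s : Deck n → ℝ}
    (hXX' : X * X' = 1) (hX'X : X' * X = 1)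
    (hX : ∀ k, IntertwinesUpTo X (s k) (D.unitaryWord k) (D'.unitaryWord k))
    (hs : ∀ k, planeWave (D'.paramForm p' q' - D.paramForm p q) (period k)
      = Complex.exp (Complex.I * s k)) :
    TorusBundle.Isomorphic T (D.bundle (muOf T p q)) (D'.bundle (muOf T p' q')) := by
  have mul_inverse : ∀ u, planeWave (D'.paramForm p' q' - D.paramForm p q) u
      * planeWave (D.paramForm p q - D'.paramForm p' q') u = 1 := fun u => by
    rw [← neg_sub (D'.paramForm p' q'), mul_comm, planeWave_neg_mul_planeWave]
  have hs' : ∀ k, planeWave (D.paramForm p q - D'.paramForm p' q') (period k)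
      = Complex.exp (Complex.I * (-s k : ℝ)) := fun k => by
    refine mul_left_cancel₀ (Complex.exp_ne_zero (Complex.I * s k)) ?_
    rw [← hs, mul_inverse, hs, ← Complex.exp_add]
    simp
  refine ⟨_, _, h.isHolHom_planeWave hX hs,
    (sameSlope_equivalence.symm h).isHolHom_planeWave (fun k => (hX k).inverse hXX' hX'X) hs',
    fun u => ⟨?_, ?_⟩⟩
  · change (planeWave _ u • X) * (planeWave _ u • X') = 1
    rw [Matrix.smul_mul, Matrix.mul_smul, smul_smul, mul_inverse, one_smul, hXX']
  · change (planeWave _ u • X') * (planeWave _ u • X) = 1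
    rw [Matrix.smul_mul, Matrix.mul_smul, smul_smul, mul_comm, mul_inverse, one_smul, hX'X]

/-- Up to a plane wave, an isomorphism is the product of the change of frame with a word `w`. -/
theorem SameSlope.isomorphic_iff (h : SameSlope D D') (hT : HasComplexStructure T)
    {t : Deck n → ℝ} (ht : PhaseConj t D.word D'.word) :
    TorusBundle.Isomorphic T (D.bundle (muOf T p q)) (D'.bundle (muOf T p' q')) ↔
      ∃ w, ∀ k, planeWave (D'.paramForm p' q' - D.paramForm p q) (period k)
          = Complex.exp (Complex.I * (t k + 2 * π / D.r * D.pairing k w : ℝ)) := by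
  obtain ⟨g, g', hgg', hg'g, hg⟩ := ht
  have intertwines : ∀ w k, IntertwinesUpTo (g * D.word w) (t k + 2 * π / D.r * D.pairing k w)
      (D.unitaryWord k) (D'.unitaryWord k) := fun w k =>
    IntertwinesUpTo.comp (.of_eq_conj hg'g (hg k)) (D.intertwinesUpTo_word w k)
  constructor
  · rintro ⟨ψ, χ, hψ, -, hinv⟩
    change Cover n → Matrix (Fin D'.rk) (Fin D.rk) ℂ at ψ
    change Cover n → Matrix (Fin D.rk) (Fin D'.rk) ℂ at χ
    have inv_mul : χ 0 * ψ 0 = 1 := (hinv 0).2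
    have hne : gᴴ * ψ 0 ≠ 0 := fun h0 => by
      have : Nonempty (Fin D.rk) := ⟨⟨0, D.rk_pos⟩⟩
      have hψ0 : ψ 0 = 0 := by
        rw [← Matrix.one_mul (ψ 0), ← conjTranspose_one, ← hgg', conjTranspose_mul,
          Matrix.mul_assoc, h0, Matrix.mul_zero]
      exact one_ne_zero (inv_mul.symm.trans (hψ0 ▸ Matrix.mul_zero _))
    obtain ⟨w, hw⟩ := D.exists_trace_word_ne_zero hne
    rw [← Matrix.mul_assoc, ← conjTranspose_mul] at hw
    exact ⟨w, h.planeWave_period_eq hT (intertwines w) hψ hw⟩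
  · rintro ⟨w, hw⟩
    refine h.isomorphic_of_planeWave_period_eq (X' := (D.word w)ᴴ * g') ?_ ?_ (intertwines w) hw
    · rw [Matrix.mul_assoc, ← Matrix.mul_assoc (D.word w), D.word_mul_conjTranspose, Matrix.one_mul,
        hgg']
    · rw [Matrix.mul_assoc, ← Matrix.mul_assoc g', hg'g, Matrix.one_mul, D.conjTranspose_mul_word]

end SameSlope

end TransData

/-! ### The slope is an isomorphism invariant -/

namespace TransData

variable {n : ℕ} {D D' : TransData n}

theorem expo_inr (D : TransData n) (l : Fin n → ℤ) (u : Cover n) : D.expo (0, l) u = 0 := by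
  have cast_zero : (fun i => (((0 : Fin n → ℤ) i : ℤ) : ℝ)) = 0 := funext fun _ => Int.cast_zero
  rw [expo, cast_zero, mulVec_zero, zero_dotProduct, mul_zero]

theorem expo_inl_single_add_period (D : TransData n) (i j : Fin n) (u : Cover n) :
    D.expo (Pi.single j 1, 0) (u + period (0, Pi.single i 1))
      = D.expo (Pi.single j 1, 0) u + 2 * π * (D.A i j / D.r) := by
  have cast_single : ∀ i, (fun a => (((Pi.single i 1 : Fin n → ℤ) a : ℤ) : ℝ)) = Pi.single i 1 :=
    fun i => funext fun a => by rcases eq_or_ne a i with rfl | ha <;> simp [*]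
  have period_single : (period ((0, Pi.single i 1) : Deck n)).2 = (2 * π) • Pi.single i 1 := by
    rw [← cast_single]
    rfl
  simp only [expo, cast_single, mulVec_single_one, Prod.snd_add, period_single, dotProduct_add,
    dotProduct_smul, dotProduct_single_one, smul_eq_mul, col_apply, Matrix.map_apply]
  ring

section Equivariant

variable {ψ : Cover n → Matrix (Fin D'.rk) (Fin D.rk) ℂ} {k : Deck n} {u : Cover n}

theorem apply_add_period_eq (hψ : ψ (u + period k) * D.trans k u = D'.trans k u * ψ u) :
    ψ (u + period k) = Complex.exp (Complex.I * (D'.expo k u - D.expo k u : ℝ)) •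
      (D'.word k * ψ u * (D.word k)ᴴ) := by
  rw [trans, trans, Matrix.mul_smul, Matrix.smul_mul] at hψ
  have mul_word : ψ (u + period k) * D.word k
      = Complex.exp (Complex.I * (D'.expo k u - D.expo k u : ℝ)) • (D'.word k * ψ u) := by
    refine smul_right_injective _ (Complex.exp_ne_zero (Complex.I * D.expo k u)) ?_
    simp only [hψ, smul_smul, ← Complex.exp_add, ← mul_add, ← Complex.ofReal_add, add_sub_cancel]
  rw [← Matrix.smul_mul, ← mul_word, Matrix.mul_assoc, D.word_mul_conjTranspose, Matrix.mul_one]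

theorem det_mul_apply_add_period {X : Matrix (Fin D.rk) (Fin D'.rk) ℂ}
    {Y : Matrix (Fin D'.rk) (Fin D.rk) ℂ} (hYX : Y * X = 1)
    (hψ : ψ (u + period k) * D.trans k u = D'.trans k u * ψ u) :
    (X * ψ (u + period k)).det = (X * D'.word k * Y).det * (D.word k)ᴴ.det
      * Complex.exp (Complex.I * (D.rk * (D'.expo k u - D.expo k u) : ℝ)) * (X * ψ u).det := by
  have factor : X * (D'.word k * ψ u * (D.word k)ᴴ)
      = X * D'.word k * Y * (X * ψ u) * (D.word k)ᴴ := by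
    rw [← Matrix.mul_assoc (X * D'.word k * Y), Matrix.mul_assoc _ Y X, hYX, Matrix.mul_one,
      ← Matrix.mul_assoc, ← Matrix.mul_assoc]
  rw [apply_add_period_eq hψ, Matrix.mul_smul, factor, det_smul, det_mul, det_mul,
    Fintype.card_fin, ← Complex.exp_nat_mul, Complex.ofReal_mul, Complex.ofReal_natCast,
    mul_left_comm (D.rk : ℂ)]
  ring

end Equivariant

theorem sameSlope_of_isomorphic {T : Matrix (Fin n) (Fin n) ℂ} {μ μ' : Fin n → ℂ}
    (h : TorusBundle.Isomorphic T (D.bundle μ) (D'.bundle μ')) : SameSlope D D' := by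
  obtain ⟨ψ, χ, ⟨smooth, equivariant, -⟩, -, hinv⟩ := h
  change Cover n → Matrix (Fin D'.rk) (Fin D.rk) ℂ at ψ
  change Cover n → Matrix (Fin D.rk) (Fin D'.rk) ℂ at χ
  have mul_inv : ∀ u, ψ u * χ u = 1 := fun u => (hinv u).1
  have inv_mul : ∀ u, χ u * ψ u = 1 := fun u => (hinv u).2
  have continuous_det : Continuous fun u => (χ 0 * ψ u).det :=
    (continuous_const.matrix_mul <| continuous_pi fun a => continuous_pi fun b =>
      (smooth a b).continuous).matrix_det
  have det_ne_zero : ∀ u, (χ 0 * ψ u).det ≠ 0 := fun u =>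
    det_ne_zero_of_right_inverse (B := χ u * ψ 0) <| by
      rw [Matrix.mul_assoc, ← Matrix.mul_assoc (ψ u), mul_inv, Matrix.one_mul, inv_mul]
  have det_add_period := fun k u => det_mul_apply_add_period (mul_inv 0) (equivariant k u)
  refine sameSlope_iff.2 fun i j => ?_
  have hinvariant := multiplier_invariant continuous_det det_ne_zero
    (lam := fun u => D.rk * (D'.expo (Pi.single j 1, 0) u - D.expo (Pi.single j 1, 0) u))
    (continuous_const.mul ((D'.expo_smooth _).continuous.sub (D.expo_smooth _).continuous))
    (det_add_period (Pi.single j 1, 0)) (b := period (0, Pi.single i 1))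
    (fun u => by
      rw [det_add_period, expo_inr, expo_inr, sub_self, mul_zero, Complex.ofReal_zero, mul_zero,
        Complex.exp_zero, mul_one]) 0
  rw [expo_inl_single_add_period, expo_inl_single_add_period] at hinvariant
  have hrk : (D.rk : ℝ) ≠ 0 := Nat.cast_ne_zero.2 D.rk_pos.ne'
  have hpi : (2 * π : ℝ) ≠ 0 := by positivity
  refine mul_left_cancel₀ hpi ?_
  linear_combination mul_left_cancel₀ hrk hinvariant

end TransData

/-! ### Comparison of multipliers -/

theorem exp_I_eq_iff (a b : ℝ) : Complex.exp (Complex.I * a) = Complex.exp (Complex.I * b) ↔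
    ∃ z : ℤ, a = b + 2 * π * z := by
  rw [Complex.exp_eq_exp_iff_exists_int]
  refine exists_congr fun z => ⟨fun h => ?_, fun h => ?_⟩
  · have hab : (a : ℂ) = b + 2 * π * z := mul_left_cancel₀ Complex.I_ne_zero (by
      linear_combination h)
    exact_mod_cast hab
  · rw [h]
    push_cast
    ring

namespace TransData

variable {n : ℕ} {D D' : TransData n}

theorem wordPhase_add (s t : Fin n ⊕ Fin n → ℝ) (k : Deck n) :
    wordPhase (s + t) k = wordPhase s k + wordPhase t k := by
  simp only [wordPhase, Pi.add_apply, mul_add, Finset.sum_add_distrib]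
  ring

theorem exp_wordPhase_eq_iff {s t : Fin n ⊕ Fin n → ℝ} :
    (∀ k, Complex.exp (Complex.I * wordPhase s k) = Complex.exp (Complex.I * wordPhase t k)) ↔
      ∀ i, ∃ z : ℤ, s i = t i + 2 * π * z := by
  simp only [exp_I_eq_iff]
  constructor
  · rintro h (j | j)
    · simpa [wordPhase, Pi.single_apply] using h (Pi.single j 1, 0)
    · simpa [wordPhase, Pi.single_apply] using h (0, Pi.single j 1)
  · intro h k
    choose z hz using h
    refine ⟨∑ j, k.1 j * z (.inl j) + ∑ j, k.2 j * z (.inr j), ?_⟩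
    simp only [wordPhase, hz, mul_add, Finset.sum_add_distrib, Int.cast_add, Int.cast_sum,
      Int.cast_mul, Finset.mul_sum, mul_left_comm (2 * π)]
    ring

/-- The phases by which the word `w` fails to commute with the generators. -/
def pairingPhase (D : TransData n) (w : Deck n) : Fin n ⊕ Fin n → ℝ :=
  Sum.elim (fun i => -(2 * π * ((D.Aᵀ *ᵥ w.2) i : ℤ) / D.r))
    fun i => 2 * π * ((D.A *ᵥ w.1) i : ℤ) / D.r

theorem wordPhase_pairingPhase (D : TransData n) (k w : Deck n) :
    wordPhase (D.pairingPhase w) k = 2 * π / D.r * D.pairing k w := by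
  have pairing_eq : D.pairing k w = k.2 ⬝ᵥ (D.A *ᵥ w.1) - k.1 ⬝ᵥ (D.Aᵀ *ᵥ w.2) := by
    rw [pairing, dotProduct_comm, dotProduct_comm (D.A *ᵥ k.1), dotProduct_mulVec w.2,
      dotProduct_comm k.1, mulVec_transpose]
  simp only [pairing_eq, wordPhase, pairingPhase, Sum.elim_inl, Sum.elim_inr, dotProduct,
    Int.cast_sub, Int.cast_sum, Int.cast_mul, mul_sub, Finset.mul_sum, mul_neg,
    Finset.sum_neg_distrib, neg_add_eq_sub]
  congr 1 <;> exact Finset.sum_congr rfl fun i _ => by ring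

/-- The phases of the plane wave of `paramForm` along the periods. -/
def paramPhase (D : TransData n) (p q : Fin n → ℝ) : Fin n ⊕ Fin n → ℝ :=
  Sum.elim (fun i => -(q i / D.r)) fun i => p i / D.r

theorem paramForm_period (D : TransData n) (p q : Fin n → ℝ) (k : Deck n) :
    D.paramForm p q (period k) = 2 * π * wordPhase (D.paramPhase p q) k := by
  simp only [paramForm_apply, period, wordPhase, paramPhase, Sum.elim_inl, Sum.elim_inr,
    dotProduct, mul_sub, mul_add, Finset.mul_sum, mul_neg, Finset.sum_neg_distrib]
  rw [sub_eq_neg_add]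
  exact congrArg₂ (fun a b => -a + b) (Finset.sum_congr rfl fun i _ => by ring)
    (Finset.sum_congr rfl fun i _ => by ring)

theorem planeWave_paramForm_sub_period (D D' : TransData n) (p q p' q' : Fin n → ℝ) (k : Deck n) :
    planeWave (D'.paramForm p' q' - D.paramForm p q) (period k)
      = Complex.exp (Complex.I * wordPhase (D'.paramPhase p' q' - D.paramPhase p q) k) := by
  have hsub : wordPhase (D'.paramPhase p' q') k
      = wordPhase (D'.paramPhase p' q' - D.paramPhase p q) k + wordPhase (D.paramPhase p q) k := by
    rw [← wordPhase_add, sub_add_cancel]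
  rw [planeWave, _root_.sub_apply, paramForm_period, paramForm_period, hsub]
  congr 3
  field_simp
  ring

theorem SameSlope.isomorphic_iff_mem_slopeLattice (h : SameSlope D D')
    {T : Matrix (Fin n) (Fin n) ℂ} (hT : HasComplexStructure T) {p q p' q' : Fin n → ℝ}
    {t : Fin n ⊕ Fin n → ℝ} (ht : PhaseConj t (fun i => (D.gen i).1) fun i => (D'.gen i).1) :
    TorusBundle.Isomorphic T (D.bundle (muOf T p q)) (D'.bundle (muOf T p' q')) ↔
      (fun i => p' i / D'.r - p i / D.r - t (.inr i)) ∈ slopeLattice D.r D.A ∧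
      (fun i => q' i / D'.r - q i / D.r + t (.inl i)) ∈ slopeLattice D.r D.Aᵀ := by
  rw [h.isomorphic_iff hT (phaseConj_word ht)]
  simp only [planeWave_paramForm_sub_period, ← wordPhase_pairingPhase, ← wordPhase_add,
    exp_wordPhase_eq_iff, Sum.forall, Pi.add_apply, Pi.sub_apply, paramPhase, pairingPhase,
    Sum.elim_inl, Sum.elim_inr]
  constructor
  · rintro ⟨w, hq, hp⟩
    choose a ha using hq
    choose b hb using hp
    refine ⟨⟨w.1, b, fun i => ?_⟩, w.2, -a, fun i => ?_⟩
    · linear_combination hb i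
    · rw [Pi.neg_apply, Int.cast_neg]
      linear_combination -ha i
  · rintro ⟨⟨m, b, hp⟩, l, a, hq⟩
    refine ⟨(m, l), fun i => ⟨-a i, ?_⟩, fun i => ⟨b i, ?_⟩⟩
    · rw [Int.cast_neg]
      linear_combination -hq i
    · linear_combination hp i

end TransData

/-! ### Holomorphic bundles and Lagrangian submanifolds -/

section ComplexVec

variable {n : ℕ}

/-- The complex vector `a + 𝐢 b`. -/
def complexVec (a b : Fin n → ℝ) : Fin n → ℂ := fun i => a i + Complex.I * b i

theorem complexVec_surjective (z : Fin n → ℂ) : ∃ a b, complexVec a b = z :=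
  ⟨fun i => (z i).re, fun i => (z i).im, funext fun i => by
    rw [complexVec, mul_comm, Complex.re_add_im]⟩

theorem isType01_iff (T : Matrix (Fin n) (Fin n) ℂ) (v w : Cover n) :
    IsType01 T v w ↔ complexVec v.1 w.1 = -(T *ᵥ complexVec v.2 w.2) := by
  have complexVec_eq : ∀ a b : Fin n → ℝ, complexVec a b
      = (fun i => (a i : ℂ)) + Complex.I • fun i => (b i : ℂ) := fun _ _ => rfl
  rw [← add_eq_zero_iff_eq_neg, IsType01, zcoord, zcoord, complexVec_eq, complexVec_eq, mulVec_add,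
    mulVec_smul, smul_add, add_add_add_comm]

theorem exists_isType01 (T : Matrix (Fin n) (Fin n) ℂ) (z : Fin n → ℂ) :
    ∃ v w : Cover n, IsType01 T v w ∧ complexVec v.2 w.2 = z := by
  obtain ⟨a, b, rfl⟩ := complexVec_surjective z
  obtain ⟨x, y, hxy⟩ := complexVec_surjective (-(T *ᵥ complexVec a b))
  exact ⟨(x, a), (y, b), (isType01_iff T _ _).2 hxy, rfl⟩

theorem complexVec_phi_fst (δ : Matrix (Fin n) (Fin n) ℤ) (v w : Cover n) :
    complexVec (phi δ v).1 (phi δ w).1 = -complexVec v.2 w.2 := by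
  ext i
  simp only [complexVec, phi_apply, Pi.neg_apply, Complex.ofReal_neg]
  ring

theorem IsType01.complexVec_phi_snd {T : Matrix (Fin n) (Fin n) ℂ} (δ : Matrix (Fin n) (Fin n) ℤ)
    {v w : Cover n} (h : IsType01 T v w) :
    complexVec (phi δ v).2 (phi δ w).2 = -((T - toC δ) *ᵥ complexVec v.2 w.2) := by
  have phi_snd : complexVec (phi δ v).2 (phi δ w).2
      = complexVec v.1 w.1 + toC δ *ᵥ complexVec v.2 w.2 := by
    ext i
    simp only [complexVec, phi_apply, Pi.add_apply, Matrix.mulVec, dotProduct, Complex.ofReal_add,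
      Complex.ofReal_sum, Complex.ofReal_mul, mul_add, Finset.mul_sum, Finset.sum_add_distrib,
      Matrix.map_apply, Complex.ofReal_intCast, mul_left_comm Complex.I]
    ring
  rw [phi_snd, (isType01_iff T v w).1 h, sub_mulVec]
  abel

end ComplexVec

theorem isSymm_transpose_mul_iff {R ι : Type*} [CommRing R] [Fintype ι] (A W : Matrix ι ι R) :
    (Aᵀ * W).IsSymm ↔ ∀ v w, (A *ᵥ v) ⬝ᵥ (W *ᵥ w) = (A *ᵥ w) ⬝ᵥ (W *ᵥ v) := by
  classical
  have bilinear_eq : ∀ v w, (A *ᵥ v) ⬝ᵥ (W *ᵥ w) = v ⬝ᵥ ((Aᵀ * W) *ᵥ w) := fun v w => by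
    rw [← mulVec_mulVec, dotProduct_mulVec v, vecMul_transpose]
  simp only [bilinear_eq]
  refine ⟨fun h v w => ?_, fun h => Matrix.ext fun i j => ?_⟩
  · rw [dotProduct_mulVec, ← mulVec_transpose, h.eq, dotProduct_comm]
  · simpa using h (Pi.single j 1) (Pi.single i 1)

namespace TransData

variable {n : ℕ}

theorem slopeForm_complexVec (D : TransData n) (a b c d : Fin n → ℝ) :
    (D.slopeForm a c : ℂ) - D.slopeForm b d + Complex.I * (D.slopeForm a d + D.slopeForm b c)
      = (1 / (D.r : ℂ)) * ((toC D.A *ᵥ complexVec a b) ⬝ᵥ complexVec c d) := by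
  have ofReal_slopeForm : ∀ x y : Fin n → ℝ, (D.slopeForm x y : ℂ)
      = (1 / (D.r : ℂ)) * ((toC D.A *ᵥ fun i => (x i : ℂ)) ⬝ᵥ fun i => (y i : ℂ)) := fun x y => by
    simp [slopeForm, Matrix.mulVec, dotProduct]
  have complexVec_eq : ∀ a b : Fin n → ℝ, complexVec a b
      = (fun i => (a i : ℂ)) + Complex.I • fun i => (b i : ℂ) := fun _ _ => rfl
  simp only [ofReal_slopeForm, complexVec_eq, mulVec_add, mulVec_smul, dotProduct_add,
    add_dotProduct, dotProduct_smul, smul_dotProduct, smul_eq_mul]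
  linear_combination (-(1 / (D.r : ℂ))) * ((toC D.A *ᵥ fun i => (b i : ℂ)) ⬝ᵥ
    fun i => (d i : ℂ)) * Complex.I_mul_I

theorem slopeForm_eq_dotForm (D : TransData n) (x y : Fin n → ℝ) :
    D.slopeForm x y = dotForm ((1 / (D.r : ℝ)) • ((toR D.A)ᵀ *ᵥ y)) x := by
  rw [slopeForm, dotForm_apply, smul_dotProduct, smul_eq_mul, mulVec_transpose, dotProduct_comm,
    dotProduct_mulVec]

theorem curvature_bundle (D : TransData n) (μ : Fin n → ℂ) (u v w : Cover n) :
    (D.bundle μ).curvature u v w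
      = -(Complex.I / (2 * π)) * (D.slopeForm v.1 w.2 - D.slopeForm w.1 v.2) := by
  have fderiv_form : ∀ v w : Cover n, fderiv ℝ (fun x => (D.bundle μ).form x w) u v
      = -(Complex.I / (2 * π)) * D.slopeForm v.1 w.2 := fun v w => by
    let ℓ : Cover n →L[ℝ] ℝ := (dotForm ((1 / (D.r : ℝ)) • ((toR D.A)ᵀ *ᵥ w.2))).comp
      (ContinuousLinearMap.fst ℝ _ _)
    have linear_part : HasFDerivAt (fun x : Cover n => (D.slopeForm x.1 w.2 : ℂ))
        (Complex.ofRealCLM.comp ℓ) u := by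
      simp only [slopeForm_eq_dotForm]
      exact (Complex.ofRealCLM.comp ℓ).hasFDerivAt
    simp only [form_bundle_apply]
    rw [((linear_part.add_const _).const_mul _).fderiv, slopeForm_eq_dotForm]
    rfl
  rw [TorusBundle.curvature, fderiv_form, fderiv_form, mul_sub]

theorem curvature_pullback_type01 (D : TransData n) (μ : Fin n → ℂ)
    {T : Matrix (Fin n) (Fin n) ℂ} (δ : Matrix (Fin n) (Fin n) ℤ) (u : Cover n)
    {v₁ w₁ v₂ w₂ : Cover n} (h₁ : IsType01 T v₁ w₁) (h₂ : IsType01 T v₂ w₂) :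
    ((D.bundle μ).pullback δ).curvature u v₁ v₂ - ((D.bundle μ).pullback δ).curvature u w₁ w₂
        + Complex.I * (((D.bundle μ).pullback δ).curvature u v₁ w₂
          + ((D.bundle μ).pullback δ).curvature u w₁ v₂)
      = -(Complex.I / (2 * π * D.r)) *
        ((toC D.A *ᵥ complexVec v₁.2 w₁.2) ⬝ᵥ ((T - toC δ) *ᵥ complexVec v₂.2 w₂.2)
          - (toC D.A *ᵥ complexVec v₂.2 w₂.2) ⬝ᵥ ((T - toC δ) *ᵥ complexVec v₁.2 w₁.2)) := by
  have slope_12 := D.slopeForm_complexVec (phi δ v₁).1 (phi δ w₁).1 (phi δ v₂).2 (phi δ w₂).2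
  have slope_21 := D.slopeForm_complexVec (phi δ v₂).1 (phi δ w₂).1 (phi δ v₁).2 (phi δ w₁).2
  rw [complexVec_phi_fst, h₂.complexVec_phi_snd, mulVec_neg, neg_dotProduct_neg] at slope_12
  rw [complexVec_phi_fst, h₁.complexVec_phi_snd, mulVec_neg, neg_dotProduct_neg] at slope_21
  simp only [TorusBundle.curvature_pullback, D.curvature_bundle]
  linear_combination (-(Complex.I / (2 * π))) * (slope_12 - slope_21)

theorem isHolomorphic_pullback_iff (D : TransData n) (μ : Fin n → ℂ)
    (T : Matrix (Fin n) (Fin n) ℂ) (δ : Matrix (Fin n) (Fin n) ℤ) :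
    TorusBundle.IsHolomorphic T ((D.bundle μ).pullback δ) ↔
      ((toC D.A)ᵀ * (T - toC δ)).IsSymm := by
  rw [isSymm_transpose_mul_iff]
  constructor
  · intro h z₁ z₂
    obtain ⟨v₁, w₁, h₁, rfl⟩ := exists_isType01 T z₁
    obtain ⟨v₂, w₂, h₂, rfl⟩ := exists_isType01 T z₂
    have curvature_smul := h 0 v₁ w₁ v₂ w₂ h₁ h₂
    rw [D.curvature_pullback_type01 μ δ 0 h₁ h₂] at curvature_smul
    change _ • (1 : Matrix (Fin D.rk) (Fin D.rk) ℂ) = 0 at curvature_smul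
    have : Nonempty (Fin D.rk) := ⟨⟨0, D.rk_pos⟩⟩
    have hr : (D.r : ℂ) ≠ 0 := Nat.cast_ne_zero.2 D.r_pos.ne'
    have hpi : (π : ℂ) ≠ 0 := Complex.ofReal_ne_zero.2 Real.pi_ne_zero
    have factor_ne_zero : -(Complex.I / (2 * π * D.r)) ≠ 0 :=
      neg_ne_zero.2 (div_ne_zero Complex.I_ne_zero (mul_ne_zero (mul_ne_zero two_ne_zero hpi) hr))
    exact sub_eq_zero.1 ((mul_eq_zero.1 ((smul_eq_zero.1 curvature_smul).resolve_right
      one_ne_zero)).resolve_left factor_ne_zero)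
  · intro h u v₁ w₁ v₂ w₂ h₁ h₂
    rw [D.curvature_pullback_type01 μ δ u h₁ h₂, h, sub_self, mul_zero, zero_smul]

end TransData

theorem isSymm_transpose_mul_complex_iff {ι : Type*} [Fintype ι] (A : Matrix ι ι ℤ)
    (τ : Matrix ι ι ℂ) : ((A.map (Int.cast : ℤ → ℂ))ᵀ * τ).IsSymm ↔
      ((A.map (Int.cast : ℤ → ℝ))ᵀ * τ.map Complex.im).IsSymm ∧
        ((A.map (Int.cast : ℤ → ℝ))ᵀ * τ.map Complex.re).IsSymm := by
  have re_apply (i j : ι) : (((A.map (Int.cast : ℤ → ℂ))ᵀ * τ) i j).re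
      = ((A.map (Int.cast : ℤ → ℝ))ᵀ * τ.map Complex.re) i j := by simp [Matrix.mul_apply]
  have im_apply (i j : ι) : (((A.map (Int.cast : ℤ → ℂ))ᵀ * τ) i j).im
      = ((A.map (Int.cast : ℤ → ℝ))ᵀ * τ.map Complex.im) i j := by simp [Matrix.mul_apply]
  simp only [IsSymm.ext_iff, Complex.ext_iff, re_apply, im_apply, forall_and, and_comm]

namespace AffData

variable {n : ℕ}

theorem r_ne_zero (a : AffData n) : (a.r : ℝ) ≠ 0 := Nat.cast_ne_zero.2 a.r_pos.ne'

theorem twoForm_tangent (a : AffData n) (W : Matrix (Fin n) (Fin n) ℝ) (y v w : Fin n → ℝ) :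
    twoForm W (a.tangent y v) (a.tangent y w)
      = -(1 / (a.r : ℝ)) * ((toR a.A *ᵥ v) ⬝ᵥ (W *ᵥ w) - (toR a.A *ᵥ w) ⬝ᵥ (W *ᵥ v)) := by
  simp only [twoForm, tangent_eq, smul_dotProduct, smul_eq_mul, mul_sub]

theorem twoForm_tangent_eq_zero_iff (a : AffData n) (W : Matrix (Fin n) (Fin n) ℝ) :
    (∀ y v w, twoForm W (a.tangent y v) (a.tangent y w) = 0) ↔ ((toR a.A)ᵀ * W).IsSymm := by
  rw [isSymm_transpose_mul_iff]
  simp only [twoForm_tangent, mul_eq_zero, neg_eq_zero, one_div, inv_eq_zero, a.r_ne_zero,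
    false_or, sub_eq_zero, forall_const]

theorem curvature_eq_zero (a : AffData n) (y v w : Fin n → ℝ) : a.curvature y v w = 0 := by
  simp only [curvature, connForm, tangent_eq, fderiv_fun_const, Pi.zero_apply, _root_.zero_apply,
    sub_zero]

theorem isFukObj_iff (a : AffData n) (τ : Matrix (Fin n) (Fin n) ℂ) :
    a.IsFukObj τ ↔ ((toC a.A)ᵀ * τ).IsSymm := by
  rw [isSymm_transpose_mul_complex_iff, ← twoForm_tangent_eq_zero_iff,
    ← twoForm_tangent_eq_zero_iff]
  have flat_iff (x : ℝ) : (0 : ℂ) = 2 * π * Complex.I * x ↔ x = 0 := by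
    rw [eq_comm, mul_eq_zero, or_iff_right Complex.two_pi_I_ne_zero, Complex.ofReal_eq_zero]
  refine ⟨fun h => ⟨h.lagrangian, fun y v w => ?_⟩, fun h => ⟨h.1, fun y v w => ?_⟩⟩
  · rw [← flat_iff, ← h.curv, curvature_eq_zero]
  · rw [curvature_eq_zero, flat_iff, h.2]

theorem point_eq_point_iff (a b : AffData n) (y z : Fin n → ℝ) :
    a.point y = b.point z ↔ ∃ k m : Fin n → ℤ,
      (∀ i, (b.param z).1 i = (a.param y).1 i + k i * (2 * π)) ∧
        z = y + (2 * π) • fun i => (m i : ℝ) := by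
  constructor
  · intro h
    choose k hk using fun i => coe_eq_coe (congrFun (congrArg Prod.fst h) i)
    choose m hm using fun i => coe_eq_coe (congrFun (congrArg Prod.snd h) i)
    refine ⟨k, m, hk, funext fun i => (hm i).trans ?_⟩
    simp only [param, Pi.add_apply, Pi.smul_apply, smul_eq_mul, mul_comm]
  · rintro ⟨k, m, hk, rfl⟩
    refine Prod.ext (funext fun i => ?_) (funext fun i => ?_)
    · simp only [point, hk, coe_add_period]
    · simp only [point, param, Pi.add_apply, Pi.smul_apply, smul_eq_mul, mul_comm (2 * π),
        coe_add_period]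

theorem param_fst_apply (a : AffData n) (y : Fin n → ℝ) (i : Fin n) :
    (a.param y).1 i = -((toR a.A *ᵥ y) i / a.r) + a.p i / a.r := by
  simp only [param, Pi.add_apply, Pi.smul_apply, smul_eq_mul]
  ring

theorem param_fst_add_period (a : AffData n) (y : Fin n → ℝ) (m : Fin n → ℤ) (i : Fin n) :
    (a.param (y + (2 * π) • fun j => (m j : ℝ))).1 i
      = (a.param y).1 i - 2 * π * (((a.A *ᵥ m) i : ℤ) : ℝ) / a.r := by
  rw [param_fst_apply, param_fst_apply, mulVec_add, mulVec_smul, Pi.add_apply, Pi.smul_apply,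
    toR_mulVec_intCast, smul_eq_mul]
  ring

theorem slope_apply_eq_of_L_eq {a b : AffData n} (h : a.L = b.L) (i j : Fin n) :
    (b.A i j : ℝ) / b.r = a.A i j / a.r := by
  have column := congrFun (slope_eq_of_L_eq h (Pi.single j 1)) i
  simp only [mulVec_single_one, Pi.smul_apply, smul_eq_mul, col_apply, Matrix.map_apply] at column
  linear_combination column

theorem sub_mem_slopeLattice_of_L_eq {a b : AffData n} (h : a.L = b.L) :
    (fun i => b.p i / b.r - a.p i / a.r) ∈ slopeLattice a.r a.A := by
  have origin_mem : b.point 0 ∈ a.L := h ▸ Set.mem_range_self 0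
  obtain ⟨c, hc⟩ := origin_mem
  obtain ⟨k, m, hk, hm⟩ := (point_eq_point_iff _ _ _ _).1 hc
  have hc : c = 0 + (2 * π) • fun i => (((-m) i : ℤ) : ℝ) := by
    rw [zero_add, ← sub_eq_zero, hm]
    ext i
    simp
  refine ⟨m, k, fun i => ?_⟩
  have first_coordinate := hk i
  rw [hc, param_fst_add_period, param_fst_apply, param_fst_apply, mulVec_zero, mulVec_zero,
    Pi.zero_apply, zero_div, zero_div, mulVec_neg, Pi.neg_apply, Int.cast_neg] at first_coordinate
  linear_combination first_coordinate

theorem L_eq_of_sub_mem_slopeLattice {a b : AffData n}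
    (hs : ∀ i j, (b.A i j : ℝ) / b.r = a.A i j / a.r)
    (hp : (fun i => b.p i / b.r - a.p i / a.r) ∈ slopeLattice a.r a.A) : a.L = b.L := by
  obtain ⟨m, k, hmk⟩ := hp
  have slope_mulVec (y : Fin n → ℝ) (i : Fin n) :
      (toR b.A *ᵥ y) i / b.r = (toR a.A *ᵥ y) i / a.r := by
    simp only [Matrix.mulVec, dotProduct, Finset.sum_div, Matrix.map_apply]
    exact Finset.sum_congr rfl fun j _ => by linear_combination y j * hs i j
  have point_eq (y : Fin n → ℝ) :
      b.point y = a.point (y + (2 * π) • fun j => (((-m) j : ℤ) : ℝ)) := by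
    refine (point_eq_point_iff _ _ _ _).2 ⟨-k, -m, fun i => ?_, rfl⟩
    have difference := hmk i
    rw [param_fst_add_period, param_fst_apply, param_fst_apply, slope_mulVec, mulVec_neg]
    simp only [Pi.neg_apply, Int.cast_neg]
    linear_combination -difference
  refine Set.Subset.antisymm ?_ ?_
  · rintro _ ⟨y, rfl⟩
    exact ⟨y - (2 * π) • fun j => (((-m) j : ℤ) : ℝ), by rw [point_eq, sub_add_cancel]⟩
  · rintro _ ⟨y, rfl⟩
    exact ⟨_, (point_eq y).symm⟩

theorem L_eq_iff {a b : AffData n} : a.L = b.L ↔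
    (∀ i j, (b.A i j : ℝ) / b.r = a.A i j / a.r) ∧
      (fun i => b.p i / b.r - a.p i / a.r) ∈ slopeLattice a.r a.A :=
  ⟨fun h => ⟨slope_apply_eq_of_L_eq h, sub_mem_slopeLattice_of_L_eq h⟩,
    fun h => L_eq_of_sub_mem_slopeLattice h.1 h.2⟩

theorem point_add_period_eq_iff (a : AffData n) (y : Fin n → ℝ) (m : Fin n → ℤ) :
    a.point (y + (2 * π) • fun i => (m i : ℝ)) = a.point y ↔ ∀ i, (a.r : ℤ) ∣ (a.A *ᵥ m) i := by
  have two_pi_ne_zero : (2 * π : ℝ) ≠ 0 := Real.two_pi_pos.ne'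
  have coordinate_iff (k : ℤ) (i : Fin n) : (a.param (y + (2 * π) • fun i => (m i : ℝ))).1 i
      = (a.param y).1 i + k * (2 * π) ↔ (a.A *ᵥ m) i = a.r * -k := by
    rw [param_fst_add_period, sub_eq_add_neg, add_right_inj, mul_div_assoc, ← mul_neg,
      mul_comm (k : ℝ), mul_right_inj' two_pi_ne_zero, neg_eq_iff_eq_neg, div_eq_iff a.r_ne_zero,
      ← @Int.cast_inj ℝ]
    push_cast
    rw [mul_comm (a.r : ℝ)]
  rw [eq_comm, point_eq_point_iff]
  constructor
  · rintro ⟨k, -, hk, -⟩ i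
    exact ⟨-k i, (coordinate_iff _ i).1 (hk i)⟩
  · intro h
    choose k hk using h
    exact ⟨-k, m, fun i => (coordinate_iff _ i).2 (by simp [hk]), rfl⟩

theorem planeWave_dotForm_period_eq_one_iff (β : Fin n → ℝ) (m : Fin n → ℤ) :
    planeWave (dotForm β) ((2 * π) • fun i => (m i : ℝ)) = 1 ↔
      ∃ z : ℤ, β ⬝ᵥ (fun i => (m i : ℝ)) = 2 * π * z := by
  have exponent : dotForm β ((2 * π) • fun i => (m i : ℝ)) / (2 * π)
      = β ⬝ᵥ fun i => (m i : ℝ) := by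
    rw [map_smul, smul_eq_mul, dotForm_apply, mul_div_cancel_left₀ _ Real.two_pi_pos.ne']
  rw [planeWave, exponent]
  simpa using exp_I_eq_iff (β ⬝ᵥ fun i => (m i : ℝ)) 0

theorem factorsThrough_planeWave_iff (a : AffData n) (β : Fin n → ℝ) :
    Function.FactorsThrough (planeWave (dotForm β)) a.point ↔ β ∈ slopeLattice a.r a.Aᵀ := by
  rw [mem_slopeLattice_transpose_iff a.r_pos]
  constructor
  · intro h m hm
    rw [← planeWave_dotForm_period_eq_one_iff]
    simpa only [zero_add, planeWave_zero_right] using h ((a.point_add_period_eq_iff 0 m).2 hm)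
  · intro h y z hyz
    obtain ⟨-, m, -, rfl⟩ := (point_eq_point_iff _ _ _ _).1 hyz
    rw [planeWave_add_right, (planeWave_dotForm_period_eq_one_iff β m).2
      (h m ((a.point_add_period_eq_iff y m).1 hyz.symm)), mul_one]

theorem connForm_sub_tangent (a b : AffData n) (y v : Fin n → ℝ) :
    b.connForm (a.tangent y v) - a.connForm (a.tangent y v)
      = -(Complex.I / (2 * π) * dotForm (fun i => a.q i / a.r - b.q i / b.r) v) := by
  have dotForm_eq : dotForm (fun i => a.q i / a.r - b.q i / b.r) v
      = 1 / (a.r : ℝ) * (a.q ⬝ᵥ v) - 1 / (b.r : ℝ) * (b.q ⬝ᵥ v) := by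
    simp only [dotForm_apply, dotProduct, Finset.mul_sum, ← Finset.sum_sub_distrib]
    exact Finset.sum_congr rfl fun i _ => by ring
  rw [dotForm_eq, connForm, connForm, tangent_eq]
  push_cast
  ring

theorem exists_flat_iff (a : AffData n) (β : Fin n → ℝ) :
    (∃ f : Torus n → ℂ, ContDiff ℝ ∞ (fun y => f (a.point y)) ∧ (∀ y, f (a.point y) ≠ 0) ∧
      ∀ y v, fderiv ℝ (fun x => f (a.point x)) y v
        + -(Complex.I / (2 * π) * dotForm β v) * f (a.point y) = 0) ↔
    β ∈ slopeLattice a.r a.Aᵀ := by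
  rw [← factorsThrough_planeWave_iff]
  constructor
  · rintro ⟨f, hf, f_ne_zero, flat⟩ y z hyz
    have eq_planeWave := eq_planeWave_mul_of_fderiv (hf.differentiable (by simp))
      (ℓ := dotForm β) fun y v => by linear_combination flat y v
    refine mul_right_cancel₀ (f_ne_zero 0) ?_
    rw [← eq_planeWave, ← eq_planeWave, hyz]
  · intro factors
    have extend_point (y : Fin n → ℝ) :
        Function.extend a.point (planeWave (dotForm β)) 0 (a.point y) = planeWave (dotForm β) y :=
      factors.extend_apply 0 y
    refine ⟨Function.extend a.point (planeWave (dotForm β)) 0, ?_, fun y => ?_, fun y v => ?_⟩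
    · simpa only [extend_point] using contDiff_planeWave (dotForm β)
    · rw [extend_point]
      exact planeWave_ne_zero _ y
    · simp only [extend_point]
      rw [(hasFDerivAt_planeWave (dotForm β) y).fderiv]
      simp only [_root_.smul_apply, smul_eq_mul, ContinuousLinearMap.comp_apply,
        Complex.ofRealCLM_apply]
      ring

theorem isomorphic_iff (a b : AffData n) : Isomorphic a b ↔
    (∀ i j, (b.A i j : ℝ) / b.r = a.A i j / a.r) ∧
      (fun i => b.p i / b.r - a.p i / a.r) ∈ slopeLattice a.r a.A ∧
      (fun i => b.q i / b.r - a.q i / a.r) ∈ slopeLattice a.r a.Aᵀ := by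
  have neg_difference : (fun i => b.q i / b.r - a.q i / a.r)
      = -fun i => a.q i / a.r - b.q i / b.r := funext fun i => (neg_sub _ _).symm
  simp only [Isomorphic, L_eq_iff, connForm_sub_tangent, exists_flat_iff, neg_difference,
    neg_mem_iff, and_assoc]

end AffData

/-! ### The mirror correspondence -/

section Mirror

variable {n : ℕ} {T : Matrix (Fin n) (Fin n) ℂ} {δ : Matrix (Fin n) (Fin n) ℤ}

theorem isFukObj_mirrorData (a : Angles n) (E : DGObj T δ) :
    (mirrorData a E).IsFukObj (T - toC δ) :=
  ((mirrorData a E).isFukObj_iff _).2 ((E.data.isHolomorphic_pullback_iff _ T δ).1 E.hol)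

theorem mirrorData_p_sub (a : Angles n) {E E' : DGObj T δ} (hrk : E.data.rk = E'.data.rk) :
    (fun i => (mirrorData a E').p i / ((mirrorData a E').r : ℝ)
        - (mirrorData a E).p i / ((mirrorData a E).r : ℝ))
      = fun i => E'.p i / E'.data.r - E.p i / E.data.r
        - (a.gen E'.data (.inr i) - a.gen E.data (.inr i)) / E.data.rk := by
  funext i
  have hr := E.data.r_ne_zero
  have hr' := E'.data.r_ne_zero
  simp only [mirrorData, Angles.gen, Sum.elim_inr, Pi.sub_apply, Pi.smul_apply, smul_eq_mul, ← hrk]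
  field_simp
  ring

theorem mirrorData_q_sub (a : Angles n) {E E' : DGObj T δ} (hrk : E.data.rk = E'.data.rk) :
    (fun i => (mirrorData a E').q i / ((mirrorData a E').r : ℝ)
        - (mirrorData a E).q i / ((mirrorData a E).r : ℝ))
      = fun i => E'.q i / E'.data.r - E.q i / E.data.r
        + (a.gen E'.data (.inl i) - a.gen E.data (.inl i)) / E.data.rk := by
  funext i
  have hr := E.data.r_ne_zero
  have hr' := E'.data.r_ne_zero
  simp only [mirrorData, Angles.gen, Sum.elim_inl, Pi.add_apply, Pi.smul_apply, smul_eq_mul, ← hrk]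
  field_simp
  ring

theorem isomorphic_mirrorData_iff (hδ : (T - toC δ).det ≠ 0) (hT : HasComplexStructure T)
    {a : Angles n} (ha : a.IsConsistent) (E E' : DGObj T δ) :
    TorusBundle.Isomorphic T E.bundle E'.bundle ↔
      AffData.Isomorphic (mirrorData a E) (mirrorData a E') := by
  have pullback_iff : TorusBundle.Isomorphic T E.bundle E'.bundle ↔
      TorusBundle.Isomorphic (Tprime T δ) (E.data.bundle (muOf (Tprime T δ) E.p E.q))
        (E'.data.bundle (muOf (Tprime T δ) E'.p E'.q)) :=
    TorusBundle.isomorphic_pullback_iff hδ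
  have slope_iff : E.data.SameSlope E'.data ↔ ∀ i j, ((mirrorData a E').A i j : ℝ)
      / (mirrorData a E').r = (mirrorData a E).A i j / (mirrorData a E).r :=
    TransData.sameSlope_iff
  rw [pullback_iff, AffData.isomorphic_iff, ← slope_iff,
    ← and_iff_right_of_imp TransData.sameSlope_of_isomorphic]
  refine and_congr_right fun h => ?_
  have frames := Angles.isConsistent_iff.1 ha _ _ h
  rw [mirrorData_p_sub a frames.size_eq, mirrorData_q_sub a frames.size_eq]
  exact h.isomorphic_iff_mem_slopeLattice (hasComplexStructure_Tprime hδ hT) frames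

theorem exists_mirrorData_eq (hδ : (T - toC δ).det ≠ 0) (hT : HasComplexStructure T)
    (a : Angles n) (x : FukObj (T - toC δ)) : ∃ E : DGObj T δ, mirrorData a E = x.data := by
  obtain ⟨⟨r, hr, A, p, q⟩, hx⟩ := x
  obtain ⟨D, rfl, rfl⟩ := TransData.exists_transData r hr A
  let p' := p + ((D.r : ℝ) / D.rk) • a.θ D
  let q' := q - ((D.r : ℝ) / D.rk) • a.ξ D
  have symmetric := (AffData.isFukObj_iff _ _).1 hx
  have hol := (D.isHolomorphic_pullback_iff (muOf (Tprime T δ) p' q') T δ).2 symmetric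
  have simple := (D.isSimple_bundle (hasComplexStructure_Tprime hδ hT) p' q').pullback hδ
  exact ⟨⟨D, p', q', hol, simple⟩,
    congrArg₂ (AffData.mk D.r hr D.A) (add_sub_cancel_right _ _) (sub_add_cancel _ _)⟩

end Mirror

theorem det_ne_zero_of_dotProduct_mulVec_pos {ι R : Type*} [Fintype ι] [DecidableEq ι]
    [CommRing R] [IsDomain R] [Preorder R] {M : Matrix ι ι R}
    (hM : ∀ x, x ≠ 0 → 0 < x ⬝ᵥ (M *ᵥ x)) : M.det ≠ 0 := fun hdet => by
  obtain ⟨x, hx, hMx⟩ := exists_mulVec_eq_zero_iff.2 hdet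
  exact (hM x hx).ne' (by rw [hMx, dotProduct_zero])

end TorusMirror

end

theorem theorem4p2_general {n : ℕ} (T : Matrix (Fin n) (Fin n) ℂ)
    (hIm : (T.map Complex.im).det ≠ 0)
    (δ : Matrix (Fin n) (Fin n) ℤ)
    (hδ : (T - toC δ).det ≠ 0) :
    ∃ hmap : ∀ (a : Angles n) (E : DGObj T δ), (mirrorData a E).IsFukObj (T - toC δ),
      (∃ a : Angles n, a.IsConsistent) ∧
      ∀ a : Angles n, a.IsConsistent →
        ∃ F : Quotient (DGObj.isoSetoid T δ) → Quotient (FukObj.isoSetoid (T - toC δ)),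
          (∀ E : DGObj T δ, F ⟦E⟧ = ⟦⟨mirrorData a E, hmap a E⟩⟧) ∧
          Function.Bijective F := by
  have hT : HasComplexStructure T := hasComplexStructure_of_det_im_ne_zero hIm
  refine ⟨isFukObj_mirrorData, Angles.exists_isConsistent n, fun a ha => ?_⟩
  have isomorphic_iff := isomorphic_mirrorData_iff hδ hT ha
  refine ⟨Quotient.map (fun E => ⟨mirrorData a E, isFukObj_mirrorData a E⟩)
    fun E E' => (isomorphic_iff E E').1, fun _ => rfl, ?injective, ?surjective⟩
  case injective =>
    rintro ⟨E⟩ ⟨E'⟩ h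
    exact Quotient.sound ((isomorphic_iff E E').2 (Quotient.exact h))
  case surjective =>
    rintro ⟨⟨x, hx⟩⟩
    obtain ⟨E, rfl⟩ := exists_mirrorData_eq hδ hT a ⟨x, hx⟩
    exact ⟨⟦E⟧, rfl⟩

theorem theorem4p2 {n : ℕ} (T : Matrix (Fin n) (Fin n) ℂ)
    (hT : T.det = 0)
    (hIm : ∀ x : Fin n → ℝ, x ≠ 0 → 0 < x ⬝ᵥ (T.map Complex.im *ᵥ x))
    (δ : Matrix (Fin n) (Fin n) ℤ)
    (hδ : (T - toC δ).det ≠ 0) :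
    ∃ hmap : ∀ (a : Angles n) (E : DGObj T δ), (mirrorData a E).IsFukObj (T - toC δ),
      (∃ a : Angles n, a.IsConsistent) ∧
      ∀ a : Angles n, a.IsConsistent →
        ∃ F : Quotient (DGObj.isoSetoid T δ) → Quotient (FukObj.isoSetoid (T - toC δ)),
          (∀ E : DGObj T δ, F ⟦E⟧ = ⟦⟨mirrorData a E, hmap a E⟩⟧) ∧
          Function.Bijective F :=
  theorem4p2_general T (det_ne_zero_of_dotProduct_mulVec_pos hIm) δ hδ
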